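/- **Setting.** Use the seven-qubit Steane code ($n=7$), whose X-type and Z-type generators are both given by the Hamming checks $0001111,\ 0110011,\ 1010101$. A block$_0$ is a qubit and a block$_k$ consists of $7$ subblocks$_{k-1}$. Pauli errors (up to phase) are tracked through the circuits. The state$_0$ of a qubit is its tracked error; the state$_k\in\{I,X,Y,Z\}$ of a block$_k$ is obtained by error-free decoding of the states$_{k-1}$ of its subblocks. The relative states$_{k-1}$ of the subblocks are the minimum weight error (Y counted as two) with the same syndrome as their states$_{k-1}$; a subblock is in relative error if its relative state is not $I$. **Noise.** Each physical CNOT fails independently with probability $p$; on failure one of the sixteen two-qubit Pauli products, with an arbitrary distribution that may depend on the location, is applied after the gate. Everything else is perfect. **Operations.** CNOT$_0$ is the physical gate, Correction$_0$ does nothing, and $|0\rangle_0$ is prepared perfectly; $|+\rangle_k$ is $|0\rangle_k$ followed by transverse Hadamards. For $k\ge1$: * $|0\rangle_k$: twice prepare seven ancillas$_{k-1}$ $|{+}{+}0{+}000\rangle$, apply the encoder (CNOTs$_{k-1}$ from subblock 1 to 3, 5, 7, from 2 to 3, 6, 7, from 4 to 5, 6, 7) and transverse Correction$_{k-1}$;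 apply transverse CNOT$_{k-1}$ from the first copy to the second, measure the second in the Z eigenbasis, decode recursively, and start over unless there is no relative error and the decoded value is $0$. The first copy is kept; if its state$_k$ has a Z-part, a transverse Z, which acts trivially on $|0\rangle_k$, is added to the record. * Correction$_k$: two rounds of the following. Apply transverse Correction$_{k-1}$; apply transverse CNOT$_{k-1}$ into a $|+\rangle_k$, measure it in the Z eigenbasis, decode, and apply transverse X to the subblock found in relative error; then apply transverse CNOT$_{k-1}$ from a $|0\rangle_k$, measure it in the X eigenbasis, decode, and apply transverse Z to the subblock found in relative error. * CNOT$_k$: transverse CNOT$_{k-1}$, then Correction$_k$ on both blocks. **Wellness.** Every block is well$_0$. A block$_k$ is well$_k(p_1,\dots,p_k)$ if at most one subblock, called uncontrolled, is in relative error or not well$_{k-1}(p_1,\dots,p_{k-1})$, and, conditioned on the state$_k$ of the block and on the errors (and uncontrolled subblocks) in all other blocks, the probability that there is an uncontrolled subblock is at most $p_k$. (Which subblock is uncontrolled is a random variable on a possibly enlarged probability space; the other subblocks are well$_{k-1}$ conditioned on everything outside of them, including its value.) **Parameters.** $A_0=B_0=0$, $C_0=p$, and for $k\ge1$ $$N_k=1-14A_{k-1}-14B_{k-1}-25C_{k-1},$$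 $$A_k=\frac{\binom{14}{2}(A_{k-1}^2+B_{k-1}^2)+\binom{25}{2}C_{k-1}^2+14\cdot 25(A_{k-1}+B_{k-1})C_{k-1}+4\cdot 49A_{k-1}B_{k-1}}{N_k},$$ $$a_k=\frac{14(A_{k-1}+B_{k-1})+25C_{k-1}}{(1-A_k)N_k},\quad S_k=4a_k+14B_{k-1}+28C_{k-1},\quad B_k'=4A_k+S_k,\quad b_k=\frac{S_k}{1-B_k'},$$ $$B_k=4A_k+\tbinom{28}{2}C_{k-1}^2+\tbinom42a_k^2+\tbinom{14}{2}B_{k-1}^2+b_kS_k+28C_{k-1}(4a_k+14B_{k-1})+56a_kB_{k-1},\qquad \tilde b_k=\frac{S_k}{1-B_k},$$ $$C_k=\Bigl(2B_k+14C_{k-1}B_k'+\tbinom72C_{k-1}^2\Bigr)+2b_k\bigl(2B_k'+7C_{k-1}\bigr)+b_k^2 .$$ **Claim C$_k$ (CNOT$_k$).** Let $k\ge0$, and suppose that $N_j>0$, $A_j<1$, $B_j<1$, $B_j'<1$ and $\tilde b_j\le b_j$ for $1\le j\le k$. Apply CNOT$_k$ to two blocks$_k$ of a system whose tracked errors have an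 arbitrary joint distribution. Then there is a failure event of probability at most $C_k$ such that, conditioned on no failure, both output blocks are well$_k(b_1,\dots,b_k)$, and, if the input blocks are well$_k(b_1,\dots,b_k)$, the correct logical effect takes place: CNOT$_k$ followed by perfect recursive decoding of both blocks equals perfect recursive decoding followed by a perfect CNOT (up to global phase, for all encoded states, also when entangled with a reference system). -/

import Mathlib

open scoped NNReal ENNReal Matrix

universe u v w

noncomputable section

namespace SteaneFT

/-! ## Pauli errors and the seven-qubit code -/

/-- A Pauli operator up to phase, as (X-part, Z-part): `I = (0,0)`, `X = (1,0)`, `Z = (0,1)`,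
`Y = (1,1)`.  Multiplication up to phase is addition. -/
abbrev Pauli : Type := ZMod 2 × ZMod 2

/-- Parity checks of the `[7,4,3]` Hamming code.  The Z-type generators of the Steane code are
these rows (they detect X-parts), and so are the X-type generators (they detect Z-parts). -/
def checks : Matrix (Fin 3) (Fin 7) (ZMod 2) :=
  !![0, 0, 0, 1, 1, 1, 1;
     0, 1, 1, 0, 0, 1, 1;
     1, 0, 1, 0, 1, 0, 1]

/-- The syndrome of the X-parts (or of the Z-parts) of seven Pauli errors. -/
def syndrome (e : Fin 7 → ZMod 2) : Fin 3 → ZMod 2 := checks *ᵥ e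

/-- The bit pattern of weight at most one with the syndrome of `e`. -/
def minPattern (e : Fin 7 → ZMod 2) : Fin 7 → ZMod 2 :=
  fun j => if ∀ r, checks r j = syndrome e r then 1 else 0

/-- Relative states of seven subblocks with states `s`: the minimum weight error with the
same syndrome (see `relState_spec`). -/
def relState (s : Fin 7 → Pauli) : Fin 7 → Pauli :=
  fun j => (minPattern (fun i => (s i).1) j, minPattern (fun i => (s i).2) j)

/-- Weight of an error pattern, counting a Y error as two. -/
def weight (s : Fin 7 → Pauli) : ℕ :=
  hammingNorm (fun i => (s i).1) + hammingNorm (fun i => (s i).2)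

theorem minPattern_spec : ∀ e : Fin 7 → ZMod 2, syndrome (minPattern e) = syndrome e ∧
    (e ≠ minPattern e → hammingNorm (minPattern e) < hammingNorm e) := by
  decide +kernel

/-- `relState s` is the unique error of minimum weight with the syndrome of `s`. -/
theorem relState_spec (s : Fin 7 → Pauli) :
    (syndrome (fun i => (relState s i).1) = syndrome (fun i => (s i).1) ∧
      syndrome (fun i => (relState s i).2) = syndrome (fun i => (s i).2)) ∧
    ∀ t : Fin 7 → Pauli, syndrome (fun i => (t i).1) = syndrome (fun i => (s i).1) →
      syndrome (fun i => (t i).2) = syndrome (fun i => (s i).2) → t ≠ relState s →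
      weight (relState s) < weight t := by
  refine ⟨⟨(minPattern_spec _).1, (minPattern_spec _).1⟩, fun t h₁ h₂ hne => ?_⟩
  have e₁ : minPattern (fun i => (t i).1) = minPattern (fun i => (s i).1) := by
    funext j; simp only [minPattern, h₁]
  have e₂ : minPattern (fun i => (t i).2) = minPattern (fun i => (s i).2) := by
    funext j; simp only [minPattern, h₂]
  have m₁ := (minPattern_spec (fun i => (t i).1)).2
  have m₂ := (minPattern_spec (fun i => (t i).2)).2
  rw [e₁] at m₁
  rw [e₂] at m₂
  change hammingNorm (minPattern fun i => (s i).1) + hammingNorm (minPattern fun i => (s i).2) <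
    hammingNorm (fun i => (t i).1) + hammingNorm (fun i => (t i).2)
  by_cases c₁ : (fun i => (t i).1) = minPattern (fun i => (s i).1)
  · by_cases c₂ : (fun i => (t i).2) = minPattern (fun i => (s i).2)
    · exact absurd (funext fun i => Prod.ext (congrFun c₁ i) (congrFun c₂ i)) hne
    · have := m₂ c₂
      rw [c₁]
      omega
  · have := m₁ c₁
    by_cases c₂ : (fun i => (t i).2) = minPattern (fun i => (s i).2)
    · rw [c₂]
      omega
    · have := m₂ c₂
      omega

/-- Error-free decoding of one layer.  After the relative error is removed, an error commuting
with all generators is left; it is a stabilizer element or a stabilizer element times a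
transverse logical operator according to the parity of its weight (see `logical_spec`). -/
def logical (s : Fin 7 → Pauli) : Pauli := ∑ j, (s j + relState s j)

/-- A bit pattern of trivial syndrome is a sum of checks if its parity is even, and a sum of
checks plus the all-ones pattern if its parity is odd. -/
theorem logical_spec : ∀ e : Fin 7 → ZMod 2, syndrome e = 0 →
    ∃ c : Fin 3 → ZMod 2, e = c ᵥ* checks + fun _ => ∑ j, e j := by
  decide +kernel

/-! ## Tracked errors in concatenated blocks -/

/-- Tracked Pauli errors of a block of level `k` (`7 ^ k` qubits). -/
def Err : ℕ → Type
  | 0 => Pauli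
  | k + 1 => Fin 7 → Err k

/-- The state of a block: error-free recursive decoding from the bottom up. -/
def state : (k : ℕ) → Err k → Pauli
  | 0, e => e
  | k + 1, e => logical fun i => state k (e i)

/-- Relative states of the seven subblocks of a block of level `k + 1`. -/
def subRel {k : ℕ} (e : Err (k + 1)) : Fin 7 → Pauli := relState fun i => state k (e i)

/-- No error on any qubit. -/
def noError : (k : ℕ) → Err k
  | 0 => (0 : Pauli)
  | k + 1 => fun _ => noError k

/-- Apply the Pauli `P` transversely, that is, to every qubit of the block. -/
def shift : (k : ℕ) → Pauli → Err k → Err k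
  | 0, P, e => (e.1 + P.1, e.2 + P.2)
  | k + 1, P, e => fun i => shift k P (e i)

/-- Transverse Hadamard gates: X and Z errors are exchanged on every qubit. -/
def hadamard : (k : ℕ) → Err k → Err k
  | 0, e => (e.2, e.1)
  | k + 1, e => fun i => hadamard k (e i)

/-- Propagation through a CNOT gate (first component: control): X errors are copied forward,
Z errors backward. -/
def propagate (e : Pauli × Pauli) : Pauli × Pauli :=
  ((e.1.1, e.1.2 + e.2.2), (e.1.1 + e.2.1, e.2.2))

/-! ## Noise -/

/-- The base error model.  A physical CNOT gate fails with probability `p`, independently of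
everything else.  When it fails, one of the sixteen Pauli products, chosen according to `q`, is
applied after the gate; `q` is arbitrary and may depend on the location of the gate in the
circuit (a label).  Everything else is perfect. -/
structure Noise where
  p : ℝ≥0
  p_le_one : p ≤ 1
  q : List ℕ → PMF (Pauli × Pauli)

/-- A coin that shows `true` with probability `p`. -/
def coin (p : ℝ≥0) (hp : p ≤ 1) : PMF Bool :=
  PMF.ofFintype (fun c => if c then (p : ℝ≥0∞) else ((1 - p : ℝ≥0) : ℝ≥0∞)) (by
    simp only [Fintype.sum_bool, if_true, Bool.false_eq_true, if_false]
    exact_mod_cast add_tsub_cancel_of_le hp)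

/-- The physical CNOT gate at location `loc`, acting on tracked errors. -/
def physicalCNOT (N : Noise) (loc : List ℕ) (e : Pauli × Pauli) : PMF (Pauli × Pauli) :=
  (coin N.p N.p_le_one).bind fun fails =>
    if fails then (N.q loc).map fun d => propagate e + d else PMF.pure (propagate e)

/-- Independent experiments, one for each index. -/
def indep {α : Type} : (n : ℕ) → (Fin n → PMF α) → PMF (Fin n → α)
  | 0, _ => PMF.pure Fin.elim0
  | n + 1, f => (f 0).bind fun x =>
      (indep n fun i => f i.succ).bind fun xs => PMF.pure (Fin.cons x xs)

open Classical in
/-- The result of repeating an experiment until `S` happens: the law conditioned on `S`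
(only meaningful when `S` has positive probability). -/
def postselect {α : Type} (μ : PMF α) (S : Set α) : PMF α :=
  if h : ∃ a ∈ S, a ∈ μ.support then μ.filter S h else μ

/-! ## Transverse measurements and classical decoding

An ideal ancilla measured transversely shows a random codeword of the concatenated classical code;
the tracked errors disturb this string, by their X-parts in the Z eigenbasis and by their Z-parts
in the X eigenbasis.  The experimenter sees only the disturbed string. -/

/-- Outcome strings of a transverse measurement of a block. -/
def Bits : ℕ → Type
  | 0 => ZMod 2
  | k + 1 => Fin 7 → Bits k

/-- Bitwise sum. -/
def Bits.xor : {k : ℕ} → Bits k → Bits k → Bits k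
  | 0, m, d => (show ZMod 2 from m) + (show ZMod 2 from d)
  | _ + 1, m, d => fun i => (m i).xor (d i)

/-- The X-parts of tracked errors. -/
def xPart : {k : ℕ} → Err k → Bits k
  | 0, e => e.1
  | _ + 1, e => fun i => xPart (e i)

/-- The Z-parts of tracked errors. -/
def zPart : {k : ℕ} → Err k → Bits k
  | 0, e => e.2
  | _ + 1, e => fun i => zPart (e i)

/-- Ideal outcome string of a block with logical outcome `b`: on each layer a uniformly random
sum of checks, plus the all-ones pattern if `b = 1`. -/
def codeword : (k : ℕ) → ZMod 2 → PMF (Bits k)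
  | 0, b => PMF.pure b
  | k + 1, b => (PMF.uniformOfFintype (Fin 3 → ZMod 2)).bind fun c =>
      indep 7 fun i => codeword k ((c ᵥ* checks) i + b)

/-- Ideal outcome string when the logical outcome is uniformly random (`|+⟩` in the Z eigenbasis,
`|0⟩` in the X eigenbasis). -/
def randomCodeword (k : ℕ) : PMF (Bits k) :=
  (PMF.uniformOfFintype (ZMod 2)).bind fun b => codeword k b

/-- Classical decoding of an outcome string, from the bottom up. -/
def value : (k : ℕ) → Bits k → ZMod 2
  | 0, m => m
  | k + 1, m => ∑ j, (value k (m j) + minPattern (fun i => value k (m i)) j)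

/-- The subblock (if any) that the decoded outcomes show to be in relative error. -/
def relFlips {k : ℕ} (m : Bits (k + 1)) : Fin 7 → ZMod 2 := minPattern fun i => value k (m i)

/-! ## Encoded operations, acting on tracked errors -/

/-- The encoded operations of level `k`: preparation of the ancilla `|0⟩`, error correction and
CNOT (control, target).  The label is the location. -/
structure Ops (k : ℕ) where
  zero : List ℕ → PMF (Err k)
  correct : List ℕ → Err k → PMF (Err k)
  cnot : List ℕ → Err k × Err k → PMF (Err k × Err k)

/-- The ancilla `|+⟩`: transverse Hadamard gates applied to `|0⟩`. -/
def Ops.plus {k : ℕ} (o : Ops k) (loc : List ℕ) : PMF (Err k) :=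
  (o.zero loc).map (hadamard k)

/-- Transverse CNOT from the first block to the second, subblock by subblock. -/
def transverseCNOT {k : ℕ} (o : Ops k) (loc : List ℕ) (c t : Err (k + 1)) :
    PMF (Err (k + 1) × Err (k + 1)) :=
  (indep 7 fun i => o.cnot (i.val :: loc) (c i, t i)).map fun r =>
    (fun i => (r i).1, fun i => (r i).2)

/-- Transverse error correction of the subblocks. -/
def transverseCorrect {k : ℕ} (o : Ops k) (loc : List ℕ) (e : Err (k + 1)) :
    PMF (Err (k + 1)) :=
  indep 7 fun i => o.correct (i.val :: loc) (e i)

/-- A sequence of CNOTs (control, target) between subblocks of the same block. -/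
def network {k : ℕ} (o : Ops k) (loc : List ℕ) :
    List (Fin 7 × Fin 7) → Err (k + 1) → PMF (Err (k + 1))
  | [], e => PMF.pure e
  | g :: gs, e => (o.cnot (gs.length :: loc) (e g.1, e g.2)).bind fun r =>
      network o loc gs (Function.update (Function.update e g.1 r.1) g.2 r.2)

/-- The nine CNOTs that encode `|0⟩` in the Steane code from `|+⟩|+⟩|0⟩|+⟩|0⟩|0⟩|0⟩`. -/
def encoder : List (Fin 7 × Fin 7) :=
  [(0, 2), (0, 4), (0, 6), (1, 2), (1, 5), (1, 6), (3, 4), (3, 5), (3, 6)]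

/-- The unverified ancilla `|0⟩` of level `k + 1`: prepare seven ancillas of level `k`, apply the
encoder, then correct the subblocks. -/
def unverified {k : ℕ} (o : Ops k) (loc : List ℕ) : PMF (Err (k + 1)) :=
  (indep 7 fun i => if i = 0 ∨ i = 1 ∨ i = 3 then o.plus (i.val :: 0 :: loc)
    else o.zero (i.val :: 0 :: loc)).bind fun e =>
      (network o (1 :: loc) encoder e).bind fun e' => transverseCorrect o (2 :: loc) e'

/-- The outcomes for the second copy, measured in the Z eigenbasis, show no relative error and
the logical value `0`. -/
def accepted {k : ℕ} (m : Bits (k + 1)) : Prop :=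
  (∀ i, relFlips m i = 0) ∧ value (k + 1) m = 0

/-- Bookkeeping for `|0⟩`: logical Z acts trivially on `|0⟩`, so if the state has a Z-part, a
transverse Z is added to the record. -/
def bookkeep {k : ℕ} (e : Err k) : Err k := shift k (0, (state k e).2) e

/-- Preparation of the verified ancilla `|0⟩` of level `k + 1`: two unverified copies, transverse
CNOT from the first to the second, measurement of the second, start over unless accepted. -/
def prepareZero {k : ℕ} (o : Ops k) (loc : List ℕ) : PMF (Err (k + 1)) :=
  (postselect
    ((unverified o (0 :: loc)).bind fun e₁ =>
      (unverified o (1 :: loc)).bind fun e₂ =>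
      (transverseCNOT o (2 :: loc) e₁ e₂).bind fun r =>
      (codeword (k + 1) 0).map fun c => (r.1, c.xor (xPart r.2)))
    {r : Err (k + 1) × Bits (k + 1) | accepted r.2}).map fun r => bookkeep r.1

/-- One round of error correction at level `k + 1`: transverse corrections of the subblocks; then
transverse CNOTs into a `|+⟩` ancilla, which is measured in the Z eigenbasis, and transverse X on
the subblock found in relative X error; then transverse CNOTs from a `|0⟩` ancilla, which is
measured in the X eigenbasis, and transverse Z on the subblock found in relative Z error. -/
def correctionRound {k : ℕ} (o : Ops k) (loc : List ℕ) (e : Err (k + 1)) :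
    PMF (Err (k + 1)) :=
  (transverseCorrect o (0 :: loc) e).bind fun e₁ =>
  (prepareZero o (1 :: loc)).bind fun a =>
  (transverseCNOT o (2 :: loc) e₁ (hadamard (k + 1) a)).bind fun r =>
  (randomCodeword (k + 1)).bind fun c =>
  let x := relFlips (c.xor (xPart r.2))
  let e₂ : Err (k + 1) := fun i => shift k (x i, 0) (r.1 i)
  (prepareZero o (3 :: loc)).bind fun b =>
  (transverseCNOT o (4 :: loc) b e₂).bind fun r' =>
  (randomCodeword (k + 1)).map fun c' =>
  let z := relFlips (c'.xor (zPart r'.1))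
  fun i => shift k (0, z i) (r'.2 i)

/-- Error correction at level `k + 1`: two rounds. -/
def correction {k : ℕ} (o : Ops k) (loc : List ℕ) (e : Err (k + 1)) : PMF (Err (k + 1)) :=
  (correctionRound o (0 :: loc) e).bind fun e' => correctionRound o (1 :: loc) e'

/-- CNOT at level `k + 1`: transverse CNOT of level `k`, then error correction of both blocks. -/
def encodedCNOT {k : ℕ} (o : Ops k) (loc : List ℕ) (e : Err (k + 1) × Err (k + 1)) :
    PMF (Err (k + 1) × Err (k + 1)) :=
  (transverseCNOT o (0 :: loc) e.1 e.2).bind fun r =>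
  (correction o (1 :: loc) r.1).bind fun f₁ =>
  (correction o (2 :: loc) r.2).map fun f₂ => (f₁, f₂)

/-- The operations of all levels.  At level `0`, ancillas are perfect, there is no error
correction, and CNOT is the physical gate. -/
def ops (N : Noise) : (k : ℕ) → Ops k
  | 0 => { zero := fun _ => PMF.pure (noError 0)
           correct := fun _ e => PMF.pure e
           cnot := physicalCNOT N }
  | k + 1 => { zero := prepareZero (ops N k)
               correct := correction (ops N k)
               cnot := encodedCNOT (ops N k) }

/-! ## Wellness -/

/-- The probability of an event. -/
def prob {Ω : Type u} (μ : PMF Ω) (S : Set Ω) : ℝ := (μ.toOuterMeasure S).toReal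

/-- A block of level `k` with its errors, and with the information, for the block and for the
blocks nested in it, which subblock (at most one) is uncontrolled. -/
def Cfg : ℕ → Type
  | 0 => Pauli
  | k + 1 => Option (Fin 7) × (Fin 7 → Cfg k)

/-- The errors alone. -/
def Cfg.err : {k : ℕ} → Cfg k → Err k
  | 0, e => e
  | _ + 1, c => fun i => (c.2 i).err

/-- The block `X` is well with parameters `p 1, …, p k`, on the event `D` (that is, for the law
`μ` conditioned on `D`), where `env` is everything outside the block.  At most one subblock, the
uncontrolled one, is in relative error or not well; conditioned on the state of the block and on
`env`, an uncontrolled subblock exists with probability at most `p k`; and every other subblock is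
well when everything outside of it, including which subblock is uncontrolled, is given. -/
def Well {Ω : Type u} (μ : PMF Ω) (p : ℕ → ℝ) :
    (k : ℕ) → {W : Type v} → (D : Set Ω) → (X : Ω → Cfg k) → (env : Ω → W) → Prop
  | 0, _, _, _, _ => True
  | k + 1, W, D, X, env =>
      (∀ ω ∈ μ.support, ω ∈ D → ∀ i, (X ω).1 ≠ some i → subRel (X ω).err i = 0) ∧
      (∀ (s : Pauli) (x : W),
        prob μ {ω | ω ∈ D ∧ state (k + 1) (X ω).err = s ∧ env ω = x ∧ (X ω).1 ≠ none} ≤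
          p (k + 1) * prob μ {ω | ω ∈ D ∧ state (k + 1) (X ω).err = s ∧ env ω = x}) ∧
      ∀ i : Fin 7, Well μ p k (W := W × Option (Fin 7) × ({j : Fin 7 // j ≠ i} → Cfg k))
        {ω | ω ∈ D ∧ (X ω).1 ≠ some i} (fun ω => (X ω).2 i)
        (fun ω => (env ω, (X ω).1, fun j => (X ω).2 j))

/-- Two blocks are well on the event `D`: each of them is, given the other one and the rest `R` of
the system. -/
def PairWell {Ω : Type u} {W : Type v} (μ : PMF Ω) (p : ℕ → ℝ) (k : ℕ) (D : Set Ω)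
    (X Y : Ω → Cfg k) (R : Ω → W) : Prop :=
  Well μ p k D X (fun ω => (Y ω, R ω)) ∧ Well μ p k D Y (fun ω => (X ω, R ω))

/-- Two input blocks, in a system whose errors have joint law `μ` (first block, second block,
rest), are well with parameters `p 1, …, p k`, for some choice of uncontrolled subblocks. -/
def InputsWell {W : Type v} (p : ℕ → ℝ) (k : ℕ) (μ : PMF ((Err k × Err k) × W)) : Prop :=
  ∃ ν : PMF ((Cfg k × Cfg k) × W), ν.map (fun x => ((x.1.1.err, x.1.2.err), x.2)) = μ ∧
    PairWell ν p k Set.univ (fun x => x.1.1) (fun x => x.1.2) (fun x => x.2)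

/-! ## Logical effect -/

/-- State vectors of two logical qubits and a reference system with basis `S`. -/
abbrev LogicalVec (S : Type) : Type := (ZMod 2 × ZMod 2) × S → ℂ

/-- `1` or `-1`. -/
def sign (a : ZMod 2) : ℂ := if a = 0 then 1 else -1

/-- The Pauli product `P ⊗ Q` acting on the two logical qubits (as Z-part after X-part). -/
def pauliAct {S : Type} (P Q : Pauli) (ψ : LogicalVec S) : LogicalVec S :=
  fun x => sign (P.2 * x.1.1) * sign (Q.2 * x.1.2) * ψ ((x.1.1 - P.1, x.1.2 - Q.1), x.2)

/-- The perfect CNOT, `|a, b⟩ ↦ |a, a + b⟩`, on the two logical qubits. -/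
def cnotAct {S : Type} (ψ : LogicalVec S) : LogicalVec S :=
  fun x => ψ ((x.1.1, x.1.2 - x.1.1), x.2)

/-- Perfect recursive decoding of two blocks with tracked errors `e.1`, `e.2` on top of the
encoding of `ψ`. -/
def decode {k : ℕ} {S : Type} (e : Err k × Err k) (ψ : LogicalVec S) : LogicalVec S :=
  pauliAct (state k e.1) (state k e.2) ψ

/-- An encoded CNOT that turns the tracked errors `e` into `f` has the correct logical effect:
for every encoded state, possibly entangled with a reference system, applying it and decoding
is the same, up to a global phase, as decoding and applying the perfect CNOT. -/
def CorrectCNOT {k : ℕ} (e f : Err k × Err k) : Prop :=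
  ∀ (S : Type) (ψ : LogicalVec S), ∃ c : ℂ, ‖c‖ = 1 ∧
    decode f (cnotAct ψ) = c • cnotAct (decode e ψ)

/-! ## Failure and wellness parameters -/

/-- The parameters of one level: `A`, `B`, `B'`, `C` bound failure probabilities of ancilla
preparation, error correction (`B'` for inputs with one arbitrary subblock) and CNOT; `a` and `b`
are wellness parameters of ancillas and of blocks leaving an error correction; `accept` bounds the
acceptance probability of an ancilla from below; `bTilde` is the lower bound required of `b`. -/
structure Rates where
  accept : ℝ
  A : ℝ
  a : ℝ
  B : ℝ
  B' : ℝ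
  bTilde : ℝ
  b : ℝ
  C : ℝ

/-- The recursion for the parameters, with `n = 7` and `s(n) = 9`. -/
def rates (p : ℝ) : ℕ → Rates
  | 0 => { accept := 1, A := 0, a := 0, B := 0, B' := 0, bTilde := 0, b := 0, C := p }
  | k + 1 =>
      let n : ℝ := 7
      let m : ℝ := 2 * 9 + 7
      let A₀ := (rates p k).A
      let B₀ := (rates p k).B
      let C₀ := (rates p k).C
      let accept := 1 - 2 * n * A₀ - 2 * n * B₀ - m * C₀
      let A := (Nat.choose 14 2 * (A₀ ^ 2 + B₀ ^ 2) + Nat.choose 25 2 * C₀ ^ 2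
        + 2 * n * m * (A₀ + B₀) * C₀ + 4 * n ^ 2 * A₀ * B₀) / accept
      let a := (2 * n * (A₀ + B₀) + m * C₀) / ((1 - A) * accept)
      let single := 4 * a + 2 * n * B₀ + 4 * n * C₀
      let B' := 4 * A + single
      let b := single / (1 - B')
      let B := 4 * A + Nat.choose 28 2 * C₀ ^ 2 + Nat.choose 4 2 * a ^ 2
        + Nat.choose 14 2 * B₀ ^ 2 + b * (4 * n * C₀ + 4 * a + 2 * n * B₀)
        + 4 * n * C₀ * (4 * a + 2 * n * B₀) + 8 * n * a * B₀
      let bTilde := single / (1 - B)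
      let C := (2 * B + 2 * n * C₀ * B' + Nat.choose 7 2 * C₀ ^ 2)
        + 2 * b * (2 * B' + n * C₀) + b ^ 2
      { accept := accept, A := A, a := a, B := B, B' := B', bTilde := bTilde, b := b, C := C }

/-- The parameter range of interest at a level: denominators are positive and `b` is at least
`bTilde`. -/
structure Rates.InRange (r : Rates) : Prop where
  accept_pos : 0 < r.accept
  A_lt_one : r.A < 1
  B_lt_one : r.B < 1
  B'_lt_one : r.B' < 1
  bTilde_le : r.bTilde ≤ r.b

/-! ## Runs of the encoded CNOT -/

/-- A run: the errors of the two input blocks, the rest of the system, the two output blocks, and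
whether the operation is declared to have failed. -/
structure Run (k : ℕ) (W : Type v) where
  input : Err k × Err k
  rest : W
  out₁ : Cfg k
  out₂ : Cfg k
  failed : Bool

/-- The errors of the output blocks. -/
def Run.output {k : ℕ} {W : Type v} (r : Run k W) : Err k × Err k := (r.out₁.err, r.out₂.err)

/-- Joint law of the input errors, the rest of the system and the output errors when the encoded
CNOT of level `k` at location `loc` is applied to the blocks of a system with law `μ`. -/
def cnotLaw {W : Type v} (N : Noise) (k : ℕ) (loc : List ℕ) (μ : PMF ((Err k × Err k) × W)) :
    PMF (((Err k × Err k) × W) × (Err k × Err k)) :=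
  μ.bind fun x => ((ops N k).cnot loc x.1).map fun f => (x, f)

end SteaneFT

end

open SteaneFT

namespace SteaneFT
noncomputable section

/-! ## Masses and expectations -/

/-! Wellness combines a statement about every single run (an untagged subblock has no relative error
and is itself well) with a statement about probabilities (tags are rare, given the state and the
surroundings). The proof separates the two. `Valid` is the first, a property of one configuration;
`TW` is the second, a property of the unnormalized law of a configuration. The inequalities in `TW`
are homogeneous, so conditioning on the surroundings is just fixing coordinates of a mass. Such
masses form a cone (`TW.tsum`) and may be cut down to any event determined by the state
(`TW.restrict`).

Each operation is replaced by an instrumented one that acts on errors with tags and raises a flag on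
failure; forgetting tags and flag gives back the real operation. `AncSpec`, `CorrSpec` and
`CnotSpec` are proved together by induction on the level. For corrections and CNOTs the output is
`TW` for each fixed input and each flag, unflagged outputs are valid for each input, the logical
effect is right for valid inputs without a flag, and the failure probability is bounded on average
over `TW` inputs. Failed outputs lose all tags, which makes `TW` trivial for them.

Inside level `k + 1`, a failure at level `k` is a fault, recorded with its place, or as `none` if it
occurs before or in the encoder and may spread. Because operations emit `TW` masses given the record
so far, the next operation always sees admissible inputs, and two successive faults cost the product
of their bounds although they are dependent (`Pres.bd_mul`, `Rates3.comp`). Operations fail only if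
two faults occur, where tagged inputs and tagged ancillas count as faults, or if a part fails that
itself needed two faults. This makes the recursion quadratic.

One fault is harmless by properties of the Hamming code. A pattern that is a codeword outside one
place (`Near`) decodes correctly and is corrected at that place only. A fault-free round removes all
relative errors whatever came in (`halfK_clean`); a round with all faults at one place preserves a
state known outside it (`halfK_near`). With two rounds and at most one fault, one round is clean, so
validity of the output needs nothing of the input (`corrK_valid`), and only a fault of the second
round leaves a tag (`corrK_tw_tag`). In an ancilla, the X-part caused by one spreading fault is
exposed by the second copy, and the remaining Z-part is, up to stabilizers and logical Z, an error
on one subblock (`DoubleSpec.ancOut_valid`). In a CNOT, one tag or one failed gate affects the same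
place of both blocks, which the corrections tolerate (`cnotK_state`, `cnotK_fail`).

At the ends, well inputs become `TW` once tags inside uncontrolled subblocks are erased (`Well.tw`).
Arbitrary inputs are simply left untagged, hence `TW`, which is why the failure bound and the
wellness of the outputs need no assumption on them (`exists_input`, `well_of_tw`). -/

/-- The indicator of a proposition. -/
def ind (P : Prop) : ℝ≥0∞ := by classical exact if P then 1 else 0

theorem ind_true {P : Prop} (h : P) : ind P = 1 := by simp [ind, h]

theorem ind_false {P : Prop} (h : ¬P) : ind P = 0 := by simp [ind, h]

theorem ind_le_one (P : Prop) : ind P ≤ 1 := by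
  by_cases h : P <;> simp [ind, h]

theorem ind_mono {P Q : Prop} (h : P → Q) : ind P ≤ ind Q := by
  by_cases hP : P
  · simp [ind, hP, h hP]
  · simp [ind, hP]

theorem ind_congr {P Q : Prop} (h : P ↔ Q) : ind P = ind Q := by rw [propext h]

theorem ind_and (P Q : Prop) : ind (P ∧ Q) = ind P * ind Q := by
  by_cases hP : P <;> by_cases hQ : Q <;> simp [ind, hP, hQ]

theorem ind_or_le (P Q : Prop) : ind (P ∨ Q) ≤ ind P + ind Q := by
  by_cases hP : P <;> by_cases hQ : Q <;> simp [ind, hP, hQ]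

/-- Integral of `φ` against the mass `m`. -/
def E {α : Type u} (m φ : α → ℝ≥0∞) : ℝ≥0∞ := ∑' a, m a * φ a

/-- Total mass. -/
def mass {α : Type u} (m : α → ℝ≥0∞) : ℝ≥0∞ := ∑' a, m a

section E

variable {α : Type u} {β : Type v}

theorem E_mono {m φ ψ : α → ℝ≥0∞} (h : ∀ a, φ a ≤ ψ a) : E m φ ≤ E m ψ :=
  ENNReal.tsum_le_tsum fun a => mul_le_mul_right (h a) _

theorem E_mono_support {m φ ψ : α → ℝ≥0∞} (h : ∀ a, m a ≠ 0 → φ a ≤ ψ a) : E m φ ≤ E m ψ := by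
  refine ENNReal.tsum_le_tsum fun a => ?_
  by_cases ha : m a = 0
  · simp [ha]
  · exact mul_le_mul_right (h a ha) _

theorem E_add (m φ ψ : α → ℝ≥0∞) : E m (fun a => φ a + ψ a) = E m φ + E m ψ := by
  simp only [E, mul_add, ENNReal.tsum_add]

theorem E_mul_left (m φ : α → ℝ≥0∞) (c : ℝ≥0∞) : E m (fun a => c * φ a) = c * E m φ := by
  simp only [E, ← ENNReal.tsum_mul_left]
  exact tsum_congr fun a => by ring

theorem E_mul_right (m φ : α → ℝ≥0∞) (c : ℝ≥0∞) : E m (fun a => φ a * c) = E m φ * c := by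
  simp only [E, ← ENNReal.tsum_mul_right]
  exact tsum_congr fun a => by ring

theorem E_one (m : α → ℝ≥0∞) : E m (fun _ => 1) = mass m := by simp [E, mass]

theorem E_const (m : α → ℝ≥0∞) (c : ℝ≥0∞) : E m (fun _ => c) = c * mass m := by
  simp only [E, mass, ENNReal.tsum_mul_right, mul_comm c]

theorem E_zero (m : α → ℝ≥0∞) : E m (fun _ => 0) = 0 := by simp [E]

theorem E_ind_le (m : α → ℝ≥0∞) (P : α → Prop) : E m (fun a => ind (P a)) ≤ mass m := by
  rw [← E_one]; exact E_mono fun a => ind_le_one _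

theorem E_finset_sum {ι : Type*} (s : Finset ι) (m : α → ℝ≥0∞) (φ : ι → α → ℝ≥0∞) :
    E m (fun a => ∑ i ∈ s, φ i a) = ∑ i ∈ s, E m (φ i) := by
  simp only [E, Finset.mul_sum]
  exact Summable.tsum_finsetSum fun i _ => ENNReal.summable

theorem mass_pmf (μ : PMF α) : mass μ = 1 := μ.tsum_coe

theorem E_pure (a : α) (φ : α → ℝ≥0∞) : E (PMF.pure a) φ = φ a := by
  classical
  simp only [E, PMF.pure_apply]
  rw [tsum_eq_single a]
  · simp
  · intro b hb; simp [hb]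

theorem E_bind (μ : PMF α) (f : α → PMF β) (φ : β → ℝ≥0∞) :
    E (μ.bind f) φ = E μ (fun a => E (f a) φ) := by
  simp only [E, PMF.bind_apply, ← ENNReal.tsum_mul_right, ← ENNReal.tsum_mul_left]
  rw [ENNReal.tsum_comm]
  exact tsum_congr fun a => tsum_congr fun b => by ring

theorem E_map (μ : PMF α) (f : α → β) (φ : β → ℝ≥0∞) :
    E (μ.map f) φ = E μ (fun a => φ (f a)) := by
  rw [PMF.map, E_bind]
  congr 1; funext a; exact E_pure _ _

theorem apply_eq_E (m : α → ℝ≥0∞) (a : α) : m a = E m (fun x => ind (x = a)) := by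
  rw [E, tsum_eq_single a]
  · simp [ind]
  · intro b hb; simp [ind, hb]

theorem map_apply_E (μ : PMF α) (f : α → β) (b : β) :
    (μ.map f) b = E μ (fun a => ind (f a = b)) := by
  rw [apply_eq_E (μ.map f) b, E_map]

theorem bind_apply_E (μ : PMF α) (f : α → PMF β) (b : β) :
    (μ.bind f) b = E μ (fun a => f a b) := rfl

theorem E_prod (m : α × β → ℝ≥0∞) (φ : α × β → ℝ≥0∞) :
    E m φ = ∑' a, ∑' b, m (a, b) * φ (a, b) := ENNReal.tsum_prod' (f := fun x => m x * φ x)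

theorem mass_prod (m : α × β → ℝ≥0∞) : mass m = ∑' a, ∑' b, m (a, b) :=
  ENNReal.tsum_prod' (f := m)

/-- An event of probability one may be inserted. -/
theorem E_le_of_pmf {μ : PMF α} {φ : α → ℝ≥0∞} {c : ℝ≥0∞} (h : ∀ a ∈ μ.support, φ a ≤ c) :
    E μ φ ≤ c := by
  calc E μ φ ≤ E μ (fun _ => c) := E_mono_support fun a ha => h a ((PMF.mem_support_iff _ _).2 ha)
    _ = c := by rw [E_const, mass_pmf, mul_one]

end E

/-! ## Kernels with a fault record -/

/-- A record of faults: their places (`none` for a fault that may spread), and whether an ancilla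
of the own level has failed. -/
abbrev Rec : Type := List (Option (Fin 7)) × Bool

/-- Concatenation of records. -/
def Rec.append (r s : Rec) : Rec := (r.1 ++ s.1, r.2 || s.2)

section Kernels

variable {α β γ : Type}

/-- Composition of experiments with fault records. -/
def wbind (μ : PMF (α × Rec)) (f : α → PMF (β × Rec)) : PMF (β × Rec) :=
  μ.bind fun x => (f x.1).map fun y => (y.1, x.2.append y.2)

theorem mem_support_wbind {μ : PMF (α × Rec)} {f : α → PMF (β × Rec)} {b : β} {r : Rec} :
    (b, r) ∈ (wbind μ f).support ↔ ∃ a s t, (a, s) ∈ μ.support ∧ (b, t) ∈ (f a).support ∧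
      r = s.append t := by
  simp only [wbind, PMF.mem_support_bind_iff, PMF.mem_support_map_iff]
  constructor
  · rintro ⟨⟨a, s⟩, h, ⟨b', t⟩, h', e⟩
    obtain ⟨rfl, rfl⟩ := Prod.ext_iff.1 e
    exact ⟨a, s, t, h, h', rfl⟩
  · rintro ⟨a, s, t, h, h', rfl⟩
    exact ⟨(a, s), h, (b, t), h', rfl⟩

theorem E_wbind (μ : PMF (α × Rec)) (f : α → PMF (β × Rec)) (φ : β × Rec → ℝ≥0∞) :
    E (wbind μ f) φ = E μ (fun x => E (f x.1) (fun y => φ (y.1, x.2.append y.2))) := by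
  rw [wbind, E_bind]
  congr 1; funext x; rw [E_map]

/-- `I`-masses are turned into `J`-masses, for every record. -/
def Pres (I : (α → ℝ≥0∞) → Prop) (K : α → PMF (β × Rec)) (J : (β → ℝ≥0∞) → Prop) : Prop :=
  ∀ m, I m → ∀ r, J (fun b => ∑' a, m a * K a (b, r))

/-- The function `ψ` has average at most `e` for `I`-masses. -/
def Bd (I : (α → ℝ≥0∞) → Prop) (ψ : α → ℝ≥0∞) (e : ℝ≥0∞) : Prop :=
  ∀ m, I m → E m ψ ≤ e * mass m

/-- Closure under weighted sums. -/
def IsCone (I : (α → ℝ≥0∞) → Prop) : Prop :=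
  ∀ (ι : Type) (w : ι → ℝ≥0∞) (m : ι → α → ℝ≥0∞), (∀ i, I (m i)) → I (fun a => ∑' i, w i * m i a)

/-- Bounds for the probability of at least one fault, of at least two faults and of a failed
ancilla. -/
structure Rates3 (I : (α → ℝ≥0∞) → Prop) (K : α → PMF (β × Rec)) (e₁ e₂ eA : ℝ≥0∞) : Prop where
  one : Bd I (fun a => E (K a) (fun x => ind (1 ≤ x.2.1.length))) e₁
  two : Bd I (fun a => E (K a) (fun x => ind (2 ≤ x.2.1.length))) e₂
  anc : Bd I (fun a => E (K a) (fun x => ind (x.2.2 = true))) eA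

theorem Bd.mono {I : (α → ℝ≥0∞) → Prop} {φ ψ : α → ℝ≥0∞} {e e' : ℝ≥0∞} (h : Bd I ψ e)
    (hφ : ∀ a, φ a ≤ ψ a) (he : e ≤ e') : Bd I φ e' := fun m hm =>
  (E_mono hφ).trans ((h m hm).trans (mul_le_mul_left he _))

theorem Bd.add {I : (α → ℝ≥0∞) → Prop} {φ ψ : α → ℝ≥0∞} {e e' : ℝ≥0∞} (h : Bd I φ e)
    (h' : Bd I ψ e') : Bd I (fun a => φ a + ψ a) (e + e') := fun m hm => by
  rw [E_add, add_mul]; exact add_le_add (h m hm) (h' m hm)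

theorem Bd.zero {I : (α → ℝ≥0∞) → Prop} : Bd I (fun _ => 0) 0 := fun m _ => by
  simp [E_zero]

theorem Bd.sum {I : (α → ℝ≥0∞) → Prop} {ι : Type*} (s : Finset ι) {φ : ι → α → ℝ≥0∞} {e : ℝ≥0∞}
    (h : ∀ i ∈ s, Bd I (φ i) e) : Bd I (fun a => ∑ i ∈ s, φ i a) (s.card * e) := fun m hm => by
  rw [E_finset_sum]
  refine (Finset.sum_le_sum fun i hi => h i hi m hm).trans ?_
  rw [Finset.sum_const, nsmul_eq_mul, mul_assoc]

theorem Pres.of_forall {I : (α → ℝ≥0∞) → Prop} {K : α → PMF (β × Rec)} {J : (β → ℝ≥0∞) → Prop}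
    (hJ : IsCone J) (h : ∀ a r, J (fun b => K a (b, r))) : Pres I K J := fun m _ r =>
  hJ α m (fun a b => K a (b, r)) fun a => h a r

/-- For each fixed record the output is a `J`-mass, so the bound on `ψ` holds on that slice and may
be weighted by any function of the record. This bounds later events given earlier faults, without
independence. -/
theorem Pres.bd_mul {I : (α → ℝ≥0∞) → Prop} {K : α → PMF (β × Rec)} {J : (β → ℝ≥0∞) → Prop}
    (h : Pres I K J) {ψ : β → ℝ≥0∞} {e : ℝ≥0∞} (hψ : Bd J ψ e) (φ : Rec → ℝ≥0∞)
    {m : α → ℝ≥0∞} (hm : I m) :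
    E m (fun a => E (K a) (fun x => φ x.2 * ψ x.1)) ≤ e * E m (fun a => E (K a) (fun x => φ x.2)) := by
  have key : ∀ χ : β → ℝ≥0∞, E m (fun a => E (K a) (fun x => φ x.2 * χ x.1)) =
      ∑' r, φ r * E (fun b => ∑' a, m a * K a (b, r)) χ := by
    intro χ
    simp only [E, ENNReal.tsum_prod', ← ENNReal.tsum_mul_left, ← ENNReal.tsum_mul_right]
    have : ∀ F : α → β → List (Option (Fin 7)) → Bool → ℝ≥0∞,
        ∑' a, ∑' b, ∑' l, ∑' f, F a b l f = ∑' l, ∑' f, ∑' b, ∑' a, F a b l f := by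
      intro F
      calc ∑' a, ∑' b, ∑' l, ∑' f, F a b l f = ∑' b, ∑' a, ∑' l, ∑' f, F a b l f :=
            ENNReal.tsum_comm
        _ = ∑' b, ∑' l, ∑' a, ∑' f, F a b l f := tsum_congr fun b => ENNReal.tsum_comm
        _ = ∑' l, ∑' b, ∑' a, ∑' f, F a b l f := ENNReal.tsum_comm
        _ = ∑' l, ∑' b, ∑' f, ∑' a, F a b l f :=
            tsum_congr fun l => tsum_congr fun b => ENNReal.tsum_comm
        _ = ∑' l, ∑' f, ∑' b, ∑' a, F a b l f := tsum_congr fun l => ENNReal.tsum_comm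
    rw [this]
    exact tsum_congr fun l => tsum_congr fun f => tsum_congr fun b => tsum_congr fun a => by ring
  have k1 := key (fun _ => 1)
  simp only [mul_one] at k1
  rw [key, k1, ← ENNReal.tsum_mul_left]
  refine ENNReal.tsum_le_tsum fun r => ?_
  rw [E_one]
  calc φ r * E _ ψ ≤ φ r * (e * mass _) := mul_le_mul_right (hψ _ (h m hm r)) _
    _ = _ := by ring

/-- A composite record is a concatenation, so the output slice is a sum, over pairs of records, of
slices of `L` applied to slices of `K`; the cone property of `M` absorbs the sum. -/
theorem Pres.comp {I : (α → ℝ≥0∞) → Prop} {K : α → PMF (β × Rec)} {J : (β → ℝ≥0∞) → Prop}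
    {L : β → PMF (γ × Rec)} {M : (γ → ℝ≥0∞) → Prop} (hM : IsCone M)
    (h : Pres I K J) (h' : Pres J L M) : Pres I (fun a => wbind (K a) L) M := by
  intro m hm r
  have e : (fun c => ∑' a, m a * (wbind (K a) L) (c, r)) = fun c => ∑' x : Rec × Rec,
      ind (x.1.append x.2 = r) * ∑' b, (∑' a, m a * K a (b, x.1)) * L b (c, x.2) := by
    funext c
    have e1 : ∀ a, (wbind (K a) L) (c, r) = ∑' b, ∑' s, ∑' t,
        K a (b, s) * (L b (c, t) * ind (s.append t = r)) := by
      intro a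
      rw [wbind, bind_apply_E, E_prod]
      refine tsum_congr fun b => tsum_congr fun s => ?_
      rw [map_apply_E, E_prod, tsum_eq_single c, ENNReal.tsum_mul_left]
      · congr 1
        exact tsum_congr fun t => by simp [Prod.ext_iff]
      · intro c' hc'
        simp [Prod.ext_iff, hc', ind]
    simp only [e1, ENNReal.tsum_prod', ← ENNReal.tsum_mul_left, ← ENNReal.tsum_mul_right]
    have : ∀ F : α → β → Rec → Rec → ℝ≥0∞,
        ∑' a, ∑' b, ∑' s, ∑' t, F a b s t = ∑' s, ∑' t, ∑' b, ∑' a, F a b s t := by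
      intro F
      calc ∑' a, ∑' b, ∑' l, ∑' f, F a b l f = ∑' b, ∑' a, ∑' l, ∑' f, F a b l f :=
            ENNReal.tsum_comm
        _ = ∑' b, ∑' l, ∑' a, ∑' f, F a b l f := tsum_congr fun b => ENNReal.tsum_comm
        _ = ∑' l, ∑' b, ∑' a, ∑' f, F a b l f := ENNReal.tsum_comm
        _ = ∑' l, ∑' b, ∑' f, ∑' a, F a b l f :=
            tsum_congr fun l => tsum_congr fun b => ENNReal.tsum_comm
        _ = ∑' l, ∑' f, ∑' b, ∑' a, F a b l f := tsum_congr fun l => ENNReal.tsum_comm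
    have e2 := this fun a b s t => m a * (K a (b, s) * (L b (c, t) * ind (s.append t = r)))
    simp only [ENNReal.tsum_prod'] at e2
    rw [e2]
    refine tsum_congr fun s => tsum_congr fun s' => tsum_congr fun t => tsum_congr fun t' => ?_
    exact tsum_congr fun b => tsum_congr fun a => by ring
  rw [e]
  exact hM _ _ _ fun x => h' _ (h m hm x.1) x.2

/-- Two faults are two in the first part, two in the second, or one in each. The mixed case gives a
product because the second part sees a `J`-mass even given that the first had a fault. -/
theorem Rates3.comp {I : (α → ℝ≥0∞) → Prop} {K : α → PMF (β × Rec)} {J : (β → ℝ≥0∞) → Prop}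
    {L : β → PMF (γ × Rec)} {e₁ e₂ eA f₁ f₂ fA : ℝ≥0∞} (hP : Pres I K J)
    (h : Rates3 I K e₁ e₂ eA) (h' : Rates3 J L f₁ f₂ fA) :
    Rates3 I (fun a => wbind (K a) L) (e₁ + f₁) (e₂ + f₂ + e₁ * f₁) (eA + fA) := by
  have tr : ∀ {ψ : β → ℝ≥0∞} {e : ℝ≥0∞}, Bd J ψ e →
      Bd I (fun a => E (K a) (fun x => ψ x.1)) e := by
    intro ψ e hψ m hm
    have := hP.bd_mul hψ (fun _ => 1) hm
    simp only [one_mul, E_one, mass_pmf] at this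
    exact this
  refine ⟨?_, ?_, ?_⟩
  · refine (h.one.add (tr h'.one)).mono (fun a => ?_) le_rfl
    rw [E_wbind, ← E_add]
    refine E_mono fun x => ?_
    by_cases hx : 1 ≤ x.2.1.length
    · rw [ind_true hx]
      exact le_add_right (E_le_of_pmf fun _ _ => ind_le_one _)
    · refine le_add_left (E_mono fun y => ind_mono ?_)
      simp only [Rec.append, List.length_append]; omega
  · have h12 : Bd I (fun a => E (K a) (fun x => ind (1 ≤ x.2.1.length) *
        E (L x.1) (fun y => ind (1 ≤ y.2.1.length)))) (e₁ * f₁) := by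
      intro m hm
      refine (hP.bd_mul h'.one (fun r => ind (1 ≤ r.1.length)) hm).trans ?_
      calc f₁ * _ ≤ f₁ * (e₁ * mass m) := mul_le_mul_right (h.one m hm) _
        _ = _ := by ring
    refine ((h.two.add (tr h'.two)).add h12).mono (fun a => ?_) le_rfl
    rw [E_wbind, ← E_add, ← E_add]
    refine E_mono fun x => ?_
    rw [← E_mul_left, add_assoc, ← E_add]
    by_cases hx : 2 ≤ x.2.1.length
    · rw [ind_true hx]
      exact le_add_right (E_le_of_pmf fun _ _ => ind_le_one _)
    · refine le_add_left (E_mono fun y => ?_)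
      rw [← ind_and]
      refine (ind_mono ?_).trans (ind_or_le _ _)
      simp only [Rec.append, List.length_append]; omega
  · refine (h.anc.add (tr h'.anc)).mono (fun a => ?_) le_rfl
    rw [E_wbind, ← E_add]
    refine E_mono fun x => ?_
    by_cases hx : x.2.2 = true
    · rw [ind_true hx]
      exact le_add_right (E_le_of_pmf fun _ _ => ind_le_one _)
    · refine le_add_left (E_mono fun y => ind_mono ?_)
      simp [Rec.append, hx]

end Kernels

/-! ## States and tags -/

theorem E_tsum {α : Type u} {ι : Type v} (w : ι → ℝ≥0∞) (m : ι → α → ℝ≥0∞) (φ : α → ℝ≥0∞) :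
    E (fun a => ∑' i, w i * m i a) φ = ∑' i, w i * E (m i) φ := by
  simp only [E, ← ENNReal.tsum_mul_left, ← ENNReal.tsum_mul_right]
  rw [ENNReal.tsum_comm]
  exact tsum_congr fun i => tsum_congr fun a => by ring

theorem E_comp_involutive {α : Type u} {f : α → α} (hf : Function.Involutive f)
    (m φ : α → ℝ≥0∞) : E (fun a => m (f a)) φ = E m (fun a => φ (f a)) := by
  rw [E, ← (hf.toPerm f).tsum_eq]
  exact tsum_congr fun a => by simp [hf a]

/-- The tag of a configuration: its uncontrolled subblock, if any. -/
def tagC {k : ℕ} (c : Cfg (k + 1)) : Option (Fin 7) := c.1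

/-- The configurations of the subblocks. -/
def subC {k : ℕ} (c : Cfg (k + 1)) : Fin 7 → Cfg k := c.2

/-- A configuration from its tag and its subblocks. -/
def mkC {k : ℕ} (t : Option (Fin 7)) (g : Fin 7 → Cfg k) : Cfg (k + 1) := (t, g)

@[simp] theorem tagC_mkC {k : ℕ} (t : Option (Fin 7)) (g : Fin 7 → Cfg k) :
    tagC (mkC t g) = t := rfl

@[simp] theorem subC_mkC {k : ℕ} (t : Option (Fin 7)) (g : Fin 7 → Cfg k) :
    subC (mkC t g) = g := rfl

/-- The states of the subblocks. -/
def states {k : ℕ} (g : Fin 7 → Cfg k) : Fin 7 → Pauli := fun i => state k (g i).err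

theorem state_succ {k : ℕ} (c : Cfg (k + 1)) : state (k + 1) c.err = logical (states (subC c)) := rfl

theorem subRel_eq {k : ℕ} (c : Cfg (k + 1)) : subRel c.err = relState (states (subC c)) := rfl

theorem states_update {k : ℕ} (g : Fin 7 → Cfg k) (i : Fin 7) (x : Cfg k) :
    states (Function.update g i x) = Function.update (states g) i (state k x.err) := by
  funext j
  by_cases h : j = i
  · subst h; simp [states]
  · simp [states, h]

/-- The configuration without uncontrolled subblocks. -/
def untag : (k : ℕ) → Err k → Cfg k
  | 0, e => e
  | k + 1, e => mkC none fun i => untag k (e i)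

theorem untag_err : ∀ (k : ℕ) (e : Err k), (untag k e).err = e
  | 0, _ => rfl
  | k + 1, e => funext fun i => untag_err k (e i)

/-- Every subblock that is not tagged as uncontrolled is valid and not in relative error. -/
def Valid : (k : ℕ) → Cfg k → Prop
  | 0, _ => True
  | k + 1, c => ∀ i, tagC c ≠ some i → subRel c.err i = 0 ∧ Valid k (subC c i)

/-- Transverse Pauli, on configurations. -/
def shiftC : (k : ℕ) → Pauli → Cfg k → Cfg k
  | 0, P, e => shift 0 P e
  | k + 1, P, c => mkC (tagC c) fun i => shiftC k P (subC c i)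

/-- Transverse Hadamard, on configurations. -/
def hadamardC : (k : ℕ) → Cfg k → Cfg k
  | 0, e => hadamard 0 e
  | k + 1, c => mkC (tagC c) fun i => hadamardC k (subC c i)

theorem shiftC_err : ∀ (k : ℕ) (P : Pauli) (c : Cfg k), (shiftC k P c).err = shift k P c.err
  | 0, _, _ => rfl
  | k + 1, P, c => funext fun i => shiftC_err k P (subC c i)

theorem hadamardC_err : ∀ (k : ℕ) (c : Cfg k), (hadamardC k c).err = hadamard k c.err
  | 0, _ => rfl
  | k + 1, c => funext fun i => hadamardC_err k (subC c i)

theorem shiftC_shiftC : ∀ (k : ℕ) (P : Pauli) (c : Cfg k), shiftC k P (shiftC k P c) = c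
  | 0, P, (x, z) => by
    change (x + P.1 + P.1, z + P.2 + P.2) = (x, z)
    simp [add_assoc, CharTwo.add_self_eq_zero]
  | k + 1, P, (t, g) => by
    change (t, fun i => shiftC k P (shiftC k P (g i))) = (t, g)
    simp only [shiftC_shiftC k]

theorem hadamardC_hadamardC : ∀ (k : ℕ) (c : Cfg k), hadamardC k (hadamardC k c) = c
  | 0, (_, _) => rfl
  | k + 1, (t, g) => by
    change (t, fun i => hadamardC k (hadamardC k (g i))) = (t, g)
    simp only [hadamardC_hadamardC k]

/-! ### The Hamming code -/

theorem syndrome_add (e f : Fin 7 → ZMod 2) : syndrome (e + f) = syndrome e + syndrome f :=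
  Matrix.mulVec_add _ _ _

theorem minPattern_congr {e f : Fin 7 → ZMod 2} (h : syndrome e = syndrome f) :
    minPattern e = minPattern f := by
  funext j; simp only [minPattern, h]

theorem syndrome_const (a : ZMod 2) : syndrome (fun _ => a) = 0 := by
  revert a; decide +kernel

theorem minPattern_zero : minPattern 0 = 0 := by decide +kernel

/-- The columns of the check matrix are distinct and nonzero, so single errors are their own coset
leaders. -/
theorem minPattern_single : ∀ (t : Fin 7) (a : ZMod 2),
    minPattern (Pi.single t a) = Pi.single t a := by decide +kernel

theorem syndrome_vecMul : ∀ c : Fin 3 → ZMod 2, syndrome (c ᵥ* checks) = 0 := by decide +kernel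

theorem sum_vecMul : ∀ c : Fin 3 → ZMod 2, ∑ i, (c ᵥ* checks) i = 0 := by decide +kernel

theorem syndrome_minPattern (e : Fin 7 → ZMod 2) : syndrome (minPattern e) = syndrome e :=
  (minPattern_spec e).1

/-- Error-free decoding of a bit pattern. -/
def decodeBit (e : Fin 7 → ZMod 2) : ZMod 2 := ∑ j, (e j + minPattern e j)

/-- A summand of trivial syndrome does not move the coset leader, so only its parity enters. -/
theorem decodeBit_add {e f : Fin 7 → ZMod 2} (hf : syndrome f = 0) :
    decodeBit (e + f) = decodeBit e + ∑ j, f j := by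
  have : minPattern (e + f) = minPattern e :=
    minPattern_congr (by rw [syndrome_add, hf, add_zero])
  simp only [decodeBit, this, Pi.add_apply, ← Finset.sum_add_distrib]
  exact Finset.sum_congr rfl fun j _ => by ring

theorem minPattern_of_syndrome {f : Fin 7 → ZMod 2} (hf : syndrome f = 0) : minPattern f = 0 := by
  rw [← minPattern_zero]
  exact minPattern_congr (by rw [hf]; exact (Matrix.mulVec_zero _).symm)

theorem syndrome_of_minPattern {f : Fin 7 → ZMod 2} (hf : minPattern f = 0) : syndrome f = 0 := by
  rw [← syndrome_minPattern, hf]; exact Matrix.mulVec_zero _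

theorem decodeBit_of_syndrome {f : Fin 7 → ZMod 2} (hf : syndrome f = 0) :
    decodeBit f = ∑ j, f j := by
  simp [decodeBit, minPattern_of_syndrome hf]

theorem sum_const7 (a : ZMod 2) : ∑ _j : Fin 7, a = a := by
  revert a; decide

/-- X-parts. -/
def xs (s : Fin 7 → Pauli) : Fin 7 → ZMod 2 := fun i => (s i).1

/-- Z-parts. -/
def zs (s : Fin 7 → Pauli) : Fin 7 → ZMod 2 := fun i => (s i).2

theorem logical_eq (s : Fin 7 → Pauli) : logical s = (decodeBit (xs s), decodeBit (zs s)) := by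
  rw [Prod.ext_iff]
  simp only [logical, Prod.fst_sum, Prod.snd_sum]
  exact ⟨rfl, rfl⟩

/-- Constant patterns have trivial syndrome, and their parity is the constant because seven is odd.
-/
theorem logical_add_const (s : Fin 7 → Pauli) (P : Pauli) :
    logical (fun i => s i + P) = logical s + P := by
  have h1 : xs (fun i => s i + P) = xs s + fun _ => P.1 := rfl
  have h2 : zs (fun i => s i + P) = zs s + fun _ => P.2 := rfl
  rw [logical_eq, logical_eq, h1, h2, decodeBit_add (syndrome_const _),
    decodeBit_add (syndrome_const _), sum_const7, sum_const7]
  rfl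

theorem relState_add_const (s : Fin 7 → Pauli) (P : Pauli) :
    relState (fun i => s i + P) = relState s := by
  funext j
  have h1 : minPattern (xs s + fun _ => P.1) = minPattern (xs s) :=
    minPattern_congr (by rw [syndrome_add, syndrome_const, add_zero])
  have h2 : minPattern (zs s + fun _ => P.2) = minPattern (zs s) :=
    minPattern_congr (by rw [syndrome_add, syndrome_const, add_zero])
  exact Prod.ext (congrFun h1 j) (congrFun h2 j)

theorem state_shift : ∀ (k : ℕ) (P : Pauli) (e : Err k), state k (shift k P e) = state k e + P
  | 0, _, _ => rfl
  | k + 1, P, e => by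
    change logical (fun i => state k (shift k P (e i))) = logical (fun i => state k (e i)) + P
    simp only [state_shift k]
    exact logical_add_const _ P

theorem state_hadamard : ∀ (k : ℕ) (e : Err k), state k (hadamard k e) = (state k e).swap
  | 0, _ => rfl
  | k + 1, e => by
    change logical (fun i => state k (hadamard k (e i))) = (logical (fun i => state k (e i))).swap
    simp only [state_hadamard k, logical_eq]
    rfl

theorem state_shiftC {k : ℕ} (P : Pauli) (c : Cfg k) :
    state k (shiftC k P c).err = state k c.err + P := by
  rw [shiftC_err, state_shift]

theorem state_hadamardC {k : ℕ} (c : Cfg k) :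
    state k (hadamardC k c).err = (state k c.err).swap := by
  rw [hadamardC_err, state_hadamard]

theorem valid_shiftC : ∀ (k : ℕ) (P : Pauli) {c : Cfg k}, Valid k c → Valid k (shiftC k P c)
  | 0, _, _, _ => trivial
  | k + 1, P, c, h => fun i hi => by
    obtain ⟨h1, h2⟩ := h i hi
    refine ⟨?_, valid_shiftC k P h2⟩
    rw [subRel_eq] at h1 ⊢
    have : states (subC (shiftC (k + 1) P c)) = fun i => states (subC c) i + P :=
      funext fun j => state_shiftC P (subC c j)
    rw [this, relState_add_const, h1]

theorem valid_hadamardC : ∀ (k : ℕ) {c : Cfg k}, Valid k c → Valid k (hadamardC k c)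
  | 0, _, _ => trivial
  | k + 1, c, h => fun i hi => by
    obtain ⟨h1, h2⟩ := h i hi
    refine ⟨?_, valid_hadamardC k h2⟩
    rw [subRel_eq] at h1 ⊢
    have : states (subC (hadamardC (k + 1) c)) = fun i => (states (subC c) i).swap :=
      funext fun j => state_hadamardC (subC c j)
    rw [this]
    exact Prod.ext (congrArg Prod.snd h1) (congrArg Prod.fst h1)

/-! ## Tag-wellness -/

/-- The probabilistic part of wellness of a block whose configuration has law `m` (not
normalized): a subblock is tagged with probability at most `p k`, given the state, and each
subblock is tag-well given the tag and the other subblocks. -/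
def TW (p : ℕ → ℝ≥0∞) : (k : ℕ) → (Cfg k → ℝ≥0∞) → Prop
  | 0, _ => True
  | k + 1, m =>
      (∀ s, E m (fun c : Cfg (k + 1) => ind (state (k + 1) c.err = s ∧ tagC c ≠ none)) ≤
        p (k + 1) * E m (fun c => ind (state (k + 1) c.err = s))) ∧
      ∀ (t : Option (Fin 7)) (i : Fin 7) (g : Fin 7 → Cfg k),
        TW p k (fun x => m (mkC t (Function.update g i x)))

section TagWell

variable {p : ℕ → ℝ≥0∞}

/-- The defining inequalities are linear in the mass. Averaging over hidden variables is therefore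
harmless. -/
theorem TW.tsum {ι : Type v} (w : ι → ℝ≥0∞) : ∀ (k : ℕ) {m : ι → Cfg k → ℝ≥0∞},
    (∀ i, TW p k (m i)) → TW p k (fun x => ∑' i, w i * m i x)
  | 0, _, _ => trivial
  | k + 1, m, h => by
    refine ⟨fun s => ?_, fun t i g => TW.tsum w k fun j => (h j).2 t i g⟩
    rw [E_tsum, E_tsum, ← ENNReal.tsum_mul_left]
    refine ENNReal.tsum_le_tsum fun i => ?_
    calc w i * _ ≤ w i * (p (k + 1) * _) := mul_le_mul_right ((h i).1 s) _
      _ = _ := by ring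

theorem TW.isCone (k : ℕ) : IsCone (TW p k) := fun _ w _ h => TW.tsum w k h

theorem TW.smul {k : ℕ} {m : Cfg k → ℝ≥0∞} (h : TW p k m) (w : ℝ≥0∞) :
    TW p k (fun x => w * m x) := by
  simpa using TW.tsum (ι := Unit) (fun _ => w) k (m := fun _ => m) fun _ => h

theorem TW.zero (k : ℕ) : TW p k (fun _ => 0) := by
  simpa using TW.tsum (p := p) (ι := Empty) (fun _ => 0) k (m := fun _ _ => 0) (fun i => i.elim)

/-- Tags are bounded for each state separately, so whole states may be discarded. In the recursion
the siblings are fixed, and the state of the block is then a function of the state of the remaining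
subblock. -/
theorem TW.restrict : ∀ {k : ℕ} {m : Cfg k → ℝ≥0∞}, TW p k m → ∀ S : Pauli → Prop,
    TW p k (fun x => m x * ind (S (state k x.err)))
  | 0, _, _, _ => trivial
  | k + 1, m, h, S => by
    refine ⟨fun s => ?_, fun t i g => ?_⟩
    · have e1 : ∀ Q : Cfg (k + 1) → Prop,
          E (fun c => m c * ind (S (state (k + 1) c.err)))
            (fun c => ind (state (k + 1) c.err = s ∧ Q c)) =
          ind (S s) * E m (fun c => ind (state (k + 1) c.err = s ∧ Q c)) := by
        intro Q
        rw [← E_mul_left]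
        refine tsum_congr fun c => ?_
        by_cases hs : state (k + 1) c.err = s
        · simp only [hs]; ring
        · simp [ind, hs]
      have e2 := e1 (fun c => tagC c ≠ none)
      have e3 := e1 (fun _ => True)
      simp only [and_true] at e3
      rw [e2, e3]
      calc ind (S s) * _ ≤ ind (S s) * (p (k + 1) * _) := mul_le_mul_right (h.1 s) _
        _ = _ := by ring
    · have := (h.2 t i g).restrict (fun P => S (logical (Function.update (states g) i P)))
      have e : ∀ x : Cfg k, state (k + 1)
          (mkC t (Function.update g i x)).err =
          logical (Function.update (states g) i (state k x.err)) := by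
        intro x
        rw [state_succ, ← states_update]; rfl
      simp only [e]
      exact this

/-- Without tags the bounded quantities vanish at every depth. This serves failed outputs and inputs
about which nothing is known. -/
theorem TW.of_untagged : ∀ {k : ℕ} {m : Cfg k → ℝ≥0∞},
    (∀ x, m x ≠ 0 → x = untag k x.err) → TW p k m
  | 0, _, _ => trivial
  | k + 1, m, h => by
    refine ⟨fun s => ?_, fun t i g => TW.of_untagged fun x hx => ?_⟩
    · have : E m (fun c => ind (state (k + 1) c.err = s ∧ tagC c ≠ none)) = 0 := by
        rw [← E_zero m]
        refine le_antisymm (E_mono_support fun c hc => ?_) (by simp [E_zero])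
        rw [ind_false]
        rintro ⟨-, h'⟩
        rw [h c hc] at h'
        exact h' rfl
      rw [this]; exact zero_le
    · have e : Function.update g i x = fun j => untag k _ := congrArg subC (h _ hx)
      have e' := congrFun e i
      simp only [Function.update_self] at e'
      rw [e']
      simp [untag_err]

/-- An involution that acts subblock by subblock, keeps tags and moves states by `σ` only permutes
the inequalities. It is used for transverse Paulis and Hadamard gates. -/
theorem TW.relabel (φ : ∀ k, Cfg k → Cfg k) (σ : Pauli → Pauli)
    (hφ : ∀ k (c : Cfg (k + 1)), φ (k + 1) c = mkC (tagC c) fun i => φ k (subC c i))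
    (hinv : ∀ k, Function.Involutive (φ k)) (hσ : Function.Involutive σ)
    (hs : ∀ k (c : Cfg k), state k (φ k c).err = σ (state k c.err)) :
    ∀ {k : ℕ} {m : Cfg k → ℝ≥0∞}, TW p k m → TW p k (fun x => m (φ k x))
  | 0, _, _ => trivial
  | k + 1, m, h => by
    refine ⟨fun s => ?_, fun t i g => ?_⟩
    · rw [E_comp_involutive (hinv _), E_comp_involutive (hinv _)]
      have := h.1 (σ s)
      have e : ∀ a, σ a = s ↔ a = σ s := fun a => ⟨fun h => by rw [← h, hσ], fun h => by rw [h, hσ]⟩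
      have e' : ∀ c : Cfg (k + 1), tagC (φ (k + 1) c) = tagC c := fun c => by rw [hφ]; rfl
      simpa only [hs, e, e'] using this
    · have := TW.relabel φ σ hφ hinv hσ hs (h.2 t i (fun j => φ k (g j)))
      have e : ∀ x, φ (k + 1) (mkC t (Function.update g i x)) =
          mkC t (Function.update (fun j => φ k (g j)) i (φ k x)) := by
        intro x
        rw [hφ]
        congr 1
        funext j
        by_cases hj : j = i
        · subst hj; simp
        · simp [hj]
      simpa only [e] using this

theorem TW.shiftC {k : ℕ} {m : Cfg k → ℝ≥0∞} (h : TW p k m) (P : Pauli) :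
    TW p k (fun x => m (SteaneFT.shiftC k P x)) :=
  TW.relabel (fun k => SteaneFT.shiftC k P) (· + P) (fun _ _ => rfl) (fun k => shiftC_shiftC k P)
    (fun a => by change a + P + P = a; rw [add_assoc, CharTwo.add_self_eq_zero, add_zero]) (fun _ c => state_shiftC P c) h

theorem TW.hadamardC {k : ℕ} {m : Cfg k → ℝ≥0∞} (h : TW p k m) :
    TW p k (fun x => m (SteaneFT.hadamardC k x)) :=
  TW.relabel SteaneFT.hadamardC Prod.swap (fun _ _ => rfl) hadamardC_hadamardC
    Prod.swap_swap (fun _ c => state_hadamardC c) h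

theorem TW.tag_le {k : ℕ} {m : Cfg (k + 1) → ℝ≥0∞} (h : TW p (k + 1) m) :
    E m (fun c => ind (tagC c ≠ none)) ≤ p (k + 1) * mass m := by
  have e : ∀ Q : Cfg (k + 1) → Prop, E m (fun c => ind (Q c)) =
      ∑ s : Pauli, E m (fun c => ind (state (k + 1) c.err = s ∧ Q c)) := by
    intro Q
    rw [← E_finset_sum]
    congr 1; funext c
    rw [Finset.sum_eq_single (state (k + 1) c.err)]
    · simp
    · intro s _ hs; simp [ind, hs.symm]
    · simp
  have e' := e (fun _ => True)
  simp only [and_true, ind_true trivial, E_one] at e'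
  rw [e, e', Finset.mul_sum]
  exact Finset.sum_le_sum fun s _ => h.1 s

/-- Two objects whose joint law is an `I`-mass in each of them, given the other. -/
def PairOf {X : Type} (I : (X → ℝ≥0∞) → Prop) (m : X × X → ℝ≥0∞) : Prop :=
  (∀ y, I (fun x => m (x, y))) ∧ ∀ x, I (fun y => m (x, y))

/-- Two blocks, each tag-well given the other. -/
abbrev PairTW (p : ℕ → ℝ≥0∞) (k : ℕ) (m : Cfg k × Cfg k → ℝ≥0∞) : Prop := PairOf (TW p k) m

theorem PairOf.isCone {X : Type} {I : (X → ℝ≥0∞) → Prop} (hI : IsCone I) : IsCone (PairOf I) :=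
  fun ι w _ h => ⟨fun y => hI ι w _ fun i => (h i).1 y, fun x => hI ι w _ fun i => (h i).2 x⟩

end TagWell

/-! ## Seven registers -/

section Registers

variable {X Y : Type}

/-- Functions with the value `x₀` at `i` serve as representatives of the remaining coordinates; the
inner sum runs over the value at `i`. -/
theorem tsum_update (i : Fin 7) (x₀ : X) (F : (Fin 7 → X) → ℝ≥0∞) :
    ∑' g, F g = ∑' g : Fin 7 → X, ind (g i = x₀) * ∑' x, F (Function.update g i x) := by
  have h : ∀ g : Fin 7 → X, F g = ∑' y : (Fin 7 → X) × X,
      ind (y.1 i = x₀ ∧ Function.update y.1 i y.2 = g) * F g := by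
    intro g
    rw [tsum_eq_single (Function.update g i x₀, g i)]
    · simp [ind]
    · rintro ⟨g', x⟩ hne
      rw [ind_false, zero_mul]
      rintro ⟨h1, rfl⟩
      apply hne
      simp [← h1]
  calc ∑' g, F g = ∑' y : (Fin 7 → X) × X, ∑' g,
        ind (y.1 i = x₀ ∧ Function.update y.1 i y.2 = g) * F g := by
        rw [ENNReal.tsum_comm]; exact tsum_congr h
    _ = ∑' y : (Fin 7 → X) × X, ind (y.1 i = x₀) * F (Function.update y.1 i y.2) := by
        refine tsum_congr fun y => ?_
        rw [tsum_eq_single (Function.update y.1 i y.2)]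
        · simp
        · intro g hg; simp [ind, hg.symm]
    _ = _ := by
        rw [ENNReal.tsum_prod']
        simp only [ENNReal.tsum_mul_left]

/-- Each register has an `I`-mass as its law, given the others. -/
def Inv (I : (X → ℝ≥0∞) → Prop) (m : (Fin 7 → X) → ℝ≥0∞) : Prop :=
  ∀ i g, I (fun x => m (Function.update g i x))

theorem Inv.isCone {I : (X → ℝ≥0∞) → Prop} (hI : IsCone I) : IsCone (Inv I) :=
  fun ι w _ h i g => hI ι w _ fun j => h j i g

/-- With the other registers frozen, `χ` is a constant and the law of register `i` is an `I`-mass.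
-/
theorem Inv.bd_mul {I : (X → ℝ≥0∞) → Prop} {ψ : X → ℝ≥0∞} {ε : ℝ≥0∞} (hψ : Bd I ψ ε)
    {m : (Fin 7 → X) → ℝ≥0∞} (hm : Inv I m) (i : Fin 7) {χ : (Fin 7 → X) → ℝ≥0∞}
    (hχ : ∀ g x, χ (Function.update g i x) = χ g) :
    E m (fun g => ψ (g i) * χ g) ≤ ε * E m χ := by
  rcases isEmpty_or_nonempty X with hX | ⟨⟨x₀⟩⟩
  · simp [E]
  · rw [E, E, tsum_update i x₀ (fun g => m g * (ψ (g i) * χ g)),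
      tsum_update i x₀ (fun g => m g * χ g), ← ENNReal.tsum_mul_left]
    refine ENNReal.tsum_le_tsum fun g => ?_
    have e1 : ∑' x, m (Function.update g i x) *
        (ψ (Function.update g i x i) * χ (Function.update g i x)) =
        E (fun x => m (Function.update g i x)) ψ * χ g := by
      rw [E, ← ENNReal.tsum_mul_right]
      exact tsum_congr fun x => by rw [hχ, Function.update_self]; ring
    have e2 : ∑' x, m (Function.update g i x) * χ (Function.update g i x) =
        mass (fun x => m (Function.update g i x)) * χ g := by
      rw [mass, ← ENNReal.tsum_mul_right]
      exact tsum_congr fun x => by rw [hχ]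
    rw [e1, e2]
    calc ind (g i = x₀) * (E (fun x => m (Function.update g i x)) ψ * χ g)
        ≤ ind (g i = x₀) * ((ε * mass (fun x => m (Function.update g i x))) * χ g) :=
          mul_le_mul_right (mul_le_mul_left (hψ _ (hm i g)) _) _
      _ = _ := by ring

theorem Inv.bd {I : (X → ℝ≥0∞) → Prop} {ψ : X → ℝ≥0∞} {ε : ℝ≥0∞} (hψ : Bd I ψ ε) (i : Fin 7) :
    Bd (Inv I) (fun g => ψ (g i)) ε := fun m hm => by
  simpa [E_one] using hm.bd_mul hψ i (χ := fun _ => 1) fun _ _ => rfl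

/-- Freezing the other five registers leaves a mass in two variables which is an `I`-mass in each,
given the other. -/
theorem Inv.bd_pair {I : (X → ℝ≥0∞) → Prop} {ψ : X × X → ℝ≥0∞} {ε : ℝ≥0∞}
    (hψ : Bd (PairOf I) ψ ε) {i j : Fin 7} (hij : i ≠ j) :
    Bd (Inv I) (fun g => ψ (g i, g j)) ε := fun m hm => by
  rcases isEmpty_or_nonempty X with hX | ⟨⟨x₀⟩⟩
  · simp [E]
  · rw [E, mass, tsum_update i x₀ (fun g => m g * ψ (g i, g j)), tsum_update i x₀ m,
      tsum_update j x₀ (fun g => ind (g i = x₀) * ∑' x, m (Function.update g i x)),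
      tsum_update j x₀ (fun g => ind (g i = x₀) * ∑' x, m (Function.update g i x) *
        ψ (Function.update g i x i, Function.update g i x j)), ← ENNReal.tsum_mul_left]
    refine ENNReal.tsum_le_tsum fun g => ?_
    simp only [Function.update_self, Function.update_of_ne hij, Function.update_of_ne hij.symm,
      ENNReal.tsum_mul_left]
    have := hψ (fun x => m (Function.update (Function.update g j x.2) i x.1))
      ⟨fun y => hm i (Function.update g j y), fun x => by
        simp only [Function.update_comm hij.symm]; exact hm j (Function.update g i x)⟩
    rw [E_prod, mass_prod, ENNReal.tsum_comm, ENNReal.tsum_comm (f := fun a b =>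
      m (Function.update (Function.update g j b) i a))] at this
    calc _ ≤ ind (g j = x₀) * (ind (g i = x₀) * _) :=
          mul_le_mul_right (mul_le_mul_right this _) _
      _ = _ := by ring

end Registers

/-! ## Independent experiments -/

section Indep

variable {α : Type}

theorem E_indep_prod : ∀ (n : ℕ) (f : Fin n → PMF α) (φ : Fin n → α → ℝ≥0∞),
    E (indep n f) (fun r => ∏ i, φ i (r i)) = ∏ i, E (f i) (φ i)
  | 0, f, φ => by
    simp only [indep, E_pure, Finset.univ_eq_empty, Finset.prod_empty]
  | n + 1, f, φ => by
    simp only [indep, E_bind, E_pure, Fin.prod_univ_succ, Fin.cons_zero, Fin.cons_succ]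
    simp only [E_mul_left, E_indep_prod n, E_mul_right]

theorem indep_apply (n : ℕ) (f : Fin n → PMF α) (r : Fin n → α) :
    indep n f r = ∏ i, f i (r i) := by
  have h : ∀ r' : Fin n → α, ind (r' = r) = ∏ i, ind (r' i = r i) := by
    intro r'
    by_cases h : r' = r
    · subst h; simp [ind]
    · rw [ind_false h]
      obtain ⟨i, hi⟩ := Function.ne_iff.1 h
      exact (Finset.prod_eq_zero (Finset.mem_univ i) (ind_false hi)).symm
  rw [apply_eq_E (indep n f) r]
  simp only [h]
  rw [E_indep_prod n f (fun i a => ind (a = r i))]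
  exact Finset.prod_congr rfl fun i _ => (apply_eq_E _ _).symm

theorem mem_support_indep {n : ℕ} {f : Fin n → PMF α} {r : Fin n → α} :
    r ∈ (indep n f).support ↔ ∀ i, r i ∈ (f i).support := by
  simp [PMF.mem_support_iff, indep_apply, Finset.prod_eq_zero_iff]

theorem E_indep_one {n : ℕ} (f : Fin n → PMF α) (φ : α → ℝ≥0∞) (i : Fin n) :
    E (indep n f) (fun r => φ (r i)) = E (f i) φ := by
  have := E_indep_prod n f (fun j => if j = i then φ else fun _ => 1)
  simp only [apply_ite (E (f _)), E_one, mass_pmf, ite_apply] at this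
  simpa using this

theorem E_indep_two {n : ℕ} (f : Fin n → PMF α) (φ ψ : α → ℝ≥0∞) {i j : Fin n} (hij : i ≠ j) :
    E (indep n f) (fun r => φ (r i) * ψ (r j)) = E (f i) φ * E (f j) ψ := by
  have := E_indep_prod n f (fun l a => (if l = i then φ a else 1) * (if l = j then ψ a else 1))
  simp only [Finset.prod_mul_distrib, Finset.prod_ite_eq', Finset.mem_univ, if_true] at this
  rw [this, ← Finset.mul_prod_erase Finset.univ _ (Finset.mem_univ i),
    ← Finset.mul_prod_erase (Finset.univ.erase i) _
      (Finset.mem_erase.2 ⟨hij.symm, Finset.mem_univ j⟩), Finset.prod_eq_one]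
  · simp [hij, hij.symm]
  · intro l hl
    simp only [Finset.mem_erase] at hl
    simp [hl.1, hl.2.1, E_one, mass_pmf]

theorem indep_map {β : Type} : ∀ (n : ℕ) (f : Fin n → PMF α) (h : α → β),
    (indep n f).map (fun r i => h (r i)) = indep n (fun i => (f i).map h)
  | 0, f, h => by
    simp only [indep, PMF.pure_map]
    congr 1; funext i; exact i.elim0
  | n + 1, f, h => by
    simp only [indep, PMF.map_bind, PMF.pure_map, PMF.bind_map, ← indep_map n]
    congr 1; funext x
    congr 1; funext r
    simp only [Function.comp]
    congr 1; funext i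
    refine Fin.cases ?_ (fun i => ?_) i <;> simp

end Indep

/-! ## Transverse operations -/

section Transverse

variable {X Y : Type}

/-- The flagged places. -/
def flagList (r : Fin 7 → Bool) : List (Fin 7) := (List.finRange 7).filter fun i => r i

theorem mem_flagList {r : Fin 7 → Bool} {i : Fin 7} : i ∈ flagList r ↔ r i = true := by
  simp [flagList]

theorem two_le_flagList : ∀ r : Fin 7 → Bool, 2 ≤ (flagList r).length →
    ∃ i j, i < j ∧ r i = true ∧ r j = true := by decide +kernel

/-- The same kind of operation on each of seven registers; the flags are recorded. -/
def trans (lab : Fin 7 → Option (Fin 7)) (K : Fin 7 → X → PMF (Y × Bool)) (g : Fin 7 → X) :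
    PMF ((Fin 7 → Y) × Rec) :=
  (indep 7 fun i => K i (g i)).map fun r =>
    (fun i => (r i).1, ((flagList fun i => (r i).2).map lab, false))

theorem mem_support_trans {lab : Fin 7 → Option (Fin 7)} {K : Fin 7 → X → PMF (Y × Bool)}
    {g : Fin 7 → X} {y : Fin 7 → Y} {r : Rec} (h : (y, r) ∈ (trans lab K g).support) :
    r.2 = false ∧ ∃ φ : Fin 7 → Bool, r.1 = (flagList φ).map lab ∧
      ∀ i, (y i, φ i) ∈ (K i (g i)).support := by
  rw [trans, PMF.mem_support_map_iff] at h
  obtain ⟨r', hr', e⟩ := h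
  obtain ⟨rfl, rfl⟩ := Prod.ext_iff.1 e
  exact ⟨rfl, _, rfl, fun i => mem_support_indep.1 hr' i⟩

theorem trans_apply (lab : Fin 7 → Option (Fin 7)) (K : Fin 7 → X → PMF (Y × Bool))
    (g : Fin 7 → X) (y : Fin 7 → Y) (r : Rec) : trans lab K g (y, r) =
      ∑' φ : Fin 7 → Bool, ind (((flagList φ).map lab, false) = r) * ∏ i, K i (g i) (y i, φ i) := by
  rw [trans, map_apply_E, E, ← (Equiv.arrowProdEquivProdArrow (Fin 7) (fun _ => Y)
    (fun _ => Bool)).symm.tsum_eq, ENNReal.tsum_prod', tsum_eq_single y]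
  · refine tsum_congr fun φ => ?_
    simp only [Equiv.arrowProdEquivProdArrow, Equiv.coe_fn_symm_mk, indep_apply]
    rw [mul_comm]
    congr 1
    exact ind_congr (by simp)
  · intro y' hy'
    refine ENNReal.tsum_eq_zero.2 fun φ => ?_
    rw [ind_false, mul_zero]
    intro h
    exact hy' (congrArg Prod.fst h)

/-- For fixed input and fixed flags the outputs factorize, so one output given the others is a
weighted sum, over flag patterns with the right record, of slices of its own kernel. -/
theorem trans_inv {J : (Y → ℝ≥0∞) → Prop} (hJ : IsCone J) (lab : Fin 7 → Option (Fin 7))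
    {K : Fin 7 → X → PMF (Y × Bool)} (h : ∀ i x f, J (fun y => K i x (y, f)))
    (g : Fin 7 → X) (r : Rec) : Inv J (fun y => trans lab K g (y, r)) := by
  intro i y
  have e : ∀ x, trans lab K g (Function.update y i x, r) = ∑' φ : Fin 7 → Bool,
      (ind (((flagList φ).map lab, false) = r) *
        ∏ j ∈ Finset.univ.erase i, K j (g j) (y j, φ j)) * K i (g i) (x, φ i) := by
    intro x
    rw [trans_apply]
    refine tsum_congr fun φ => ?_
    rw [← Finset.mul_prod_erase Finset.univ _ (Finset.mem_univ i), Function.update_self,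
      Finset.prod_congr rfl fun j hj => by rw [Function.update_of_ne (Finset.ne_of_mem_erase hj)]]
    ring
  simp only [e]
  exact hJ _ _ _ fun φ => h i _ _

/-- Union bounds over the 7 places and the 21 pairs of places. The inputs may be correlated: a pair
is handled by bounding one register with the other frozen, then bounding the other. -/
theorem trans_rates {I : (X → ℝ≥0∞) → Prop} (lab : Fin 7 → Option (Fin 7))
    {K : Fin 7 → X → PMF (Y × Bool)} {ε : ℝ≥0∞}
    (h : ∀ i, Bd I (fun x => E (K i x) (fun y => ind (y.2 = true))) ε) :
    Rates3 (Inv I) (trans lab K) (7 * ε) (21 * ε ^ 2) 0 := by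
  refine ⟨?_, ?_, ?_⟩
  · have := Bd.sum Finset.univ fun (i : Fin 7) _ => Inv.bd (h i) i
    refine this.mono (fun g => ?_) (by simp)
    rw [trans, E_map]
    simp only [← E_indep_one (fun i => K i (g i)) (fun y => ind (y.2 = true))]
    rw [← E_finset_sum]
    refine E_mono fun r => ?_
    by_cases hr : ∃ i, (r i).2 = true
    · obtain ⟨i, hi⟩ := hr
      calc _ ≤ 1 := ind_le_one _
        _ = ind ((r i).2 = true) := (ind_true hi).symm
        _ ≤ _ := Finset.single_le_sum (f := fun i => ind ((r i).2 = true)) (fun _ _ => zero_le)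
          (Finset.mem_univ i)
    · rw [ind_false]
      · exact zero_le
      · intro hl
        have : flagList (fun i => (r i).2) ≠ [] := by
          intro h0; simp [h0] at hl
        obtain ⟨i, hi⟩ := List.exists_mem_of_ne_nil _ this
        exact hr ⟨i, mem_flagList.1 hi⟩
  · let P : Finset (Fin 7 × Fin 7) := Finset.univ.filter fun x => x.1 < x.2
    have hP : P.card = 21 := by decide +kernel
    have := Bd.sum (I := Inv I) P (e := ε ^ 2) (φ := fun x g =>
      E (K x.1 (g x.1)) (fun y => ind (y.2 = true)) * E (K x.2 (g x.2)) (fun y => ind (y.2 = true)))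
      fun x hx m hm => by
        have hne : x.1 ≠ x.2 := ne_of_lt (Finset.mem_filter.1 hx).2
        refine (hm.bd_mul (h x.1) x.1 fun g y => by
          rw [Function.update_of_ne hne.symm]).trans ?_
        calc _ ≤ ε * (ε * mass m) := mul_le_mul_right (Inv.bd (h x.2) x.2 m hm) _
          _ = _ := by ring
    refine this.mono (fun g => ?_) (by rw [hP]; norm_num)
    rw [trans, E_map]
    have e : ∀ x ∈ P, E (K x.1 (g x.1)) (fun y => ind (y.2 = true)) *
        E (K x.2 (g x.2)) (fun y => ind (y.2 = true)) = E (indep 7 fun i => K i (g i))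
          (fun r => ind ((r x.1).2 = true) * ind ((r x.2).2 = true)) := fun x hx =>
      (E_indep_two (fun i => K i (g i)) (fun y => ind (y.2 = true)) (fun y => ind (y.2 = true))
        (ne_of_lt (Finset.mem_filter.1 hx).2)).symm
    rw [Finset.sum_congr rfl e, ← E_finset_sum]
    refine E_mono fun r => ?_
    simp only [← ind_and, List.length_map]
    by_cases hr : ∃ i j, i < j ∧ (r i).2 = true ∧ (r j).2 = true
    · obtain ⟨i, j, hij, hi⟩ := hr
      calc _ ≤ 1 := ind_le_one _
        _ = ind ((r i).2 = true ∧ (r j).2 = true) := (ind_true hi).symm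
        _ ≤ _ := Finset.single_le_sum (f := fun x : Fin 7 × Fin 7 =>
            ind ((r x.1).2 = true ∧ (r x.2).2 = true)) (fun _ _ => zero_le)
            (Finset.mem_filter.2 ⟨Finset.mem_univ (i, j), hij⟩)
    · rw [ind_false]
      · exact zero_le
      · exact fun hl => hr (two_le_flagList _ hl)
  · intro m _
    have : ∀ g : Fin 7 → X, E (trans lab K g) (fun x => ind (x.2.2 = true)) = 0 := by
      intro g
      rw [trans, E_map]
      simp [ind, E_zero]
    simp [this, E_zero]

end Transverse

/-! ## Networks -/

section Network

variable {X : Type}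

/-- A gate on two of seven registers. -/
def stepK (K : X × X → PMF ((X × X) × Bool)) (e : Fin 7 × Fin 7) (g : Fin 7 → X) :
    PMF ((Fin 7 → X) × Rec) :=
  (K (g e.1, g e.2)).map fun r =>
    (Function.update (Function.update g e.1 r.1.1) e.2 r.1.2, (if r.2 then [none] else [], false))

theorem stepK_apply (K : X × X → PMF ((X × X) × Bool)) {i j : Fin 7} (hij : i ≠ j)
    (a h : Fin 7 → X) (r : Rec) : stepK K (i, j) a (h, r) =
      ∑' f : Bool, ind ((if f then [none] else [], false) = r ∧ ∀ l, l ≠ i → l ≠ j → a l = h l) *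
        K (a i, a j) ((h i, h j), f) := by
  rw [stepK, map_apply_E, E_prod, tsum_eq_single (h i, h j)]
  · refine tsum_congr fun f => ?_
    rw [mul_comm]
    congr 1
    refine ind_congr ?_
    rw [Prod.ext_iff, and_comm]
    refine and_congr Iff.rfl ?_
    constructor
    · intro e l hi hj
      have := congrFun e l
      simpa [hi, hj] using this
    · intro e
      funext l
      by_cases hj : l = j
      · subst hj; simp
      · by_cases hi : l = i
        · subst hi; simp [hj]
        · simpa [hi, hj] using e l hi hj
  · rintro ⟨u, v⟩ hne
    refine ENNReal.tsum_eq_zero.2 fun f => ?_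
    rw [ind_false, mul_zero]
    intro e
    apply hne
    have e1 := congrArg Prod.fst e
    have hi := congrFun e1 i
    have hj := congrFun e1 j
    simp [hij] at hi hj
    rw [hi, hj]

/-- A register outside the gate is untouched, so its law is a mixture of earlier ones; a register
inside receives an `I`-mass from the gate for every input and every other output. -/
theorem stepK_pres {I : (X → ℝ≥0∞) → Prop} (hI : IsCone I) {K : X × X → PMF ((X × X) × Bool)}
    (h₁ : ∀ x v f, I (fun u => K x ((u, v), f))) (h₂ : ∀ x u f, I (fun v => K x ((u, v), f)))
    {i j : Fin 7} (hij : i ≠ j) : Pres (Inv I) (stepK K (i, j)) (Inv I) := by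
  intro m hm r l g
  by_cases hl : l ≠ i ∧ l ≠ j
  · obtain ⟨hi, hj⟩ := hl
    have e : ∀ x, ∑' a, m a * stepK K (i, j) a (Function.update g l x, r) =
        ∑' a : Fin 7 → X, (ind (a l = g l) * ∑' f : Bool,
          ind ((if f then [none] else [], false) = r ∧ ∀ l', l' ≠ i → l' ≠ j → a l' = g l') *
          K (a i, a j) ((g i, g j), f)) * m (Function.update a l x) := by
      intro x
      rw [tsum_update l (g l)]
      refine tsum_congr fun a => ?_
      by_cases ha : a l = g l
      · rw [ind_true ha, one_mul, one_mul, tsum_eq_single x]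
        · rw [mul_comm, stepK_apply K hij]
          congr 1
          refine tsum_congr fun f => ?_
          rw [Function.update_of_ne hi.symm, Function.update_of_ne hj.symm,
            Function.update_of_ne hi.symm, Function.update_of_ne hj.symm]
          congr 1
          refine ind_congr (and_congr Iff.rfl (forall_congr' fun l' => ?_))
          by_cases hl : l' = l
          · subst hl; simp [ha]
          · simp [hl]
        · intro y hy
          rw [stepK_apply K hij, ENNReal.tsum_eq_zero.2, mul_zero]
          intro f
          rw [ind_false, zero_mul]
          rintro ⟨-, hh⟩
          have := hh l hi hj
          simp only [Function.update_self] at this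
          exact hy this
      · simp [ind, ha]
    simp only [e]
    exact hI _ _ _ fun a => hm l a
  · refine hI _ _ _ fun a => ?_
    simp only [stepK_apply K hij]
    have hl' : l = i ∨ l = j := by tauto
    have e : ∀ (x : X) (f : Bool),
        ind ((if f then [none] else [], false) = r ∧ ∀ l', l' ≠ i → l' ≠ j →
          a l' = Function.update g l x l') =
        ind ((if f then [none] else [], false) = r ∧ ∀ l', l' ≠ i → l' ≠ j → a l' = g l') := by
      intro x f
      refine ind_congr (and_congr Iff.rfl (forall_congr' fun l' => ?_))
      refine imp_congr_right fun h1 => imp_congr_right fun h2 => ?_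
      rw [Function.update_of_ne]
      rintro rfl; tauto
    simp only [e]
    refine hI _ _ _ fun f => ?_
    rcases hl' with rfl | rfl
    · simp only [Function.update_self, Function.update_of_ne hij.symm]; exact h₁ _ _ _
    · simp only [Function.update_self, Function.update_of_ne hij]; exact h₂ _ _ _

theorem stepK_rates {I : (X → ℝ≥0∞) → Prop} {K : X × X → PMF ((X × X) × Bool)} {ε : ℝ≥0∞}
    (h : Bd (PairOf I) (fun x => E (K x) (fun y => ind (y.2 = true))) ε)
    {i j : Fin 7} (hij : i ≠ j) : Rates3 (Inv I) (stepK K (i, j)) ε 0 0 := by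
  refine ⟨(Inv.bd_pair h hij).mono (fun g => ?_) le_rfl, Bd.zero.mono (fun g => ?_) le_rfl,
    Bd.zero.mono (fun g => ?_) le_rfl⟩
  · rw [stepK, E_map]
    refine E_mono fun r => ind_mono ?_
    cases r.2 <;> simp
  · rw [stepK, E_map, ← E_zero (K (g i, g j))]
    refine E_mono fun r => ?_
    rw [ind_false]
    cases r.2 <;> simp
  · rw [stepK, E_map, ← E_zero (K (g i, g j))]
    refine E_mono fun r => ?_
    rw [ind_false]
    simp

/-- A sequence of gates. -/
def netK (K : ℕ → X × X → PMF ((X × X) × Bool)) : List (Fin 7 × Fin 7) → (Fin 7 → X) →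
    PMF ((Fin 7 → X) × Rec)
  | [], g => PMF.pure (g, ([], false))
  | e :: es, g => wbind (stepK (K es.length) e g) (netK K es)

theorem pure_pres {I : (X → ℝ≥0∞) → Prop} (hI : IsCone I) (r : Rec) :
    Pres I (fun g => PMF.pure (g, r)) I := by
  intro m hm s
  have e : ∀ b, ∑' a, m a * (PMF.pure (a, r)) (b, s) = ∑' _ : Unit, ind (r = s) * m b := by
    intro b
    rw [tsum_eq_single b]
    · rw [apply_eq_E (PMF.pure (b, r)), E_pure, mul_comm]
      simp
    · intro a ha
      rw [apply_eq_E (PMF.pure (a, r)), E_pure, ind_false, mul_zero]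
      exact fun h => ha (congrArg Prod.fst h)
  simp only [e]
  exact hI _ _ _ fun _ => hm

theorem pure_rates {Y : Type} {I : (X → ℝ≥0∞) → Prop} (f : X → Y) :
    Rates3 I (fun g => PMF.pure (f g, (([], false) : Rec))) 0 0 0 := by
  refine ⟨Bd.zero.mono (fun g => ?_) le_rfl, Bd.zero.mono (fun g => ?_) le_rfl,
    Bd.zero.mono (fun g => ?_) le_rfl⟩ <;> simp [E_pure, ind]

theorem netK_pres {I : (X → ℝ≥0∞) → Prop} (hI : IsCone I)
    {K : ℕ → X × X → PMF ((X × X) × Bool)}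
    (h₁ : ∀ n x v f, I (fun u => K n x ((u, v), f)))
    (h₂ : ∀ n x u f, I (fun v => K n x ((u, v), f))) : ∀ es : List (Fin 7 × Fin 7),
    (∀ e ∈ es, e.1 ≠ e.2) → Pres (Inv I) (netK K es) (Inv I)
  | [], _ => pure_pres (Inv.isCone hI) _
  | e :: es, h => (stepK_pres hI (h₁ _) (h₂ _) (h e (List.mem_cons_self ..))).comp (Inv.isCone hI)
      (netK_pres hI h₁ h₂ es fun e' he' => h e' (List.mem_cons_of_mem _ he'))

/-- The pairs are counted by Pascal's rule: the first gate forms one pair with each later gate. -/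
theorem netK_rates {I : (X → ℝ≥0∞) → Prop} (hI : IsCone I)
    {K : ℕ → X × X → PMF ((X × X) × Bool)} {ε : ℝ≥0∞}
    (h₁ : ∀ n x v f, I (fun u => K n x ((u, v), f)))
    (h₂ : ∀ n x u f, I (fun v => K n x ((u, v), f)))
    (h : ∀ n, Bd (PairOf I) (fun x => E (K n x) (fun y => ind (y.2 = true))) ε) :
    ∀ es : List (Fin 7 × Fin 7), (∀ e ∈ es, e.1 ≠ e.2) →
    Rates3 (Inv I) (netK K es) (es.length * ε) (es.length.choose 2 * ε ^ 2) 0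
  | [], _ => by
    have := pure_rates (I := Inv I) (id : (Fin 7 → X) → Fin 7 → X)
    simp only [List.length_nil, Nat.cast_zero, zero_mul, Nat.choose_zero_succ]
    exact this
  | e :: es, he => by
    have he' := he e (List.mem_cons_self ..)
    have := (stepK_rates (h es.length) he').comp (stepK_pres hI (h₁ _) (h₂ _) he')
      (netK_rates hI h₁ h₂ h es fun e' he' => he e' (List.mem_cons_of_mem _ he'))
    have c1 : ((e :: es).length : ℝ≥0∞) * ε = ε + es.length * ε := by
      rw [List.length_cons]; push_cast; ring
    have c2 : ((e :: es).length.choose 2 : ℝ≥0∞) * ε ^ 2 =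
        0 + es.length.choose 2 * ε ^ 2 + ε * (es.length * ε) := by
      rw [List.length_cons, Nat.choose_succ_succ' es.length 1, Nat.choose_one_right]
      push_cast; ring
    rw [c1, c2]
    simp only [add_zero] at this
    exact this

end Network

/-! ## Measurements -/

theorem value_succ {k : ℕ} (m : Bits (k + 1)) :
    value (k + 1) m = decodeBit (fun i => value k (m i)) := rfl

theorem value_xPart : ∀ (k : ℕ) (e : Err k), value k (xPart e) = (state k e).1
  | 0, _ => rfl
  | k + 1, e => by
    have h : (fun i => value k (xPart (k := k + 1) e i)) = xs (fun i => state k (e i)) :=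
      funext fun i => value_xPart k (e i)
    rw [value_succ, h]
    exact (congrArg Prod.fst (logical_eq _)).symm

theorem value_zPart : ∀ (k : ℕ) (e : Err k), value k (zPart e) = (state k e).2
  | 0, _ => rfl
  | k + 1, e => by
    have h : (fun i => value k (zPart (k := k + 1) e i)) = zs (fun i => state k (e i)) :=
      funext fun i => value_zPart k (e i)
    rw [value_succ, h]
    exact (congrArg Prod.snd (logical_eq _)).symm

theorem mem_support_codeword {k : ℕ} {b : ZMod 2} {c : Bits (k + 1)}
    (h : c ∈ (codeword (k + 1) b).support) : ∃ f : Fin 7 → ZMod 2, syndrome f = 0 ∧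
      ∑ i, f i = b ∧ ∀ i, c i ∈ (codeword k (f i)).support := by
  obtain ⟨w, -, hw⟩ := (PMF.mem_support_bind_iff _ _ _).1 h
  refine ⟨w ᵥ* checks + fun _ => b, ?_, ?_, fun i => mem_support_indep.1 hw i⟩
  · rw [syndrome_add, syndrome_vecMul, syndrome_const, add_zero]
  · simp only [Pi.add_apply, Finset.sum_add_distrib, sum_vecMul, sum_const7, zero_add]

theorem value_codeword : ∀ (k : ℕ) {b : ZMod 2} {c : Bits k} (_ : c ∈ (codeword k b).support)
    (d : Bits k), value k (c.xor d) = value k d + b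
  | 0, b, c, h, d => by
    have : c = b := (PMF.mem_support_pure_iff _ _).1 h
    subst this
    exact add_comm _ _
  | k + 1, b, c, h, d => by
    obtain ⟨f, hf, rfl, hc⟩ := mem_support_codeword h
    rw [value_succ, value_succ, ← decodeBit_add hf]
    congr 1
    funext i
    exact value_codeword k (hc i) (d i)

/-- On every layer the ideal outcome is a codeword, which shifts decoded values by a pattern of
trivial syndrome. The observed flips thus depend on the tracked errors alone. -/
theorem values_codeword {k : ℕ} {b : ZMod 2} {c : Bits (k + 1)}
    (h : c ∈ (codeword (k + 1) b).support) (d : Bits (k + 1)) :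
    relFlips (c.xor d) = minPattern fun i => value k (d i) := by
  obtain ⟨f, hf, -, hc⟩ := mem_support_codeword h
  refine minPattern_congr ?_
  have : (fun i => value k (c.xor d i)) = (fun i => value k (d i)) + f :=
    funext fun i => value_codeword k (hc i) (d i)
  rw [this, syndrome_add, hf, add_zero]

theorem relFlips_randomCodeword {k : ℕ} {c : Bits (k + 1)}
    (h : c ∈ (randomCodeword (k + 1)).support) (d : Bits (k + 1)) :
    relFlips (c.xor d) = minPattern fun i => value k (d i) := by
  simp only [randomCodeword, PMF.mem_support_bind_iff] at h
  obtain ⟨b, -, hb⟩ := h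
  exact values_codeword hb d

/-! ## Bit patterns that are known outside of one place -/

/-- Outside of the place `t`, the pattern `e` is a codeword with logical value `b`. -/
def Near (t : Fin 7) (e : Fin 7 → ZMod 2) (b : ZMod 2) : Prop :=
  ∃ f : Fin 7 → ZMod 2, syndrome f = 0 ∧ ∑ i, f i = b ∧ ∀ j, j ≠ t → e j = f j

theorem Near.eq_add {t : Fin 7} {e : Fin 7 → ZMod 2} {b : ZMod 2} (h : Near t e b) :
    ∃ f : Fin 7 → ZMod 2, syndrome f = 0 ∧ ∑ i, f i = b ∧ ∃ a, e = Pi.single t a + f := by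
  obtain ⟨f, h1, h2, h3⟩ := h
  refine ⟨f, h1, h2, e t - f t, ?_⟩
  funext j
  by_cases hj : j = t
  · subst hj; simp
  · simp [hj, h3 j hj]

/-- Up to a codeword the pattern is supported at `t`, and such patterns are their own coset leaders.
-/
theorem Near.minPattern_eq {t : Fin 7} {e : Fin 7 → ZMod 2} {b : ZMod 2} (h : Near t e b)
    {j : Fin 7} (hj : j ≠ t) : minPattern e j = 0 := by
  obtain ⟨f, h1, -, a, rfl⟩ := h.eq_add
  rw [minPattern_congr (f := Pi.single t a) (by rw [syndrome_add, h1, add_zero]),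
    minPattern_single]
  simp [hj]

/-- The possible error at `t` is the coset leader, so decoding cancels it. -/
theorem Near.decodeBit_eq {t : Fin 7} {e : Fin 7 → ZMod 2} {b : ZMod 2} (h : Near t e b) :
    decodeBit e = b := by
  obtain ⟨f, h1, rfl, a, rfl⟩ := h.eq_add
  rw [decodeBit_add h1]
  simp only [decodeBit, minPattern_single, CharTwo.add_self_eq_zero, Finset.sum_const_zero,
    zero_add]

theorem Near.add {t : Fin 7} {e e' e'' : Fin 7 → ZMod 2} {b b' : ZMod 2} (h : Near t e b)
    (h' : Near t e' b') (he : ∀ j, j ≠ t → e'' j = e j + e' j) : Near t e'' (b + b') := by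
  obtain ⟨f, h1, h2, h3⟩ := h
  obtain ⟨f', h1', h2', h3'⟩ := h'
  refine ⟨f + f', by rw [syndrome_add, h1, h1', add_zero], ?_, fun j hj => ?_⟩
  · simp [Finset.sum_add_distrib, h2, h2']
  · rw [he j hj, h3 j hj, h3' j hj]; rfl

theorem Near.congr {t : Fin 7} {e e' : Fin 7 → ZMod 2} {b : ZMod 2} (h : Near t e b)
    (he : ∀ j, j ≠ t → e' j = e j) : Near t e' b := by
  obtain ⟨f, h1, h2, h3⟩ := h
  exact ⟨f, h1, h2, fun j hj => (he j hj).trans (h3 j hj)⟩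

/-- The witness is the corrected pattern: its syndrome is trivial, its parity is the decoded value,
and it agrees with `e` off `t`. -/
theorem near_decodeBit {t : Fin 7} {e : Fin 7 → ZMod 2} (h : ∀ j, j ≠ t → minPattern e j = 0) :
    Near t e (decodeBit e) := by
  refine ⟨e + minPattern e, ?_, rfl, fun j hj => by simp [h j hj]⟩
  rw [syndrome_add, syndrome_minPattern]
  exact CharTwo.add_self_eq_zero _

/-! ## Instrumented operations -/

/-- An ancilla preparation with configurations and a failure flag. -/
structure AncSpec {k : ℕ} (z : PMF (Err k)) (Z : PMF (Cfg k × Bool)) (p : ℕ → ℝ≥0∞)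
    (A : ℝ≥0∞) : Prop where
  err : Z.map (fun x => x.1.err) = z
  tw : ∀ f, TW p k (fun x => Z (x, f))
  fail : E Z (fun x => ind (x.2 = true)) ≤ A
  valid : ∀ x ∈ Z.support, x.2 = false → Valid k x.1
  state : ∀ x ∈ Z.support, x.2 = false → state k x.1.err = 0

/-- An error correction with configurations and a failure flag. -/
structure CorrSpec {k : ℕ} (F : Err k → PMF (Err k)) (G : Cfg k → PMF (Cfg k × Bool))
    (p : ℕ → ℝ≥0∞) (B : ℝ≥0∞) : Prop where
  err : ∀ c, (G c).map (fun x => x.1.err) = F c.err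
  tw : ∀ c f, TW p k (fun x => G c (x, f))
  fail : Bd (TW p k) (fun c => E (G c) (fun x => ind (x.2 = true))) B
  valid : ∀ c, ∀ x ∈ (G c).support, x.2 = false → Valid k x.1
  state : ∀ c, Valid k c → ∀ x ∈ (G c).support, x.2 = false →
    state k x.1.err = state k c.err

/-- A CNOT with configurations and a failure flag. -/
structure CnotSpec {k : ℕ} (F : Err k × Err k → PMF (Err k × Err k))
    (G : Cfg k × Cfg k → PMF ((Cfg k × Cfg k) × Bool)) (p : ℕ → ℝ≥0∞) (C : ℝ≥0∞) : Prop where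
  err : ∀ c, (G c).map (fun x => (x.1.1.err, x.1.2.err)) = F (c.1.err, c.2.err)
  tw : ∀ c f, PairTW p k (fun x => G c (x, f))
  fail : Bd (PairTW p k) (fun c => E (G c) (fun x => ind (x.2 = true))) C
  valid : ∀ c, ∀ x ∈ (G c).support, x.2 = false → Valid k x.1.1 ∧ Valid k x.1.2
  state : ∀ c, Valid k c.1 → Valid k c.2 → ∀ x ∈ (G c).support, x.2 = false →
    (state k x.1.1.err, state k x.1.2.err) = propagate (state k c.1.err, state k c.2.err)

/-- Instrumented operations of one level. -/
structure IOps (k : ℕ) where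
  zero : List ℕ → PMF (Cfg k × Bool)
  correct : List ℕ → Cfg k → PMF (Cfg k × Bool)
  cnot : List ℕ → Cfg k × Cfg k → PMF ((Cfg k × Cfg k) × Bool)

/-- The instrumented operations refine the operations and have the stated properties. -/
structure IOps.Spec {k : ℕ} (K : IOps k) (o : Ops k) (p : ℕ → ℝ≥0∞) (A B C : ℝ≥0∞) : Prop where
  zero : ∀ loc, AncSpec (o.zero loc) (K.zero loc) p A
  correct : ∀ loc, CorrSpec (o.correct loc) (K.correct loc) p B
  cnot : ∀ loc, CnotSpec (o.cnot loc) (K.cnot loc) p C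

/-- The errors of seven subblocks. -/
def errs {k : ℕ} (g : Fin 7 → Cfg k) : Err (k + 1) := fun i => (g i).err

/-! ## One half of a round of error correction -/

section Half

variable {k : ℕ} {p : ℕ → ℝ≥0∞}

/-- The ancilla of one half of a round is put next to the data. -/
def halfPrep (Z : PMF (Cfg (k + 1) × Bool)) (g : Fin 7 → Cfg k) :
    PMF ((Fin 7 → Cfg k × Cfg k) × Rec) :=
  Z.map fun a => (fun i => (g i, subC a.1 i), ((tagC a.1).toList.map some, a.2))

/-- The ancilla is measured and the data are corrected. -/
def halfFix (rd : Err (k + 1) → Bits (k + 1)) (inj : ZMod 2 → Pauli)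
    (r : Fin 7 → Cfg k × Cfg k) : PMF ((Fin 7 → Cfg k) × Rec) :=
  (randomCodeword (k + 1)).map fun c =>
    (fun i => shiftC k (inj (relFlips (c.xor (rd (errs fun i => (r i).2))) i)) (r i).1, ([], false))

/-- One half of a round: an ancilla `Z`, gates `G` (data, ancilla) between the data and the
ancilla, measurement of the ancilla and correction of the data. -/
def halfK (Z : PMF (Cfg (k + 1) × Bool))
    (G : Fin 7 → Cfg k × Cfg k → PMF ((Cfg k × Cfg k) × Bool))
    (rd : Err (k + 1) → Bits (k + 1)) (inj : ZMod 2 → Pauli) (g : Fin 7 → Cfg k) :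
    PMF ((Fin 7 → Cfg k) × Rec) :=
  wbind (wbind (halfPrep Z g) (trans some G)) (halfFix rd inj)

variable {Z : PMF (Cfg (k + 1) × Bool)} {G : Fin 7 → Cfg k × Cfg k → PMF ((Cfg k × Cfg k) × Bool)}
  {rd : Err (k + 1) → Bits (k + 1)} {inj : ZMod 2 → Pauli}

/-- The ancilla is independent of the data, so a slice is a sum of products. An ancilla subblock,
given its siblings and the tag, is covered by the second clause of `TW` at level `k + 1`. -/
theorem halfPrep_pres (hZ : ∀ f, TW p (k + 1) (fun x => Z (x, f))) :
    Pres (Inv (TW p k)) (halfPrep Z) (Inv (PairTW p k)) := by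
  intro m hm r
  let R : Option (Fin 7) × Bool → Rec := fun x => (x.1.toList.map some, x.2)
  have e : ∀ h : Fin 7 → Cfg k × Cfg k, ∑' a, m a * halfPrep Z a (h, r) =
      ∑' x : Option (Fin 7) × Bool, ind (R x = r) *
        (m (fun i => (h i).1) * Z (mkC x.1 fun i => (h i).2, x.2)) := by
    intro h
    have e1 : ∀ a, halfPrep Z a (h, r) = ind (a = fun i => (h i).1) *
        ∑' x : Option (Fin 7) × Bool, ind (R x = r) * Z (mkC x.1 fun i => (h i).2, x.2) := by
      intro a
      rw [halfPrep, map_apply_E, E, ← ENNReal.tsum_mul_left, ENNReal.tsum_prod',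
        ENNReal.tsum_prod']
      change ∑' (x : Option (Fin 7) × (Fin 7 → Cfg k)), _ = _
      rw [ENNReal.tsum_prod']
      refine tsum_congr fun t => ?_
      rw [tsum_eq_single (fun i => (h i).2)]
      · refine tsum_congr fun f => ?_
        have : ind (((fun i => (a i, (h i).2)), R (t, f)) = (h, r)) =
            ind (a = fun i => (h i).1) * ind (R (t, f) = r) := by
          rw [← ind_and]
          refine ind_congr ?_
          rw [Prod.ext_iff]
          refine and_congr ⟨fun e => ?_, fun e => ?_⟩ Iff.rfl
          · funext i; exact congrArg Prod.fst (congrFun e i)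
          · funext i; rw [e]
        change Z (mkC t fun i => (h i).2, f) *
          ind (((fun i => (a i, (h i).2)), R (t, f)) = (h, r)) = _
        rw [this]; ring
      · intro g hg
        refine ENNReal.tsum_eq_zero.2 fun f => ?_
        rw [ind_false, mul_zero]
        intro e
        apply hg
        funext i
        exact congrArg Prod.snd (congrFun (congrArg Prod.fst e) i)
    simp only [e1]
    rw [tsum_eq_single (fun i => (h i).1)]
    · rw [ind_true rfl, one_mul, ← ENNReal.tsum_mul_left]
      exact tsum_congr fun x => by ring
    · intro a ha; simp [ind, ha]
  simp only [e]
  intro i h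
  refine PairOf.isCone (TW.isCone k) _ _ _ fun x => ?_
  have u1 : ∀ y : Cfg k × Cfg k, (fun j => (Function.update h i y j).1) =
      Function.update (fun j => (h j).1) i y.1 := by
    intro y; funext j
    by_cases hj : j = i
    · subst hj; simp
    · simp [hj]
  have u2 : ∀ y : Cfg k × Cfg k, (fun j => (Function.update h i y j).2) =
      Function.update (fun j => (h j).2) i y.2 := by
    intro y; funext j
    by_cases hj : j = i
    · subst hj; simp
    · simp [hj]
  simp only [u1, u2]
  refine ⟨fun y => ?_, fun y => ?_⟩
  · simp only [mul_comm (m _)]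
    exact (hm i _).smul _
  · exact ((hZ x.2).2 x.1 i (fun j => (h j).2)).smul (m (Function.update (fun j => (h j).1) i y))

/-- The tag of the ancilla is counted as a fault; there is at most one, hence the zero. -/
theorem halfPrep_rates {I : ((Fin 7 → Cfg k) → ℝ≥0∞) → Prop} {a A : ℝ≥0∞}
    (ha : E Z (fun x => ind (tagC x.1 ≠ none)) ≤ a) (hA : E Z (fun x => ind (x.2 = true)) ≤ A) :
    Rates3 I (halfPrep Z) a 0 A := by
  refine ⟨fun m _ => ?_, fun m _ => ?_, fun m _ => ?_⟩ <;> rw [← E_const] <;>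
    refine E_mono fun g => ?_ <;> rw [halfPrep, E_map]
  · refine le_trans (E_mono fun x => ind_mono ?_) ha
    cases tagC x.1 <;> simp
  · rw [← E_zero Z]
    refine E_mono fun x => ?_
    rw [ind_false]
    cases tagC x.1 <;> simp
  · exact hA

/-- The applied Pauli is a function of the random string and of the ancilla. For fixed values of
these it relabels the data by an involution; the measured ancilla is then summed out. -/
theorem halfFix_pres : Pres (Inv (PairTW p k)) (halfFix rd inj) (Inv (TW p k)) := by
  intro m hm r
  let v : Bits (k + 1) → (Fin 7 → Cfg k) → Fin 7 → Pauli := fun c a i =>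
    inj (relFlips (c.xor (rd (errs a))) i)
  have e : ∀ g : Fin 7 → Cfg k, ∑' h, m h * halfFix rd inj h (g, r) =
      ∑' x : Bits (k + 1) × (Fin 7 → Cfg k), (randomCodeword (k + 1) x.1 * ind (([], false) = r)) *
        m (fun i => (shiftC k (v x.1 x.2 i) (g i), x.2 i)) := by
    intro g
    rw [← (Equiv.arrowProdEquivProdArrow (Fin 7) (fun _ => Cfg k)
      (fun _ => Cfg k)).symm.tsum_eq, ENNReal.tsum_prod', ENNReal.tsum_prod',
      ENNReal.tsum_comm, ENNReal.tsum_comm (α := Bits (k + 1))]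
    refine tsum_congr fun a => ?_
    simp only [Equiv.arrowProdEquivProdArrow, Equiv.coe_fn_symm_mk, halfFix, map_apply_E, E,
      ← ENNReal.tsum_mul_left]
    rw [ENNReal.tsum_comm]
    refine tsum_congr fun c => ?_
    rw [tsum_eq_single (fun i => shiftC k (v c a i) (g i))]
    · have : ind (((fun i => shiftC k (v c a i) (shiftC k (v c a i) (g i))), (([], false) : Rec)) =
          (g, r)) = ind ((([], false) : Rec) = r) := by
        simp only [shiftC_shiftC]
        exact ind_congr (by simp)
      change _ * (_ * ind (((fun i => shiftC k (v c a i) (shiftC k (v c a i) (g i))),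
        (([], false) : Rec)) = (g, r))) = _
      rw [this]; ring
    · intro b hb
      rw [ind_false]
      · simp
      · intro e
        apply hb
        funext i
        have := congrFun (congrArg Prod.fst e) i
        change shiftC k (v c a i) (b i) = g i at this
        rw [← this, shiftC_shiftC]
  simp only [e]
  intro i g
  refine TW.isCone k _ _ _ fun x => ?_
  have u : ∀ y : Cfg k, (fun j => (shiftC k (v x.1 x.2 j) (Function.update g i y j), x.2 j)) =
      Function.update (fun j => (shiftC k (v x.1 x.2 j) (g j), x.2 j)) i
        (shiftC k (v x.1 x.2 i) y, x.2 i) := by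
    intro y; funext j
    by_cases hj : j = i
    · subst hj; simp
    · simp [hj]
  simp only [u]
  exact ((hm i _).1 (x.2 i)).shiftC _

theorem halfFix_rates {I : ((Fin 7 → Cfg k × Cfg k) → ℝ≥0∞) → Prop} :
    Rates3 I (halfFix rd inj) 0 0 0 := by
  refine ⟨fun m _ => ?_, fun m _ => ?_, fun m _ => ?_⟩ <;> rw [← E_const] <;>
    refine E_mono fun g => ?_ <;> rw [halfFix, E_map] <;> simp [ind, E_zero]

theorem trans_pres {X Y : Type} {I : ((Fin 7 → X) → ℝ≥0∞) → Prop} {J : (Y → ℝ≥0∞) → Prop}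
    (hJ : IsCone J) (lab : Fin 7 → Option (Fin 7))
    {K : Fin 7 → X → PMF (Y × Bool)} (h : ∀ i x f, J (fun y => K i x (y, f))) :
    Pres I (trans lab K) (Inv J) :=
  Pres.of_forall (Inv.isCone hJ) fun g r => trans_inv hJ lab h g r

/-- The gates emit `TW` pairs from every input, so nothing is needed of the data or of the ancilla.
-/
theorem halfK_pres (hG : ∀ i x f, PairTW p k (fun y => G i x (y, f)))
    {I : ((Fin 7 → Cfg k) → ℝ≥0∞) → Prop} : Pres I (halfK Z G rd inj) (Inv (TW p k)) :=
  have h1 : Pres I (halfPrep Z) (fun _ => True) := fun _ _ _ => trivial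
  (h1.comp (Inv.isCone (PairOf.isCone (TW.isCone k)))
    (trans_pres (PairOf.isCone (TW.isCone k)) some hG)).comp
    (Inv.isCone (TW.isCone k)) halfFix_pres

/-- Here the ancilla must be `TW`, since the failure bound of the gates is only an average over `TW`
pairs. The mixed term pairs a tagged ancilla with a failed gate. -/
theorem halfK_rates {a A C : ℝ≥0∞} (hZ : ∀ f, TW p (k + 1) (fun x => Z (x, f)))
    (ha : E Z (fun x => ind (tagC x.1 ≠ none)) ≤ a) (hA : E Z (fun x => ind (x.2 = true)) ≤ A)
    (hG : ∀ i x f, PairTW p k (fun y => G i x (y, f)))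
    (hC : ∀ i, Bd (PairTW p k) (fun x => E (G i x) (fun y => ind (y.2 = true))) C) :
    Rates3 (Inv (TW p k)) (halfK Z G rd inj) (a + 7 * C) (21 * C ^ 2 + a * (7 * C)) A := by
  have h := Rates3.comp ((halfPrep_pres hZ).comp (Inv.isCone (PairOf.isCone (TW.isCone k)))
    (trans_pres (PairOf.isCone (TW.isCone k)) some hG))
    ((halfPrep_rates ha hA).comp (halfPrep_pres hZ) (trans_rates some hC))
    (halfFix_rates (rd := rd) (inj := inj))
  simp only [add_zero, zero_add, mul_zero] at h
  exact h

theorem mem_support_halfK {g g' : Fin 7 → Cfg k} {r : Rec}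
    (h : (g', r) ∈ (halfK Z G rd inj g).support) :
    ∃ (a : Cfg (k + 1)) (φ : Fin 7 → Bool) (y : Fin 7 → Cfg k × Cfg k) (c : Bits (k + 1)),
      (a, r.2) ∈ Z.support ∧ c ∈ (randomCodeword (k + 1)).support ∧
      r.1 = (tagC a).toList.map some ++ (flagList φ).map some ∧
      (∀ i, (y i, φ i) ∈ (G i (g i, subC a i)).support) ∧
      ∀ i, g' i = shiftC k (inj (relFlips (c.xor (rd (errs fun i => (y i).2))) i)) (y i).1 := by
  obtain ⟨y, s, t, h1, h2, rfl⟩ := mem_support_wbind.1 h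
  obtain ⟨x, s', t', h3, h4, rfl⟩ := mem_support_wbind.1 h1
  rw [halfPrep, PMF.mem_support_map_iff] at h3
  obtain ⟨⟨a, f⟩, ha, e⟩ := h3
  obtain ⟨rfl, rfl⟩ := Prod.ext_iff.1 e
  obtain ⟨h5, φ, h6, h7⟩ := mem_support_trans h4
  rw [halfFix, PMF.mem_support_map_iff] at h2
  obtain ⟨c, hc, e⟩ := h2
  obtain ⟨rfl, rfl⟩ := Prod.ext_iff.1 e
  refine ⟨a, φ, y, c, ?_, hc, ?_, h7, fun i => rfl⟩
  · simpa [Rec.append, h5] using ha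
  · simp [Rec.append, h6]

/-- The effect of a gate of one half of a round, on the parts `π` (which is measured) and `ρ`. -/
structure GateSpec (G : Fin 7 → Cfg k × Cfg k → PMF ((Cfg k × Cfg k) × Bool))
    (π ρ : Pauli → ZMod 2) : Prop where
  valid : ∀ i c, ∀ x ∈ (G i c).support, x.2 = false → Valid k x.1.1 ∧ Valid k x.1.2
  state : ∀ i c, Valid k c.1 → Valid k c.2 → ∀ x ∈ (G i c).support, x.2 = false →
    π (state k x.1.1.err) = π (state k c.1.err) ∧
    ρ (state k x.1.1.err) = ρ (state k c.1.err) + ρ (state k c.2.err) ∧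
    π (state k x.1.2.err) = π (state k c.1.err) + π (state k c.2.err)

/-- Conditions on the parts, on the readout and on the correction. -/
structure PartSpec (rd : Err (k + 1) → Bits (k + 1)) (inj : ZMod 2 → Pauli)
    (π ρ : Pauli → ZMod 2) : Prop where
  parts : (π = Prod.fst ∧ ρ = Prod.snd) ∨ (π = Prod.snd ∧ ρ = Prod.fst)
  read : ∀ g : Fin 7 → Cfg k, (fun i => value k (rd (errs g) i)) = fun i => π (states g i)
  inj_left : ∀ a, π (inj a) = a
  inj_right : ∀ a, ρ (inj a) = 0

variable {π ρ : Pauli → ZMod 2}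

theorem PartSpec.add (h : PartSpec rd inj π ρ) (P Q : Pauli) :
    π (P + Q) = π P + π Q ∧ ρ (P + Q) = ρ P + ρ Q := by
  rcases h.parts with ⟨rfl, rfl⟩ | ⟨rfl, rfl⟩ <;> exact ⟨rfl, rfl⟩

theorem PartSpec.ancilla (h : PartSpec rd inj π ρ) {a : Cfg (k + 1)} (hv : Valid (k + 1) a)
    (h0 : SteaneFT.state (k + 1) a.err = 0) {t : Fin 7} (ht : ∀ j, j ≠ t → tagC a ≠ some j) :
    Near t (fun i => π (states (subC a) i)) 0 ∧ Near t (fun i => ρ (states (subC a) i)) 0 := by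
  rw [state_succ, logical_eq] at h0
  obtain ⟨h01, h02⟩ := Prod.mk_eq_zero.1 h0
  have h1 : Near t (xs (states (subC a))) 0 := by
    have := near_decodeBit (t := t) (e := xs (states (subC a))) fun j hj =>
      congrArg Prod.fst (hv j (ht j hj)).1
    rwa [h01] at this
  have h2 : Near t (zs (states (subC a))) 0 := by
    have := near_decodeBit (t := t) (e := zs (states (subC a))) fun j hj =>
      congrArg Prod.snd (hv j (ht j hj)).1
    rwa [h02] at this
  rcases h.parts with ⟨rfl, rfl⟩ | ⟨rfl, rfl⟩
  · exact ⟨h1, h2⟩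
  · exact ⟨h2, h1⟩

/-- Outside `t` the ancilla is a codeword of logical value `0` in both parts, so the measured
pattern is still a codeword there. Any correction is therefore applied at `t`, and the unmeasured
part only gains a trivial codeword. -/
theorem halfK_near (hP : PartSpec rd inj π ρ) (hG : GateSpec G π ρ)
    (hv : ∀ x ∈ Z.support, x.2 = false → Valid (k + 1) x.1)
    (h0 : ∀ x ∈ Z.support, x.2 = false → SteaneFT.state (k + 1) x.1.err = 0)
    {g g' : Fin 7 → Cfg k} {r : Rec} (h : (g', r) ∈ (halfK Z G rd inj g).support)
    (hr : r.2 = false) {t : Fin 7} (ht : ∀ x ∈ r.1, x = some t)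
    (hg : ∀ j, j ≠ t → Valid k (g j)) {b b' : ZMod 2} (hb : Near t (fun i => π (states g i)) b)
    (hb' : Near t (fun i => ρ (states g i)) b') :
    (∀ j, j ≠ t → Valid k (g' j)) ∧ Near t (fun i => π (states g' i)) b ∧
      Near t (fun i => ρ (states g' i)) b' := by
  obtain ⟨a, φ, y, c, ha, hc, hl, hy, hg'⟩ := mem_support_halfK h
  have hφ : ∀ j, j ≠ t → φ j = false := by
    intro j hj
    by_contra hne
    have : some j ∈ r.1 := by
      rw [hl]
      exact List.mem_append_right _ (List.mem_map_of_mem (mem_flagList.2 (by simpa using hne)))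
    exact hj (Option.some.inj (ht _ this))
  have hta : ∀ j, j ≠ t → tagC a ≠ some j := by
    intro j hj hne
    have : some j ∈ r.1 := by rw [hl, hne]; simp
    exact hj (Option.some.inj (ht _ this))
  obtain ⟨n1, n2⟩ := hP.ancilla (hv _ ha hr) (h0 _ ha hr) hta
  have hst := fun j (hj : j ≠ t) => hG.state j _ (hg j hj) (hv _ ha hr j (hta j hj)).2 _ (hy j)
    (hφ j hj)
  have hflip : ∀ j, j ≠ t → relFlips (c.xor (rd (errs fun i => (y i).2))) j = 0 := by
    intro j hj
    rw [relFlips_randomCodeword hc, hP.read]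
    exact (hb.add n1 fun j hj => (hst j hj).2.2).minPattern_eq hj
  have hs : ∀ j, states g' j = SteaneFT.state k (y j).1.err +
      inj (relFlips (c.xor (rd (errs fun i => (y i).2))) j) := by
    intro j
    rw [states, hg', state_shiftC]
  refine ⟨fun j hj => ?_, hb.congr fun j hj => ?_, ?_⟩
  · rw [hg']
    exact valid_shiftC k _ (hG.valid j _ _ (hy j) (hφ j hj)).1
  · rw [hs, (hP.add _ _).1, hP.inj_left, hflip j hj, add_zero]
    exact (hst j hj).1
  · have := hb'.add n2 (e'' := fun i => ρ (states g' i)) fun j hj => by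
      rw [hs, (hP.add _ _).2, hP.inj_right, add_zero]
      exact (hst j hj).2.1
    rwa [add_zero] at this

/-- Relative errors of the data are arbitrary here. A fault-free ancilla has trivial syndrome and
even parity in both parts, so the measured syndrome is that of the data, and the correction cancels
exactly the coset leader. -/
theorem halfK_clean (hP : PartSpec rd inj π ρ) (hG : GateSpec G π ρ)
    (hv : ∀ x ∈ Z.support, x.2 = false → Valid (k + 1) x.1)
    (h0 : ∀ x ∈ Z.support, x.2 = false → SteaneFT.state (k + 1) x.1.err = 0)
    {g g' : Fin 7 → Cfg k} {r : Rec} (h : (g', r) ∈ (halfK Z G rd inj g).support)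
    (hr : r.2 = false) (ht : r.1 = []) (hg : ∀ j, Valid k (g j)) :
    (∀ j, Valid k (g' j)) ∧
      minPattern (fun i => π (states g' i)) = 0 ∧
      minPattern (fun i => ρ (states g' i)) = minPattern (fun i => ρ (states g i)) ∧
      decodeBit (fun i => π (states g' i)) = decodeBit (fun i => π (states g i)) ∧
      decodeBit (fun i => ρ (states g' i)) = decodeBit (fun i => ρ (states g i)) := by
  obtain ⟨a, φ, y, c, ha, hc, hl, hy, hg'⟩ := mem_support_halfK h
  rw [ht] at hl
  obtain ⟨hl1, hl2⟩ := List.append_eq_nil_iff.1 hl.symm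
  have hφ : ∀ j, φ j = false := by
    intro j
    by_contra hne
    have : j ∈ flagList φ := mem_flagList.2 (by simpa using hne)
    rw [List.map_eq_nil_iff.1 hl2] at this
    simp at this
  have hta : ∀ j, tagC a ≠ some j := by
    intro j hne
    rw [hne] at hl1; simp at hl1
  -- Without a distinguished place the pattern is near `0` for every `t`; choosing `t ≠ j` shows
  -- that the coset leader vanishes at `j`.
  have anc : ∀ (u : Fin 7 → ZMod 2), (∀ t, Near t u 0) → syndrome u = 0 ∧ ∑ i, u i = 0 := by
    intro u hu
    have : minPattern u = 0 := by
      funext j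
      obtain ⟨t, ht⟩ := exists_ne j
      exact (hu t).minPattern_eq ht.symm
    have h1 := syndrome_of_minPattern this
    exact ⟨h1, by rw [← decodeBit_of_syndrome h1]; exact (hu 0).decodeBit_eq⟩
  have n := fun t => hP.ancilla (t := t) (hv _ ha hr) (h0 _ ha hr) fun j _ => hta j
  obtain ⟨m1, m2⟩ := anc _ fun t => (n t).1
  obtain ⟨m3, m4⟩ := anc _ fun t => (n t).2
  have hst := fun j => hG.state j _ (hg j) (hv _ ha hr j (hta j)).2 _ (hy j) (hφ j)
  have hflip : relFlips (c.xor (rd (errs fun i => (y i).2))) =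
      minPattern (fun i => π (states g i)) := by
    rw [relFlips_randomCodeword hc]
    refine minPattern_congr ?_
    have : (fun i => π (states (fun i => (y i).2) i)) =
        (fun i => π (states g i)) + fun i => π (states (subC a) i) :=
      funext fun j => (hst j).2.2
    rw [hP.read, this, syndrome_add, m1, add_zero]
  have hs : ∀ j, states g' j = SteaneFT.state k (y j).1.err +
      inj (minPattern (fun i => π (states g i)) j) := by
    intro j
    rw [states, hg', state_shiftC, hflip]
  have e1 : (fun i => π (states g' i)) =
      (fun i => π (states g i)) + minPattern (fun i => π (states g i)) := by
    funext j
    rw [hs, (hP.add _ _).1, hP.inj_left]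
    exact congrArg (· + _) (hst j).1
  have e2 : (fun i => ρ (states g' i)) =
      (fun i => ρ (states g i)) + fun i => ρ (states (subC a) i) := by
    funext j
    rw [hs, (hP.add _ _).2, hP.inj_right, add_zero]
    exact (hst j).2.1
  have e3 : syndrome (fun i => π (states g' i)) = 0 := by
    rw [e1, syndrome_add, syndrome_minPattern]
    exact CharTwo.add_self_eq_zero _
  refine ⟨fun j => ?_, ?_, ?_, ?_, ?_⟩
  · rw [hg']
    exact valid_shiftC k _ (hG.valid j _ _ (hy j) (hφ j)).1
  · exact minPattern_of_syndrome e3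
  · rw [e2]
    exact minPattern_congr (by rw [syndrome_add, m3, add_zero])
  · rw [decodeBit_of_syndrome e3, e1]
    rfl
  · rw [e2, decodeBit_add m3, m4, add_zero]

end Half

/-! ## Rounds of error correction -/

section Round

variable {k : ℕ} {p : ℕ → ℝ≥0∞}

/-- Outside of the place `t`, the states are a codeword with logical state `L`. -/
def NearS (t : Fin 7) (s : Fin 7 → Pauli) (L : Pauli) : Prop :=
  Near t (xs s) L.1 ∧ Near t (zs s) L.2

theorem NearS.logical_eq {t : Fin 7} {s : Fin 7 → Pauli} {L : Pauli} (h : NearS t s L) :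
    logical s = L := by
  rw [SteaneFT.logical_eq, h.1.decodeBit_eq, h.2.decodeBit_eq]

theorem NearS.relState_eq {t : Fin 7} {s : Fin 7 → Pauli} {L : Pauli} (h : NearS t s L)
    {j : Fin 7} (hj : j ≠ t) : relState s j = 0 :=
  Prod.ext (h.1.minPattern_eq hj) (h.2.minPattern_eq hj)

theorem nearS_logical {t : Fin 7} {s : Fin 7 → Pauli} (h : ∀ j, j ≠ t → relState s j = 0) :
    NearS t s (logical s) := by
  rw [SteaneFT.logical_eq]
  exact ⟨near_decodeBit fun j hj => congrArg Prod.fst (h j hj),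
    near_decodeBit fun j hj => congrArg Prod.snd (h j hj)⟩

/-- What is needed of a round of error correction. -/
structure RoundSpec (F : Err (k + 1) → PMF (Err (k + 1)))
    (R : (Fin 7 → Cfg k) → PMF ((Fin 7 → Cfg k) × Rec)) (p : ℕ → ℝ≥0∞) (e₁ e₂ eA : ℝ≥0∞) :
    Prop where
  err : ∀ g, (R g).map (fun x => errs x.1) = F (errs g)
  pres : ∀ g r, Inv (TW p k) (fun g' => R g (g', r))
  rates : Rates3 (Inv (TW p k)) R e₁ e₂ eA
  labels : ∀ g, ∀ x ∈ (R g).support, ∀ y ∈ x.2.1, ∃ j, y = some j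
  clean : ∀ g, ∀ x ∈ (R g).support, x.2 = ([], false) →
    (∀ j, Valid k (x.1 j)) ∧ relState (states x.1) = 0
  near : ∀ g, ∀ x ∈ (R g).support, x.2.2 = false → ∀ t, (∀ y ∈ x.2.1, y = some t) → ∀ L,
    (∀ j, j ≠ t → Valid k (g j)) → NearS t (states g) L →
    (∀ j, j ≠ t → Valid k (x.1 j)) ∧ NearS t (states x.1) L

/-- A round: correction of the subblocks, then the two halves. -/
def roundK (G : Fin 7 → Cfg k → PMF (Cfg k × Bool)) (Z₁ Z₂ : PMF (Cfg (k + 1) × Bool))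
    (G₁ G₂ : Fin 7 → Cfg k × Cfg k → PMF ((Cfg k × Cfg k) × Bool)) (g : Fin 7 → Cfg k) :
    PMF ((Fin 7 → Cfg k) × Rec) :=
  wbind (wbind (trans some G g) (halfK Z₁ G₁ xPart fun a => (a, 0)))
    (halfK Z₂ G₂ zPart fun a => (0, a))

theorem partSpec_x : PartSpec (k := k) xPart (fun a => (a, 0)) Prod.fst Prod.snd where
  parts := Or.inl ⟨rfl, rfl⟩
  read g := funext fun i => value_xPart k (g i).err
  inj_left _ := rfl
  inj_right _ := rfl

theorem partSpec_z : PartSpec (k := k) zPart (fun a => (0, a)) Prod.snd Prod.fst where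
  parts := Or.inr ⟨rfl, rfl⟩
  read g := funext fun i => value_zPart k (g i).err
  inj_left _ := rfl
  inj_right _ := rfl

theorem wbind_map {α β γ : Type} (μ : PMF (α × Rec)) (f : α → PMF (β × Rec)) (h : β → γ) :
    (wbind μ f).map (fun x => h x.1) = μ.bind fun x => (f x.1).map fun y => h y.1 := by
  rw [wbind, PMF.map_bind]
  congr 1; funext x
  rw [PMF.map_comp]; rfl

theorem bind_of_map {α β γ : Type} (μ : PMF α) (f : α → β) (F : β → PMF γ) :
    (μ.bind fun x => F (f x)) = (μ.map f).bind F := by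
  rw [PMF.bind_map]; rfl

theorem trans_map_errs {X : Type} (lab : Fin 7 → Option (Fin 7))
    (K : Fin 7 → X → PMF (Cfg k × Bool)) (F : Fin 7 → PMF (Err k)) (g : Fin 7 → X)
    (h : ∀ i, (K i (g i)).map (fun x => x.1.err) = F i) :
    (trans lab K g).map (fun x => errs x.1) = (indep 7 F : PMF (Err (k + 1))) := by
  rw [trans, PMF.map_comp]
  change (indep 7 _).map (fun (r : Fin 7 → Cfg k × Bool) i => (r i).1.err) = _
  rw [indep_map 7 _ (fun x : Cfg k × Bool => x.1.err)]
  simp only [h]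

theorem trans_map_errs₂ {X : Type} (lab : Fin 7 → Option (Fin 7))
    (K : Fin 7 → X → PMF ((Cfg k × Cfg k) × Bool)) (F : Fin 7 → PMF (Err k × Err k))
    (g : Fin 7 → X) (h : ∀ i, (K i (g i)).map (fun x => (x.1.1.err, x.1.2.err)) = F i) :
    (trans lab K g).map (fun x i => ((x.1 i).1.err, (x.1 i).2.err)) = indep 7 F := by
  rw [trans, PMF.map_comp]
  change (indep 7 _).map (fun (r : Fin 7 → (Cfg k × Cfg k) × Bool) i =>
    ((r i).1.1.err, (r i).1.2.err)) = _
  rw [indep_map 7 _ (fun x : (Cfg k × Cfg k) × Bool => (x.1.1.err, x.1.2.err))]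
  simp only [h]

theorem halfK_map {Z : PMF (Cfg (k + 1) × Bool)}
    {G : Fin 7 → Cfg k × Cfg k → PMF ((Cfg k × Cfg k) × Bool)}
    {rd : Err (k + 1) → Bits (k + 1)} {inj : ZMod 2 → Pauli}
    {z : PMF (Err (k + 1))} (hz : Z.map (fun x => x.1.err) = z)
    {F : Fin 7 → Err k → Err k → PMF (Err k × Err k)}
    (hF : ∀ i x, (G i x).map (fun x => (x.1.1.err, x.1.2.err)) = F i x.1.err x.2.err)
    (g : Fin 7 → Cfg k) :
    (halfK Z G rd inj g).map (fun x => errs x.1) = z.bind fun a =>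
      (indep 7 fun i => F i (g i).err (a i)).bind fun r =>
      (randomCodeword (k + 1)).map fun c =>
        (show Err (k + 1) from fun i => shift k
          (inj (relFlips (c.xor (rd (show Err (k + 1) from fun i => (r i).2))) i)) (r i).1) := by
  let H : (Fin 7 → Err k × Err k) → PMF (Err (k + 1)) := fun r =>
    (randomCodeword (k + 1)).map fun c => (show Err (k + 1) from fun i => shift k
      (inj (relFlips (c.xor (rd (show Err (k + 1) from fun i => (r i).2))) i)) (r i).1)
  have h1 : ∀ y : Fin 7 → Cfg k × Cfg k, (halfFix rd inj y).map (fun x => errs x.1) =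
      H fun i => ((y i).1.err, (y i).2.err) := by
    intro y
    rw [halfFix, PMF.map_comp]
    change (randomCodeword (k + 1)).map _ = (randomCodeword (k + 1)).map _
    congr 1
    funext c
    funext i
    exact shiftC_err k _ _
  rw [halfK, wbind_map]
  simp only [h1]
  rw [bind_of_map _ (fun x : (Fin 7 → Cfg k × Cfg k) × Rec =>
    fun i => ((x.1 i).1.err, (x.1 i).2.err)) H,
    wbind_map (h := fun y : Fin 7 → Cfg k × Cfg k => fun i => ((y i).1.err, (y i).2.err))]
  have h2 : ∀ y : Fin 7 → Cfg k × Cfg k,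
      (trans some G y).map (fun x i => ((x.1 i).1.err, (x.1 i).2.err)) =
      indep 7 fun i => F i (y i).1.err (y i).2.err := fun y =>
    trans_map_errs₂ some G _ y fun i => hF i (y i)
  simp only [h2]
  rw [PMF.bind_bind, halfPrep, PMF.bind_map, ← hz, PMF.bind_map]
  rfl

theorem roundK_map {G : Fin 7 → Cfg k → PMF (Cfg k × Bool)} {Z₁ Z₂ : PMF (Cfg (k + 1) × Bool)}
    {G₁ G₂ : Fin 7 → Cfg k × Cfg k → PMF ((Cfg k × Cfg k) × Bool)}
    {f : Fin 7 → Err k → PMF (Err k)} (hf : ∀ i c, (G i c).map (fun x => x.1.err) = f i c.err)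
    {H₁ H₂ : Err (k + 1) → PMF (Err (k + 1))}
    (h₁ : ∀ g, (halfK Z₁ G₁ xPart (fun a => (a, 0)) g).map (fun x => errs x.1) = H₁ (errs g))
    (h₂ : ∀ g, (halfK Z₂ G₂ zPart (fun a => (0, a)) g).map (fun x => errs x.1) = H₂ (errs g))
    (g : Fin 7 → Cfg k) : (roundK G Z₁ Z₂ G₁ G₂ g).map (fun x => errs x.1) =
      ((indep 7 fun i => f i (errs g i) : PMF (Err (k + 1))).bind fun e => (H₁ e).bind H₂) := by
  rw [roundK, wbind_map]
  simp only [h₂]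
  rw [bind_of_map _ (fun x : (Fin 7 → Cfg k) × Rec => errs x.1), wbind_map]
  simp only [h₁]
  rw [bind_of_map _ (fun x : (Fin 7 → Cfg k) × Rec => errs x.1),
    trans_map_errs some G (fun i => f i (g i).err) g fun i => hf i (g i)]
  exact PMF.bind_bind _ _ _

/-- The rates come from seven corrections and two halves. In a clean round the X half removes
relative X errors, and the Z half removes relative Z errors while keeping the X syndrome; neither
assumes anything about the relative errors that enter. -/
theorem roundK_spec {G : Fin 7 → Cfg k → PMF (Cfg k × Bool)} {Z₁ Z₂ : PMF (Cfg (k + 1) × Bool)}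
    {G₁ G₂ : Fin 7 → Cfg k × Cfg k → PMF ((Cfg k × Cfg k) × Bool)}
    {F : Err (k + 1) → PMF (Err (k + 1))} {f : Fin 7 → Err k → PMF (Err k)}
    {z₁ z₂ : PMF (Err (k + 1))} {a A B C : ℝ≥0∞}
    (herr : ∀ g, (roundK G Z₁ Z₂ G₁ G₂ g).map (fun x => errs x.1) = F (errs g))
    (hG : ∀ i, CorrSpec (f i) (G i) p B)
    (hZ₁ : AncSpec z₁ Z₁ p A) (hZ₂ : AncSpec z₂ Z₂ p A)
    (ha₁ : E Z₁ (fun x => ind (tagC x.1 ≠ none)) ≤ a)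
    (ha₂ : E Z₂ (fun x => ind (tagC x.1 ≠ none)) ≤ a)
    (hG₁ : GateSpec G₁ Prod.fst Prod.snd) (hG₂ : GateSpec G₂ Prod.snd Prod.fst)
    (hp₁ : ∀ i x f, PairTW p k (fun y => G₁ i x (y, f)))
    (hp₂ : ∀ i x f, PairTW p k (fun y => G₂ i x (y, f)))
    (hC₁ : ∀ i, Bd (PairTW p k) (fun x => E (G₁ i x) (fun y => ind (y.2 = true))) C)
    (hC₂ : ∀ i, Bd (PairTW p k) (fun x => E (G₂ i x) (fun y => ind (y.2 = true))) C) :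
    RoundSpec F (roundK G Z₁ Z₂ G₁ G₂) p (7 * B + (a + 7 * C) + (a + 7 * C))
      (21 * B ^ 2 + (21 * C ^ 2 + a * (7 * C)) + 7 * B * (a + 7 * C) +
        (21 * C ^ 2 + a * (7 * C)) + (7 * B + (a + 7 * C)) * (a + 7 * C)) (A + A) := by
  have p1 : ∀ {I}, Pres I (trans some G) (Inv (TW p k)) :=
    trans_pres (TW.isCone k) some fun i x f => (hG i).tw x f
  have p2 : ∀ {I}, Pres I (halfK Z₁ G₁ xPart fun a => (a, 0)) (Inv (TW p k)) := halfK_pres hp₁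
  have p3 : ∀ {I}, Pres I (halfK Z₂ G₂ zPart fun a => (0, a)) (Inv (TW p k)) := halfK_pres hp₂
  have cI := Inv.isCone (TW.isCone (p := p) k)
  have split : ∀ g, ∀ x ∈ (roundK G Z₁ Z₂ G₁ G₂ g).support, ∃ (g₁ g₂ : Fin 7 → Cfg k)
      (φ : Fin 7 → Bool) (r₂ r₃ : Rec), (∀ i, (g₁ i, φ i) ∈ (G i (g i)).support) ∧
      (g₂, r₂) ∈ (halfK Z₁ G₁ xPart (fun a => (a, 0)) g₁).support ∧
      (x.1, r₃) ∈ (halfK Z₂ G₂ zPart (fun a => (0, a)) g₂).support ∧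
      x.2.1 = (flagList φ).map some ++ r₂.1 ++ r₃.1 ∧ x.2.2 = (r₂.2 || r₃.2) := by
    rintro g ⟨g', r⟩ hx
    obtain ⟨g₂, s, r₃, h0, h3, rfl⟩ := mem_support_wbind.1 hx
    obtain ⟨g₁, r₁, r₂, h1, h2, rfl⟩ := mem_support_wbind.1 h0
    obtain ⟨h4, φ, h5, h6⟩ := mem_support_trans h1
    exact ⟨g₁, g₂, φ, r₂, r₃, h6, h2, h3, by simp [Rec.append, h5], by simp [Rec.append, h4]⟩
  refine ⟨herr, ?_, ?_, ?_, ?_, ?_⟩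
  · intro g r
    have : Pres (fun _ => True) (roundK G Z₁ Z₂ G₁ G₂) (Inv (TW p k)) :=
      Pres.comp cI (Pres.comp (J := fun _ => True) cI (fun _ _ _ => trivial) p2) p3
    -- Applied to a point mass, preservation becomes a statement for the single input `g`.
    have h := this (fun x => ind (x = g)) trivial r
    have e : ∀ b, ∑' x, ind (x = g) * roundK G Z₁ Z₂ G₁ G₂ x (b, r) =
        roundK G Z₁ Z₂ G₁ G₂ g (b, r) := by
      intro b
      rw [tsum_eq_single g]
      · simp [ind]
      · intro x hx; simp [ind, hx]
    simpa only [e] using h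
  · have h := ((trans_rates some fun i => (hG i).fail).comp p1
      (halfK_rates (inj := fun a => (a, 0)) (rd := xPart) hZ₁.tw ha₁ hZ₁.fail hp₁ hC₁)).comp
      (p1.comp cI p2)
      (halfK_rates (inj := fun a => (0, a)) (rd := zPart) hZ₂.tw ha₂ hZ₂.fail hp₂ hC₂)
    simp only [zero_add] at h
    exact h
  · intro g x hx y hy
    obtain ⟨g₁, g₂, φ, r₂, r₃, -, h2, h3, h4, -⟩ := split g x hx
    rw [h4] at hy
    obtain ⟨_, φ₂, _, _, -, -, h5, -⟩ := mem_support_halfK h2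
    obtain ⟨_, φ₃, _, _, -, -, h6, -⟩ := mem_support_halfK h3
    simp only [h5, h6, List.mem_append, List.mem_map] at hy
    obtain ((⟨j, -, rfl⟩ | ⟨j, -, rfl⟩ | ⟨j, -, rfl⟩) | ⟨j, -, rfl⟩ | ⟨j, -, rfl⟩) := hy <;>
      exact ⟨j, rfl⟩
  · intro g x hx hr
    obtain ⟨g₁, g₂, φ, r₂, r₃, h1, h2, h3, h4, h5⟩ := split g x hx
    rw [hr] at h4 h5
    simp only [List.nil_eq, List.append_eq_nil_iff, List.map_eq_nil_iff, Bool.false_eq,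
      Bool.or_eq_false_iff] at h4 h5
    -- Unflagged corrections of level `k` make all subblocks valid, whatever they received.
    have v1 : ∀ j, Valid k (g₁ j) := fun j => (hG j).valid _ _ (h1 j) (by
      by_contra hne
      have : j ∈ flagList φ := mem_flagList.2 (by simpa using hne)
      rw [h4.1.1] at this
      simp at this)
    obtain ⟨v2, c1, -, -, -⟩ := halfK_clean partSpec_x hG₁ hZ₁.valid hZ₁.state h2 h5.1 h4.1.2 v1
    obtain ⟨v3, c2, c3, -, -⟩ := halfK_clean partSpec_z hG₂ hZ₂.valid hZ₂.state h3 h5.2 h4.2 v2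
    refine ⟨v3, ?_⟩
    rw [c1] at c3
    funext j
    exact Prod.ext (congrFun c3 j) (congrFun c2 j)
  · intro g x hx hr t ht L hg hL
    obtain ⟨g₁, g₂, φ, r₂, r₃, h1, h2, h3, h4, h5⟩ := split g x hx
    rw [h4] at ht
    rw [hr, Bool.false_eq, Bool.or_eq_false_iff] at h5
    have hφ : ∀ j, j ≠ t → φ j = false := by
      intro j hj
      by_contra hne
      have := ht (some j) (List.mem_append_left _ (List.mem_append_left _
        (List.mem_map_of_mem (mem_flagList.2 (by simpa using hne)))))
      exact hj (Option.some.inj this)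
    have v1 : ∀ j, j ≠ t → Valid k (g₁ j) := fun j hj => (hG j).valid _ _ (h1 j) (hφ j hj)
    have s1 : ∀ j, j ≠ t → states g₁ j = states g j := fun j hj =>
      (hG j).state _ (hg j hj) _ (h1 j) (hφ j hj)
    obtain ⟨v2, n1, n2⟩ := halfK_near partSpec_x hG₁ hZ₁.valid hZ₁.state h2 h5.1
      (fun y hy => ht y (List.mem_append_left _ (List.mem_append_right _ hy))) v1
      (hL.1.congr fun j hj => congrArg Prod.fst (s1 j hj))
      (hL.2.congr fun j hj => congrArg Prod.snd (s1 j hj))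
    obtain ⟨v3, n3, n4⟩ := halfK_near partSpec_z hG₂ hZ₂.valid hZ₂.state h3 h5.2
      (fun y hy => ht y (List.mem_append_right _ hy)) v2 n2 n1
    exact ⟨v3, n4, n3⟩

end Round

/-! ## Error correction -/

section Correction

variable {k : ℕ} {p : ℕ → ℝ≥0∞}

theorem E_section {α β : Type} (m : α × β → ℝ≥0∞) (b : β) (φ : α → ℝ≥0∞) :
    E (fun x => m (x, b)) φ = E m (fun y => ind (y.2 = b) * φ y.1) := by
  rw [E_prod, E]
  refine tsum_congr fun a => ?_
  rw [tsum_eq_single b]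
  · simp [ind]
  · intro b' hb; simp [ind, hb]

theorem E_cfg (m φ : Cfg (k + 1) → ℝ≥0∞) :
    E m φ = ∑' t, E (fun g => m (mkC t g)) (fun g => φ (mkC t g)) := E_prod m φ

theorem mass_cfg (m : Cfg (k + 1) → ℝ≥0∞) : mass m = ∑' t, mass (fun g => m (mkC t g)) :=
  mass_prod m

theorem TW.sections {m : Cfg (k + 1) → ℝ≥0∞} (h : TW p (k + 1) m) (t : Option (Fin 7)) :
    Inv (TW p k) (fun g => m (mkC t g)) := fun i g => h.2 t i g

theorem Inv.restrict {m : (Fin 7 → Cfg k) → ℝ≥0∞} (h : Inv (TW p k) m)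
    (S : (Fin 7 → Pauli) → Prop) : Inv (TW p k) (fun g => m g * ind (S (states g))) := by
  intro i g
  simp only [states_update]
  exact (h i g).restrict fun P => S (Function.update (states g) i P)

/-- Bounds on averages over the subblocks, for tagged blocks. -/
theorem Bd.tagged {ψ : (Fin 7 → Cfg k) → ℝ≥0∞} {e : ℝ≥0∞} (h : Bd (Inv (TW p k)) ψ e) :
    Bd (TW p (k + 1)) (fun c => ind (tagC c ≠ none) * ψ (subC c)) (e * p (k + 1)) := by
  intro m hm
  calc E m (fun c => ind (tagC c ≠ none) * ψ (subC c))
      = ∑' t : Option (Fin 7), ind (t ≠ none) * E (fun g => m (mkC t g)) ψ := by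
        rw [E_cfg]
        exact tsum_congr fun t => by rw [← E_mul_left]; rfl
    _ ≤ ∑' t : Option (Fin 7), ind (t ≠ none) * (e * mass (fun g => m (mkC t g))) :=
        ENNReal.tsum_le_tsum fun t => mul_le_mul_right (h _ (hm.sections t)) _
    _ = e * E m (fun c => ind (tagC c ≠ none)) := by
        rw [E_cfg, ← ENNReal.tsum_mul_left]
        refine tsum_congr fun t => ?_
        simp only [tagC_mkC, E_const]; ring
    _ ≤ e * (p (k + 1) * mass m) := mul_le_mul_right hm.tag_le _
    _ = _ := by ring

theorem Bd.sub {ψ : (Fin 7 → Cfg k) → ℝ≥0∞} {e : ℝ≥0∞} (h : Bd (Inv (TW p k)) ψ e) :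
    Bd (TW p (k + 1)) (fun c => ψ (subC c)) e := by
  intro m hm
  rw [E_cfg, mass_cfg, ← ENNReal.tsum_mul_left]
  exact ENNReal.tsum_le_tsum fun t => h _ (hm.sections t)

/-- An error correction fails if the faults, together with an uncontrolled input subblock, are at
least two, or if an ancilla has failed. -/
def corrFails (t : Option (Fin 7)) (r : Rec) : Prop :=
  2 ≤ t.toList.length + r.1.length ∨ r.2 = true

open Classical in
/-- The output block of an error correction. -/
def corrOut (t : Option (Fin 7)) (r₁ : Rec) (g : Fin 7 → Cfg k) (r₂ : Rec) :
    Cfg (k + 1) × Bool :=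
  -- Dropping the tags on failure makes tag-wellness trivial there. Otherwise there is at most one
  -- fault, and only a fault of the second round can survive, since a later clean round repairs one
  -- of the first round.
  if corrFails t (r₁.append r₂) then (untag (k + 1) (errs g), true)
  else (mkC r₂.1.head?.join g, false)

theorem corrOut_err (t : Option (Fin 7)) (r₁ : Rec) (g : Fin 7 → Cfg k) (r₂ : Rec) :
    (corrOut t r₁ g r₂).1.err = errs g := by
  unfold corrOut
  split_ifs
  · exact untag_err _ _
  · rfl

theorem corrOut_flag (t : Option (Fin 7)) (r₁ : Rec) (g : Fin 7 → Cfg k) (r₂ : Rec) :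
    (corrOut t r₁ g r₂).2 = true ↔ corrFails t (r₁.append r₂) := by
  unfold corrOut
  split_ifs with h <;> simp [h]

theorem corrOut_state (t : Option (Fin 7)) (r₁ : Rec) (g : Fin 7 → Cfg k) (r₂ : Rec) :
    state (k + 1) (corrOut t r₁ g r₂).1.err = logical (states g) := by
  rw [corrOut_err]; rfl

/-- Error correction: two rounds. -/
def corrK (R₁ R₂ : (Fin 7 → Cfg k) → PMF ((Fin 7 → Cfg k) × Rec)) (c : Cfg (k + 1)) :
    PMF (Cfg (k + 1) × Bool) :=
  (R₁ (subC c)).bind fun x => (R₂ x.1).map fun y => corrOut (tagC c) x.2 y.1 y.2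

variable {R₁ R₂ : (Fin 7 → Cfg k) → PMF ((Fin 7 → Cfg k) × Rec)}
  {F₁ F₂ : Err (k + 1) → PMF (Err (k + 1))} {e₁ e₂ eA : ℝ≥0∞}

theorem E_corrK (c : Cfg (k + 1)) (φ : Cfg (k + 1) × Bool → ℝ≥0∞) :
    E (corrK R₁ R₂ c) φ =
      E (R₁ (subC c)) (fun x => E (R₂ x.1) (fun y => φ (corrOut (tagC c) x.2 y.1 y.2))) := by
  rw [corrK, E_bind]
  congr 1; funext x; rw [E_map]

theorem corrK_fail_eq (c : Cfg (k + 1)) :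
    E (corrK R₁ R₂ c) (fun x => ind (x.2 = true)) =
      E (wbind (R₁ (subC c)) R₂) (fun x => ind (corrFails (tagC c) x.2)) := by
  rw [E_corrK, E_wbind]
  simp only [corrOut_flag]

theorem corrK_fail_none {c : Cfg (k + 1)} (hc : tagC c = none) :
    E (corrK R₁ R₂ c) (fun x => ind (x.2 = true)) ≤
      E (wbind (R₁ (subC c)) R₂) (fun x => ind (2 ≤ x.2.1.length)) +
        E (wbind (R₁ (subC c)) R₂) (fun x => ind (x.2.2 = true)) := by
  rw [corrK_fail_eq, ← E_add]
  refine E_mono fun x => (ind_mono ?_).trans (ind_or_le _ _)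
  simp [corrFails, hc]

theorem corrK_fail_some (c : Cfg (k + 1)) :
    E (corrK R₁ R₂ c) (fun x => ind (x.2 = true)) ≤
      E (wbind (R₁ (subC c)) R₂) (fun x => ind (1 ≤ x.2.1.length)) +
        E (wbind (R₁ (subC c)) R₂) (fun x => ind (x.2.2 = true)) := by
  rw [corrK_fail_eq, ← E_add]
  refine E_mono fun x => (ind_mono ?_).trans (ind_or_le _ _)
  have : (tagC c).toList.length ≤ 1 := by cases tagC c <;> simp
  rintro (h | h)
  · exact Or.inl (by omega)
  · exact Or.inr h

theorem mem_support_corrK {c : Cfg (k + 1)} {x : Cfg (k + 1) × Bool}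
    (h : x ∈ (corrK R₁ R₂ c).support) : ∃ (g g' : Fin 7 → Cfg k) (r₁ r₂ : Rec),
      (g, r₁) ∈ (R₁ (subC c)).support ∧ (g', r₂) ∈ (R₂ g).support ∧
      x = corrOut (tagC c) r₁ g' r₂ := by
  simp only [corrK, PMF.mem_support_bind_iff, PMF.mem_support_map_iff] at h
  obtain ⟨⟨g, r₁⟩, h1, ⟨g', r₂⟩, h2, rfl⟩ := h
  exact ⟨g, g', r₁, r₂, h1, h2, rfl⟩

theorem corrOut_of_not {t : Option (Fin 7)} {r₁ : Rec} {g : Fin 7 → Cfg k} {r₂ : Rec}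
    (h : (corrOut t r₁ g r₂).2 = false) :
    corrOut t r₁ g r₂ = (mkC r₂.1.head?.join g, false) ∧
      t.toList.length + r₁.1.length + r₂.1.length ≤ 1 ∧ r₁.2 = false ∧ r₂.2 = false := by
  have h' : ¬corrFails t (r₁.append r₂) := by
    rw [← corrOut_flag (g := g), h]; simp
  refine ⟨by simp [corrOut, h'], ?_⟩
  simp only [corrFails, Rec.append, List.length_append, not_or, Bool.or_eq_true] at h'
  refine ⟨by omega, ?_, ?_⟩ <;> simp_all

/-- With at most one fault, one of the rounds is clean. If the second is, it removes all relative
errors; if not, the first has done so and the single fault of the second stays at its place, which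
is tagged. -/
theorem corrK_valid (h₁ : RoundSpec F₁ R₁ p e₁ e₂ eA) (h₂ : RoundSpec F₂ R₂ p e₁ e₂ eA)
    (c : Cfg (k + 1)) (x : Cfg (k + 1) × Bool) (hx : x ∈ (corrK R₁ R₂ c).support)
    (hf : x.2 = false) : Valid (k + 1) x.1 := by
  obtain ⟨g, g', r₁, r₂, hr₁, hr₂, rfl⟩ := mem_support_corrK hx
  obtain ⟨e, hl, ha₁, ha₂⟩ := corrOut_of_not hf
  rw [e]
  rcases r₂ with ⟨l₂, f₂⟩
  rcases r₁ with ⟨l₁, f₁⟩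
  simp only at ha₁ ha₂ hl
  subst ha₁ ha₂
  match l₂, hl, hr₂ with
  | [], _, hr₂ =>
    obtain ⟨hv, hrel⟩ := h₂.clean _ _ hr₂ rfl
    intro i _
    exact ⟨congrFun hrel i, hv i⟩
  | y :: l, hl, hr₂ =>
    simp only [List.length_cons] at hl
    obtain rfl : l = [] := List.length_eq_zero_iff.1 (by omega)
    obtain rfl : l₁ = [] := List.length_eq_zero_iff.1 (by omega)
    obtain ⟨t, rfl⟩ := h₂.labels _ _ hr₂ y (by simp)
    obtain ⟨hv, hrel⟩ := h₁.clean _ _ hr₁ rfl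
    obtain ⟨hv', hn⟩ := h₂.near _ _ hr₂ rfl t (by simp) _ (fun j _ => hv j)
      (nearS_logical fun j _ => congrFun hrel j)
    intro i hi
    have hit : i ≠ t := by
      rintro rfl; exact hi rfl
    exact ⟨hn.relState_eq hit, hv' i hit⟩

/-- The tag of the input and the faults together occupy at most one place, so `near` applies to both
rounds with the same place. -/
theorem corrK_state (h₁ : RoundSpec F₁ R₁ p e₁ e₂ eA) (h₂ : RoundSpec F₂ R₂ p e₁ e₂ eA)
    (c : Cfg (k + 1)) (hc : Valid (k + 1) c) (x : Cfg (k + 1) × Bool)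
    (hx : x ∈ (corrK R₁ R₂ c).support) (hf : x.2 = false) :
    state (k + 1) x.1.err = state (k + 1) c.err := by
  obtain ⟨g, g', r₁, r₂, hr₁, hr₂, rfl⟩ := mem_support_corrK hx
  obtain ⟨-, hl, ha₁, ha₂⟩ := corrOut_of_not hf
  rw [corrOut_state]
  have : ∃ t, (∀ j, j ≠ t → tagC c ≠ some j) ∧ (∀ y ∈ r₁.1, y = some t) ∧
      ∀ y ∈ r₂.1, y = some t := by
    rcases h : tagC c with _ | t
    · rcases h' : r₁.1 with _ | ⟨y, l⟩
      · rcases h'' : r₂.1 with _ | ⟨y, l⟩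
        -- With neither tag nor fault any place would do.
        · exact ⟨0, by simp⟩
        · obtain ⟨t, rfl⟩ := h₂.labels _ _ hr₂ y (by simp [h''])
          rw [h''] at hl
          simp only [List.length_cons] at hl
          obtain rfl : l = [] := List.length_eq_zero_iff.1 (by omega)
          exact ⟨t, by simp⟩
      · obtain ⟨t, rfl⟩ := h₁.labels _ _ hr₁ y (by simp [h'])
        rw [h'] at hl
        simp only [List.length_cons] at hl
        obtain rfl : l = [] := List.length_eq_zero_iff.1 (by omega)
        rw [List.length_eq_zero_iff.1 (show r₂.1.length = 0 by omega)]
        exact ⟨t, by simp⟩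
    · rw [h] at hl
      simp only [Option.toList_some, List.length_singleton] at hl
      rw [List.length_eq_zero_iff.1 (show r₁.1.length = 0 by omega),
        List.length_eq_zero_iff.1 (show r₂.1.length = 0 by omega)]
      exact ⟨t, fun j hj e => hj (Option.some.inj e).symm, by simp, by simp⟩
  obtain ⟨t, ht, ht₁, ht₂⟩ := this
  obtain ⟨v1, n1⟩ := h₁.near _ _ hr₁ ha₁ t ht₁ (logical (states (subC c)))
    (fun j hj => (hc j (ht j hj)).2) (nearS_logical fun j hj => (hc j (ht j hj)).1)
  exact (h₂.near _ _ hr₂ ha₂ t ht₂ _ v1 n1).2.logical_eq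

theorem corrK_err (h₁ : RoundSpec F₁ R₁ p e₁ e₂ eA) (h₂ : RoundSpec F₂ R₂ p e₁ e₂ eA)
    (c : Cfg (k + 1)) : (corrK R₁ R₂ c).map (fun x => x.1.err) = (F₁ c.err).bind F₂ := by
  have : ∀ x : (Fin 7 → Cfg k) × Rec, PMF.map (fun x => x.1.err)
      ((R₂ x.1).map fun y => corrOut (tagC c) x.2 y.1 y.2) = F₂ (errs x.1) := by
    intro x
    rw [PMF.map_comp, ← h₂.err]
    congr 1
    funext y
    exact corrOut_err _ _ _ _
  rw [corrK, PMF.map_bind]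
  simp only [this]
  rw [bind_of_map _ (fun x : (Fin 7 → Cfg k) × Rec => errs x.1), h₁.err]
  rfl

/-- Failure and the new tag depend only on the records and on the input tag, so for a prescribed tag
the output is a mixture of slices of `R₂`. -/
theorem corrK_tw_sub (h₂ : RoundSpec F₂ R₂ p e₁ e₂ eA) (c : Cfg (k + 1)) (t : Option (Fin 7)) :
    Inv (TW p k) (fun g => corrK R₁ R₂ c (mkC t g, false)) := by
  have e : ∀ g, corrK R₁ R₂ c (mkC t g, false) = ∑' x : ((Fin 7 → Cfg k) × Rec) × Rec,
      (R₁ (subC c) x.1 * ind (¬corrFails (tagC c) (x.1.2.append x.2) ∧ x.2.1.head?.join = t)) *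
        R₂ x.1.1 (g, x.2) := by
    intro g
    rw [corrK, bind_apply_E, E]
    conv_rhs => rw [ENNReal.tsum_prod']
    refine tsum_congr fun x => ?_
    rw [map_apply_E, E_prod, tsum_eq_single g, ← ENNReal.tsum_mul_left]
    · refine tsum_congr fun r => ?_
      rw [mul_comm (R₂ x.1 (g, r)), mul_assoc]
      congr 2
      refine ind_congr ?_
      unfold corrOut
      split_ifs with h
      · simp [h]
      · simp only [h, not_false_eq_true, true_and, Prod.mk.injEq, and_true]
        exact ⟨fun e => congrArg tagC e, fun e => by rw [e]⟩
    · intro g' hg'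
      refine ENNReal.tsum_eq_zero.2 fun r => ?_
      rw [ind_false, mul_zero]
      unfold corrOut
      split_ifs with h
      · simp
      · simp only [Prod.mk.injEq, and_true]
        exact fun e => hg' (congrArg subC e)
  simp only [e]
  exact Inv.isCone (TW.isCone k) _ _ _ fun x => h₂.pres _ _

/-- The state is settled before the second round. On the clean runs of the first round with state
`s`, a tag costs a second-round fault (at most `e₁`), while all but `e₁ + eA` of the mass ends
untagged with the same state; `hp` compares the two. -/
theorem corrK_tw_tag (h₁ : RoundSpec F₁ R₁ p e₁ e₂ eA) (h₂ : RoundSpec F₂ R₂ p e₁ e₂ eA)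
    (hp : e₁ + p (k + 1) * (e₁ + eA) ≤ p (k + 1)) (hfin : p (k + 1) * (e₁ + eA) ≠ ⊤)
    (c : Cfg (k + 1)) (s : Pauli) :
    E (fun x => corrK R₁ R₂ c (x, false)) (fun x => ind (state (k + 1) x.err = s ∧ tagC x ≠ none))
      ≤ p (k + 1) * E (fun x => corrK R₁ R₂ c (x, false)) (fun x => ind (state (k + 1) x.err = s)) := by
  -- `M` is the law after a fault-free first round from an untagged input, restricted to decoded
  -- state `s`. As a restriction by states it still consists of `TW` masses, so the rates of the
  -- second round apply to it.
  set Q : (Fin 7 → Pauli) → Prop := fun σ => tagC c = none ∧ logical σ = s with hQ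
  set M : (Fin 7 → Cfg k) → ℝ≥0∞ := fun g => R₁ (subC c) (g, ([], false)) * ind (Q (states g))
    with hM
  have hMI : Inv (TW p k) M := (h₁.pres _ _).restrict Q
  have key : ∀ χ : (Fin 7 → Cfg k) → ℝ≥0∞, E (R₁ (subC c)) (fun x =>
      ind (x.2 = ([], false)) * (ind (Q (states x.1)) * χ x.1)) = E M χ := by
    intro χ
    rw [← E_section (R₁ (subC c)) ([], false) (fun g => ind (Q (states g)) * χ g)]
    exact tsum_congr fun g => by rw [hM]; ring
  have hMle : mass M ≤ 1 := by
    have := key (fun _ => 1)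
    rw [E_one] at this
    rw [← this]
    refine E_le_of_pmf fun x _ => ?_
    rw [mul_one]
    exact mul_le_one' (ind_le_one _) (ind_le_one _)
  -- An unflagged tagged output uses up the one allowed fault in the second round. The input is then
  -- untagged, the first round clean, and the state unchanged by the second round.
  have num : E (fun x => corrK R₁ R₂ c (x, false))
      (fun x => ind (state (k + 1) x.err = s ∧ tagC x ≠ none)) ≤
      E M (fun g => E (R₂ g) (fun y => ind (1 ≤ y.2.1.length))) := by
    rw [E_section, E_corrK, ← key]
    refine E_mono_support fun ⟨g, l₁, f₁⟩ hx => ?_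
    simp only [← E_mul_left]
    refine E_mono_support fun ⟨g', l₂, f₂⟩ hy => ?_
    rw [← ind_and, ← ind_and, ← ind_and]
    refine ind_mono fun ⟨hf, hs, ht⟩ => ?_
    obtain ⟨e, hl, ha₁, ha₂⟩ := corrOut_of_not hf
    rw [corrOut_state] at hs
    rw [e] at ht
    simp only at hl ha₁ ha₂ hs ht ⊢
    have hl₂ : 1 ≤ l₂.length := by
      rcases l₂ with _ | ⟨a, l⟩
      · exact absurd rfl ht
      · simp
    have hl₁ : l₁ = [] := List.length_eq_zero_iff.1 (by omega)
    have hc : tagC c = none := by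
      rcases h : tagC c with _ | t
      · rfl
      · rw [h] at hl; simp only [Option.toList_some, List.length_singleton] at hl; omega
    subst hl₁ ha₁
    refine ⟨rfl, ⟨hc, ?_⟩, hl₂⟩
    obtain ⟨hv, hrel⟩ := h₁.clean _ _ ((PMF.mem_support_iff _ _).2 hx) rfl
    rcases l₂ with _ | ⟨a, l⟩
    · simp at hl₂
    · obtain ⟨t, rfl⟩ := h₂.labels _ _ ((PMF.mem_support_iff _ _).2 hy) a (by simp)
      simp only [List.length_cons] at hl
      obtain rfl : l = [] := List.length_eq_zero_iff.1 (by omega)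
      rw [← hs]
      exact (h₂.near _ _ ((PMF.mem_support_iff _ _).2 hy) ha₂ t (by simp) _ (fun j _ => hv j)
        (nearS_logical fun j _ => congrFun hrel j)).2.logical_eq.symm
  have den : E M (fun g => E (R₂ g) (fun y => ind (y.2 = ([], false)))) ≤
      E (fun x => corrK R₁ R₂ c (x, false)) (fun x => ind (state (k + 1) x.err = s)) := by
    rw [E_section, E_corrK, ← key]
    refine E_mono_support fun x hx => ?_
    simp only [← E_mul_left]
    refine E_mono_support fun y hy => ?_
    rw [← ind_and, ← ind_and, ← ind_and]
    refine ind_mono fun ⟨hr₁, ⟨hc, hs⟩, hr₂⟩ => ?_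
    obtain ⟨hv, hrel⟩ := h₁.clean _ _ ((PMF.mem_support_iff _ _).2 hx) hr₁
    have hn := (h₂.near _ _ ((PMF.mem_support_iff _ _).2 hy) (by rw [hr₂]) 0 (by rw [hr₂]; simp) _
      (fun j _ => hv j) (nearS_logical fun j _ => congrFun hrel j)).2.logical_eq
    refine ⟨?_, by rw [corrOut_state, hn, hs]⟩
    rw [hr₁, hr₂, hc]
    have : ¬corrFails none (Rec.append ([], false) ([], false)) := by simp [corrFails, Rec.append]
    simp [corrOut, this]
  have tot : mass M ≤ E M (fun g => E (R₂ g) (fun y => ind (y.2 = ([], false)))) +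
      (e₁ + eA) * mass M := by
    have h1 := h₂.rates.one M hMI
    have h2 := h₂.rates.anc M hMI
    calc mass M ≤ E M (fun g => E (R₂ g) (fun y => ind (y.2 = ([], false))) +
          (E (R₂ g) (fun y => ind (1 ≤ y.2.1.length)) + E (R₂ g) (fun y => ind (y.2.2 = true)))) := by
          rw [← E_one]
          refine E_mono fun g => ?_
          rw [← mass_pmf (R₂ g), ← E_one, ← E_add, ← E_add]
          refine E_mono fun y => ?_
          rcases y with ⟨g', l, f⟩
          rcases l with _ | ⟨a, l⟩ <;> rcases f with _ | _ <;> simp [ind]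
      _ ≤ _ := by
          rw [E_add, E_add, add_mul]
          gcongr
  have hM' : mass M ≠ ⊤ := ne_top_of_le_ne_top ENNReal.one_ne_top hMle
  refine num.trans ((h₂.rates.one M hMI).trans (le_trans ?_ (mul_le_mul_right den _)))
  have fin : p (k + 1) * (e₁ + eA) * mass M ≠ ⊤ := ENNReal.mul_ne_top hfin hM'
  -- In place of a subtraction the same finite term is added to both sides; this is the role of
  -- `hfin`.
  refine (ENNReal.add_le_add_iff_right fin).1 ?_
  calc e₁ * mass M + p (k + 1) * (e₁ + eA) * mass M
      = (e₁ + p (k + 1) * (e₁ + eA)) * mass M := by ring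
    _ ≤ p (k + 1) * mass M := mul_le_mul_left hp _
    _ ≤ p (k + 1) * (_ + (e₁ + eA) * mass M) := mul_le_mul_right tot _
    _ = _ := by ring

/-- Failure means two faults, a failed ancilla, or one fault together with a tagged input. In the
last case the tag contributes the factor `p (k + 1)`, and the fault is bounded given the tag. -/
theorem corrK_spec (h₁ : RoundSpec F₁ R₁ p e₁ e₂ eA) (h₂ : RoundSpec F₂ R₂ p e₁ e₂ eA)
    (hp : e₁ + p (k + 1) * (e₁ + eA) ≤ p (k + 1)) (hfin : p (k + 1) * (e₁ + eA) ≠ ⊤) :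
    CorrSpec (fun e => (F₁ e).bind F₂) (corrK R₁ R₂) p
      ((e₂ + e₂ + e₁ * e₁) + (eA + eA) + (e₁ + e₁) * p (k + 1)) := by
  have hr := h₁.rates.comp (L := R₂) (J := Inv (TW p k)) (fun m hm r =>
    Inv.isCone (TW.isCone k) _ _ _ fun g => h₁.pres g r) h₂.rates
  refine ⟨corrK_err h₁ h₂, ?_, ?_, corrK_valid h₁ h₂, corrK_state h₁ h₂⟩
  · rintro c (_ | _)
    · exact ⟨fun s => corrK_tw_tag h₁ h₂ hp hfin c s, fun t i g => corrK_tw_sub h₂ c t i g⟩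
    · refine TW.of_untagged fun x hx => ?_
      obtain ⟨g, g', r₁, r₂, -, -, e⟩ := mem_support_corrK ((PMF.mem_support_iff _ _).2 hx)
      unfold corrOut at e
      split_ifs at e
      · have e' : x = untag (k + 1) (errs g') := congrArg Prod.fst e
        rw [e', untag_err]
      · exact absurd (congrArg Prod.snd e) (by simp)
  · refine ((hr.two.sub.add hr.anc.sub).add hr.one.tagged).mono (fun c => ?_) le_rfl
    rcases h : tagC c with _ | t
    · exact le_add_right (corrK_fail_none h)
    · rw [ind_true (by simp), one_mul]
      refine (corrK_fail_some c).trans ?_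
      rw [add_comm]
      gcongr
      exact le_add_self

end Correction

/-! ## The encoded CNOT -/

section CNOT

variable {k : ℕ} {p : ℕ → ℝ≥0∞}

/-- Pairing of two rows of registers. -/
def zipC (g g' : Fin 7 → Cfg k) : Fin 7 → Cfg k × Cfg k := fun i => (g i, g' i)

/-- First row. -/
def rowL (h : Fin 7 → Cfg k × Cfg k) : Fin 7 → Cfg k := fun i => (h i).1

/-- Second row. -/
def rowR (h : Fin 7 → Cfg k × Cfg k) : Fin 7 → Cfg k := fun i => (h i).2

theorem E_zip (m φ : (Fin 7 → Cfg k × Cfg k) → ℝ≥0∞) :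
    E m φ = ∑' g, ∑' g', m (zipC g g') * φ (zipC g g') := by
  rw [E, ← (Equiv.arrowProdEquivProdArrow (Fin 7) (fun _ => Cfg k)
      (fun _ => Cfg k)).symm.tsum_eq, ENNReal.tsum_prod']
  rfl

theorem zipC_update (g g' : Fin 7 → Cfg k) (i : Fin 7) (x y : Cfg k) :
    zipC (Function.update g i x) (Function.update g' i y) =
      Function.update (zipC g g') i (x, y) := by
  funext j
  by_cases hj : j = i
  · subst hj; simp [zipC]
  · simp [zipC, hj]

theorem Inv.zip_left {m : (Fin 7 → Cfg k × Cfg k) → ℝ≥0∞} (h : Inv (PairTW p k) m)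
    (g' : Fin 7 → Cfg k) : Inv (TW p k) (fun g => m (zipC g g')) := by
  intro i g
  have e : ∀ x, zipC (Function.update g i x) g' = Function.update (zipC g g') i (x, g' i) := by
    intro x
    rw [← zipC_update, Function.update_eq_self]
  simp only [e]
  exact (h i _).1 _

theorem Inv.zip_right {m : (Fin 7 → Cfg k × Cfg k) → ℝ≥0∞} (h : Inv (PairTW p k) m)
    (g : Fin 7 → Cfg k) : Inv (TW p k) (fun g' => m (zipC g g')) := by
  intro i g'
  have e : ∀ x, zipC g (Function.update g' i x) = Function.update (zipC g g') i (g i, x) := by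
    intro x
    rw [← zipC_update, Function.update_eq_self]
  simp only [e]
  exact (h i _).2 _

theorem Bd.rowL {ψ : (Fin 7 → Cfg k) → ℝ≥0∞} {e : ℝ≥0∞} (h : Bd (Inv (TW p k)) ψ e) :
    Bd (Inv (PairTW p k)) (fun x => ψ (SteaneFT.rowL x)) e := by
  intro m hm
  have key : ∀ φ : (Fin 7 → Cfg k) → ℝ≥0∞, E m (fun x => φ (SteaneFT.rowL x)) =
      ∑' g', E (fun g => m (zipC g g')) φ := fun φ => (E_zip _ _).trans ENNReal.tsum_comm
  rw [key, ← E_one, key fun _ => 1, ← ENNReal.tsum_mul_left]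
  refine ENNReal.tsum_le_tsum fun g' => ?_
  rw [E_one]
  exact h _ (hm.zip_left g')

theorem Bd.rowR {ψ : (Fin 7 → Cfg k) → ℝ≥0∞} {e : ℝ≥0∞} (h : Bd (Inv (TW p k)) ψ e) :
    Bd (Inv (PairTW p k)) (fun x => ψ (SteaneFT.rowR x)) e := by
  intro m hm
  have key : ∀ φ : (Fin 7 → Cfg k) → ℝ≥0∞, E m (fun x => φ (SteaneFT.rowR x)) =
      ∑' g, E (fun g' => m (zipC g g')) φ := fun φ => E_zip _ _
  rw [key, ← E_one, key fun _ => 1, ← ENNReal.tsum_mul_left]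
  refine ENNReal.tsum_le_tsum fun g => ?_
  rw [E_one]
  exact h _ (hm.zip_right g)

/-- Averages over the subblocks of two blocks, given the tags. -/
theorem Bd.pair_sub {ψ : (Fin 7 → Cfg k × Cfg k) → ℝ≥0∞} {e : ℝ≥0∞}
    (h : Bd (Inv (PairTW p k)) ψ e) {m : Cfg (k + 1) × Cfg (k + 1) → ℝ≥0∞}
    (hm : PairTW p (k + 1) m) (χ : Option (Fin 7) → Option (Fin 7) → ℝ≥0∞) :
    E m (fun x => χ (tagC x.1) (tagC x.2) * ψ (zipC (subC x.1) (subC x.2))) ≤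
      e * E m (fun x => χ (tagC x.1) (tagC x.2)) := by
  have key : ∀ φ : (Fin 7 → Cfg k × Cfg k) → ℝ≥0∞,
      E m (fun x => χ (tagC x.1) (tagC x.2) * φ (zipC (subC x.1) (subC x.2))) =
      ∑' t, ∑' t', χ t t' *
        E (fun z => m (mkC t (SteaneFT.rowL z), mkC t' (SteaneFT.rowR z))) φ := by
    intro φ
    rw [E_prod]
    change ∑' (a : Option (Fin 7) × (Fin 7 → Cfg k)), ∑' (b : Option (Fin 7) × (Fin 7 → Cfg k)),
      _ = _
    rw [ENNReal.tsum_prod']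
    refine tsum_congr fun t => ?_
    have : ∀ g : Fin 7 → Cfg k, ∑' (b : Option (Fin 7) × (Fin 7 → Cfg k)), m (mkC t g, mkC b.1 b.2) *
        (χ t b.1 * φ (zipC g b.2)) = ∑' t', ∑' g', m (mkC t g, mkC t' g') *
        (χ t t' * φ (zipC g g')) := fun g => ENNReal.tsum_prod'
    refine (tsum_congr this).trans ?_
    rw [ENNReal.tsum_comm]
    refine tsum_congr fun t' => ?_
    rw [E_zip, ← ENNReal.tsum_mul_left]
    refine tsum_congr fun g => ?_
    rw [← ENNReal.tsum_mul_left]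
    refine tsum_congr fun g' => ?_
    change _ = χ t t' * (m (mkC t g, mkC t' g') * φ (zipC g g'))
    ring
  have k1 := key (fun _ => 1)
  simp only [mul_one] at k1
  rw [key, k1, ← ENNReal.tsum_mul_left]
  refine ENNReal.tsum_le_tsum fun t => ?_
  rw [← ENNReal.tsum_mul_left]
  refine ENNReal.tsum_le_tsum fun t' => ?_
  rw [E_one]
  have hI : Inv (PairTW p k) (fun z => m (mkC t (SteaneFT.rowL z), mkC t' (SteaneFT.rowR z))) := by
    intro i z
    have e1 : ∀ y : Cfg k × Cfg k, SteaneFT.rowL (Function.update z i y) =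
        Function.update (SteaneFT.rowL z) i y.1 := by
      intro y; funext j
      by_cases hj : j = i
      · subst hj; simp [SteaneFT.rowL]
      · simp [SteaneFT.rowL, hj]
    have e2 : ∀ y : Cfg k × Cfg k, SteaneFT.rowR (Function.update z i y) =
        Function.update (SteaneFT.rowR z) i y.2 := by
      intro y; funext j
      by_cases hj : j = i
      · subst hj; simp [SteaneFT.rowR]
      · simp [SteaneFT.rowR, hj]
    simp only [e1, e2]
    exact ⟨fun y => (hm.1 (mkC t' (Function.update (SteaneFT.rowR z) i y))).2 t i
      (SteaneFT.rowL z), fun x =>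
      (hm.2 (mkC t (Function.update (SteaneFT.rowL z) i x))).2 t' i (SteaneFT.rowR z)⟩
  calc _ ≤ χ t t' * (e * mass _) := mul_le_mul_right (h _ hI) _
    _ = _ := by ring

theorem PairTW.tag_left {m : Cfg (k + 1) × Cfg (k + 1) → ℝ≥0∞} (hm : PairTW p (k + 1) m) :
    E m (fun x => ind (tagC x.1 ≠ none)) ≤ p (k + 1) * mass m := by
  rw [E_prod, mass_prod, ENNReal.tsum_comm, ENNReal.tsum_comm (f := fun a b => m (a, b)),
    ← ENNReal.tsum_mul_left]
  exact ENNReal.tsum_le_tsum fun y => (hm.1 y).tag_le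

theorem PairTW.tag_right {m : Cfg (k + 1) × Cfg (k + 1) → ℝ≥0∞} (hm : PairTW p (k + 1) m) :
    E m (fun x => ind (tagC x.2 ≠ none)) ≤ p (k + 1) * mass m := by
  rw [E_prod, mass_prod, ← ENNReal.tsum_mul_left]
  exact ENNReal.tsum_le_tsum fun x => (hm.2 x).tag_le

/-- The second tag is rare given all of the first block, hence the square. -/
theorem PairTW.tag_both {m : Cfg (k + 1) × Cfg (k + 1) → ℝ≥0∞} (hm : PairTW p (k + 1) m) :
    E m (fun x => ind (tagC x.1 ≠ none) * ind (tagC x.2 ≠ none)) ≤ p (k + 1) ^ 2 * mass m := by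
  have : E m (fun x => ind (tagC x.1 ≠ none) * ind (tagC x.2 ≠ none)) ≤
      p (k + 1) * E m (fun x => ind (tagC x.1 ≠ none)) := by
    rw [E_prod, E_prod, ← ENNReal.tsum_mul_left]
    refine ENNReal.tsum_le_tsum fun x => ?_
    have := (hm.2 x).tag_le
    calc ∑' y, m (x, y) * (ind (tagC x ≠ none) * ind (tagC y ≠ none))
        = ind (tagC x ≠ none) * E (fun y => m (x, y)) (fun y => ind (tagC y ≠ none)) := by
          rw [E, ← ENNReal.tsum_mul_left]
          exact tsum_congr fun y => by ring
      _ ≤ ind (tagC x ≠ none) * (p (k + 1) * mass fun y => m (x, y)) := mul_le_mul_right this _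
      _ = p (k + 1) * ∑' y, m (x, y) * ind (tagC x ≠ none) := by
          rw [ENNReal.tsum_mul_right, mass]; ring
  refine this.trans ((mul_le_mul_right hm.tag_left _).trans_eq ?_)
  ring

/-- The uncontrolled subblocks of the inputs. -/
def tagList (c : Cfg (k + 1) × Cfg (k + 1)) : List (Option (Fin 7)) :=
  (tagC c.1).toList.map some ++ (tagC c.2).toList.map some

open Classical in
/-- The output blocks of an encoded CNOT, where `l` lists the uncontrolled input subblocks and the
failed gates. -/
def cnotOut (l : List (Option (Fin 7))) (y₁ y₂ : Cfg (k + 1) × Bool) :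
    (Cfg (k + 1) × Cfg (k + 1)) × Bool :=
  if 2 ≤ l.length ∨ y₁.2 = true ∨ y₂.2 = true then
    ((untag (k + 1) y₁.1.err, untag (k + 1) y₂.1.err), true)
  else ((y₁.1, y₂.1), false)

/-- Encoded CNOT: transverse gates `G` and error corrections `D₁`, `D₂`. -/
def cnotK (G : Fin 7 → Cfg k × Cfg k → PMF ((Cfg k × Cfg k) × Bool))
    (D₁ D₂ : Cfg (k + 1) → PMF (Cfg (k + 1) × Bool)) (c : Cfg (k + 1) × Cfg (k + 1)) :
    PMF ((Cfg (k + 1) × Cfg (k + 1)) × Bool) :=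
  (trans some G (zipC (subC c.1) (subC c.2))).bind fun x =>
    -- Both blocks receive the same tag: a failed gate, or an uncontrolled subblock in either input,
    -- can damage that place in both.
    (D₁ (mkC (tagList c ++ x.2.1).head?.join (rowL x.1))).bind fun y₁ =>
      (D₂ (mkC (tagList c ++ x.2.1).head?.join (rowR x.1))).map fun y₂ =>
        cnotOut (tagList c ++ x.2.1) y₁ y₂

theorem cnotOut_err (l : List (Option (Fin 7))) (y₁ y₂ : Cfg (k + 1) × Bool) :
    ((cnotOut l y₁ y₂).1.1.err, (cnotOut l y₁ y₂).1.2.err) = (y₁.1.err, y₂.1.err) := by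
  unfold cnotOut
  split_ifs
  · simp only [untag_err]
  · rfl

theorem cnotOut_flag (l : List (Option (Fin 7))) (y₁ y₂ : Cfg (k + 1) × Bool) :
    (cnotOut l y₁ y₂).2 = true ↔ 2 ≤ l.length ∨ y₁.2 = true ∨ y₂.2 = true := by
  unfold cnotOut
  split_ifs with h <;> simp [h]

theorem cnotOut_of_not {l : List (Option (Fin 7))} {y₁ y₂ : Cfg (k + 1) × Bool}
    (h : (cnotOut l y₁ y₂).2 = false) : cnotOut l y₁ y₂ = ((y₁.1, y₂.1), false) ∧
      l.length ≤ 1 ∧ y₁.2 = false ∧ y₂.2 = false := by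
  have h' : ¬(2 ≤ l.length ∨ y₁.2 = true ∨ y₂.2 = true) := by
    rw [← cnotOut_flag, h]; simp
  refine ⟨by simp [cnotOut, h'], ?_⟩
  simp only [not_or, Bool.not_eq_true] at h'
  exact ⟨by omega, h'.2⟩

variable {G : Fin 7 → Cfg k × Cfg k → PMF ((Cfg k × Cfg k) × Bool)}
  {D₁ D₂ : Cfg (k + 1) → PMF (Cfg (k + 1) × Bool)}
  {f : Fin 7 → Err k × Err k → PMF (Err k × Err k)} {F₁ F₂ : Err (k + 1) → PMF (Err (k + 1))}
  {B C : ℝ≥0∞}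

theorem mem_support_cnotK {c : Cfg (k + 1) × Cfg (k + 1)}
    {x : (Cfg (k + 1) × Cfg (k + 1)) × Bool} (h : x ∈ (cnotK G D₁ D₂ c).support) :
    ∃ (z : Fin 7 → Cfg k × Cfg k) (φ : Fin 7 → Bool) (l : List (Option (Fin 7)))
      (y₁ y₂ : Cfg (k + 1) × Bool),
      (∀ i, (z i, φ i) ∈ (G i (subC c.1 i, subC c.2 i)).support) ∧
      l = tagList c ++ (flagList φ).map some ∧ y₁ ∈ (D₁ (mkC l.head?.join (rowL z))).support ∧
      y₂ ∈ (D₂ (mkC l.head?.join (rowR z))).support ∧ x = cnotOut l y₁ y₂ := by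
  simp only [cnotK, PMF.mem_support_bind_iff, PMF.mem_support_map_iff] at h
  obtain ⟨⟨z, r⟩, h1, y₁, h2, y₂, h3, rfl⟩ := h
  obtain ⟨-, φ, h4, h5⟩ := mem_support_trans h1
  refine ⟨z, φ, _, y₁, y₂, h5, rfl, ?_, ?_, ?_⟩
  · rwa [← h4]
  · rwa [← h4]
  · rw [← h4]

theorem E_cnotK (c : Cfg (k + 1) × Cfg (k + 1))
    (φ : (Cfg (k + 1) × Cfg (k + 1)) × Bool → ℝ≥0∞) :
    E (cnotK G D₁ D₂ c) φ = E (trans some G (zipC (subC c.1) (subC c.2))) (fun x =>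
      E (D₁ (mkC (tagList c ++ x.2.1).head?.join (rowL x.1))) (fun y₁ =>
        E (D₂ (mkC (tagList c ++ x.2.1).head?.join (rowR x.1))) (fun y₂ =>
          φ (cnotOut (tagList c ++ x.2.1) y₁ y₂)))) := by
  rw [cnotK, E_bind]
  congr 1; funext x; rw [E_bind]
  congr 1; funext y; rw [E_map]

theorem cnotK_err (hG : ∀ i, CnotSpec (f i) (G i) p C) (h₁ : CorrSpec F₁ D₁ p B)
    (h₂ : CorrSpec F₂ D₂ p B) (c : Cfg (k + 1) × Cfg (k + 1)) :
    (cnotK G D₁ D₂ c).map (fun x => (x.1.1.err, x.1.2.err)) =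
      (indep 7 fun i => f i (errs (subC c.1) i, errs (subC c.2) i)).bind fun r =>
        (F₁ (fun i => (r i).1)).bind fun e₁ => (F₂ (fun i => (r i).2)).map fun e₂ => (e₁, e₂) := by
  let H : (Fin 7 → Err k × Err k) → PMF (Err (k + 1) × Err (k + 1)) := fun r =>
    (F₁ (fun i => (r i).1)).bind fun e₁ => (F₂ (fun i => (r i).2)).map fun e₂ => (e₁, e₂)
  rw [cnotK, PMF.map_bind]
  have : ∀ x : (Fin 7 → Cfg k × Cfg k) × Rec,
      PMF.map (fun x => (x.1.1.err, x.1.2.err))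
      ((D₁ (mkC (tagList c ++ x.2.1).head?.join (rowL x.1))).bind fun y₁ =>
        (D₂ (mkC (tagList c ++ x.2.1).head?.join (rowR x.1))).map fun y₂ =>
          cnotOut (tagList c ++ x.2.1) y₁ y₂) = H fun i => ((x.1 i).1.err, (x.1 i).2.err) := by
    intro x
    have e1 := h₁.err (mkC (tagList c ++ x.2.1).head?.join (rowL x.1))
    have e2 := h₂.err (mkC (tagList c ++ x.2.1).head?.join (rowR x.1))
    change _ = (F₁ (mkC (tagList c ++ x.2.1).head?.join (rowL x.1)).err).bind fun e₁ =>
      (F₂ (mkC (tagList c ++ x.2.1).head?.join (rowR x.1)).err).map fun e₂ => (e₁, e₂)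
    rw [← e1, ← e2, PMF.map_bind, PMF.bind_map]
    congr 1; funext y
    rw [PMF.map_comp]
    simp only [Function.comp, PMF.map_comp]
    congr 1; funext y'
    exact cnotOut_err _ _ _
  simp only [this]
  rw [bind_of_map _ (fun x : (Fin 7 → Cfg k × Cfg k) × Rec =>
    fun i => ((x.1 i).1.err, (x.1 i).2.err)) H,
    trans_map_errs₂ some G (fun i => f i (errs (subC c.1) i, errs (subC c.2) i)) _
      fun i => (hG i).err _]

/-- Given the outcome of the gates the two corrections are independent, and each emits a `TW` mass
from every input. -/
theorem cnotK_tw (h₁ : CorrSpec F₁ D₁ p B) (h₂ : CorrSpec F₂ D₂ p B)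
    (c : Cfg (k + 1) × Cfg (k + 1)) (b : Bool) :
    PairTW p (k + 1) (fun x => cnotK G D₁ D₂ c (x, b)) := by
  rcases b with _ | _
  · have e : ∀ x, cnotK G D₁ D₂ c (x, false) = ∑' z, (trans some G (zipC (subC c.1) (subC c.2)) z *
        ind (¬2 ≤ (tagList c ++ z.2.1).length)) *
        (D₁ (mkC (tagList c ++ z.2.1).head?.join (rowL z.1)) (x.1, false) *
          D₂ (mkC (tagList c ++ z.2.1).head?.join (rowR z.1)) (x.2, false)) := by
      intro x
      rw [apply_eq_E (cnotK G D₁ D₂ c), E_cnotK]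
      refine tsum_congr fun z => ?_
      rw [mul_assoc]
      congr 1
      by_cases hl : 2 ≤ (tagList c ++ z.2.1).length
      · rw [ind_false (not_not.2 hl), zero_mul]
        simp only [cnotOut, hl, true_or, if_true]
        simp [ind, E_zero]
      · rw [ind_true hl, one_mul, apply_eq_E (D₁ _) (x.1, false), apply_eq_E (D₂ _) (x.2, false),
          ← E_mul_right]
        beta_reduce
        congr 1; funext y₁
        rw [← E_mul_left]
        congr 1; funext y₂
        rw [← ind_and]
        refine ind_congr ?_
        rcases y₁ with ⟨y₁, b₁⟩
        rcases y₂ with ⟨y₂, b₂⟩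
        unfold cnotOut
        split_ifs with h
        · simp only [hl, false_or] at h
          simp only [Prod.mk.injEq, reduceCtorEq, and_false, false_iff]
          rintro ⟨⟨-, rfl⟩, -, rfl⟩
          simp at h
        · simp only [hl, false_or, not_or, Bool.not_eq_true] at h
          obtain ⟨rfl, rfl⟩ := h
          simp [Prod.ext_iff]
    simp only [e]
    refine PairOf.isCone (TW.isCone _) _ _ _ fun z => ⟨fun y => ?_, fun x => ?_⟩
    · simp only [mul_comm _ (D₂ _ (y, false))]
      exact (h₁.tw _ _).smul _
    · exact (h₂.tw (mkC (tagList c ++ z.2.1).head?.join (rowR z.1)) false).smul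
        (D₁ (mkC (tagList c ++ z.2.1).head?.join (rowL z.1)) (x, false))
  · have : ∀ x y, cnotK G D₁ D₂ c ((x, y), true) ≠ 0 →
        x = untag (k + 1) x.err ∧ y = untag (k + 1) y.err := by
      intro x y h
      obtain ⟨z, φ, l, y₁, y₂, -, -, -, -, e⟩ := mem_support_cnotK ((PMF.mem_support_iff _ _).2 h)
      unfold cnotOut at e
      split_ifs at e
      · have e1 : x = untag (k + 1) y₁.1.err := congrArg (fun a => a.1.1) e
        have e2 : y = untag (k + 1) y₂.1.err := congrArg (fun a => a.1.2) e
        rw [e1, e2, untag_err, untag_err]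
        exact ⟨rfl, rfl⟩
      · exact absurd (congrArg Prod.snd e) (by simp)
    exact ⟨fun y => TW.of_untagged fun x hx => (this x y hx).1,
      fun x => TW.of_untagged fun y hy => (this x y hy).2⟩

theorem cnotK_valid (h₁ : CorrSpec F₁ D₁ p B) (h₂ : CorrSpec F₂ D₂ p B)
    (c : Cfg (k + 1) × Cfg (k + 1)) (x : (Cfg (k + 1) × Cfg (k + 1)) × Bool)
    (hx : x ∈ (cnotK G D₁ D₂ c).support) (hf : x.2 = false) :
    Valid (k + 1) x.1.1 ∧ Valid (k + 1) x.1.2 := by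
  obtain ⟨z, φ, l, y₁, y₂, -, -, hy₁, hy₂, rfl⟩ := mem_support_cnotK hx
  obtain ⟨e, -, f₁, f₂⟩ := cnotOut_of_not hf
  rw [e]
  exact ⟨h₁.valid _ _ hy₁ f₁, h₂.valid _ _ hy₂ f₂⟩

/-- If the list is empty, `h` holds for every `t`, in particular for some `t` other than the
subblock in question. -/
theorem valid_mkC_head {l : List (Option (Fin 7))} (hl : l.length ≤ 1)
    (hl' : ∀ y ∈ l, ∃ j, y = some j) {g : Fin 7 → Cfg k} {L : Pauli}
    (h : ∀ t, (∀ y ∈ l, y = some t) → (∀ j, j ≠ t → Valid k (g j)) ∧ NearS t (states g) L) :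
    Valid (k + 1) (mkC l.head?.join g) := by
  intro i hi
  rw [subRel_eq]
  simp only [tagC_mkC, subC_mkC] at hi ⊢
  rcases l with _ | ⟨y, l⟩
  · obtain ⟨t, ht⟩ := exists_ne i
    obtain ⟨h1, h2⟩ := h t (by simp)
    exact ⟨h2.relState_eq ht.symm, h1 i ht.symm⟩
  · simp only [List.length_cons] at hl
    obtain rfl : l = [] := List.length_eq_zero_iff.1 (by omega)
    obtain ⟨t, rfl⟩ := hl' y (by simp)
    have ht : i ≠ t := by rintro rfl; exact hi rfl
    obtain ⟨h1, h2⟩ := h t (by simp)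
    exact ⟨h2.relState_eq ht, h1 i ht⟩

/-- Tags and failed gates lie at one place `t`. Outside it the gates act perfectly, so codewords add
and both rows are near the propagated logical states; the corrections then preserve these. -/
theorem cnotK_state (hG : ∀ i, CnotSpec (f i) (G i) p C) (h₁ : CorrSpec F₁ D₁ p B)
    (h₂ : CorrSpec F₂ D₂ p B) (c : Cfg (k + 1) × Cfg (k + 1)) (hc₁ : Valid (k + 1) c.1)
    (hc₂ : Valid (k + 1) c.2) (x : (Cfg (k + 1) × Cfg (k + 1)) × Bool)
    (hx : x ∈ (cnotK G D₁ D₂ c).support) (hf : x.2 = false) :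
    (state (k + 1) x.1.1.err, state (k + 1) x.1.2.err) =
      propagate (state (k + 1) c.1.err, state (k + 1) c.2.err) := by
  obtain ⟨z, φ, l, y₁, y₂, hz, hl, hy₁, hy₂, rfl⟩ := mem_support_cnotK hx
  obtain ⟨e, hlen, f₁, f₂⟩ := cnotOut_of_not hf
  rw [e]
  set L := propagate (state (k + 1) c.1.err, state (k + 1) c.2.err) with hL
  have hl' : ∀ y ∈ l, ∃ j, y = some j := by
    intro y hy
    rw [hl, tagList] at hy
    simp only [List.mem_append, List.mem_map] at hy
    obtain ((⟨j, -, rfl⟩ | ⟨j, -, rfl⟩) | ⟨j, -, rfl⟩) := hy <;> exact ⟨j, rfl⟩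
  have main : ∀ t, (∀ y ∈ l, y = some t) →
      ((∀ j, j ≠ t → Valid k (rowL z j)) ∧ NearS t (states (rowL z)) L.1) ∧
      ((∀ j, j ≠ t → Valid k (rowR z j)) ∧ NearS t (states (rowR z)) L.2) := by
    intro t ht
    rw [hl, tagList] at ht
    have hφ : ∀ j, j ≠ t → φ j = false := by
      intro j hj
      by_contra hne
      exact hj (Option.some.inj (ht (some j) (List.mem_append_right _
        (List.mem_map_of_mem (mem_flagList.2 (by simpa using hne))))))
    have ht₁ : ∀ j, j ≠ t → tagC c.1 ≠ some j := by
      intro j hj hne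
      exact hj (Option.some.inj (ht (some j) (by simp [hne])))
    have ht₂ : ∀ j, j ≠ t → tagC c.2 ≠ some j := by
      intro j hj hne
      exact hj (Option.some.inj (ht (some j) (by simp [hne])))
    have n₁ : NearS t (states (subC c.1)) (state (k + 1) c.1.err) :=
      nearS_logical fun j hj => (hc₁ j (ht₁ j hj)).1
    have n₂ : NearS t (states (subC c.2)) (state (k + 1) c.2.err) :=
      nearS_logical fun j hj => (hc₂ j (ht₂ j hj)).1
    have hs := fun j (hj : j ≠ t) => (hG j).state _ (hc₁ j (ht₁ j hj)).2 (hc₂ j (ht₂ j hj)).2 _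
      (hz j) (hφ j hj)
    have hv := fun j (hj : j ≠ t) => (hG j).valid _ _ (hz j) (hφ j hj)
    exact ⟨⟨fun j hj => (hv j hj).1,
      n₁.1.congr fun j hj => congrArg (fun a => a.1.1) (hs j hj),
      n₁.2.add n₂.2 fun j hj => congrArg (fun a => a.1.2) (hs j hj)⟩,
      ⟨fun j hj => (hv j hj).2,
      n₁.1.add n₂.1 fun j hj => congrArg (fun a => a.2.1) (hs j hj),
      n₂.2.congr fun j hj => congrArg (fun a => a.2.2) (hs j hj)⟩⟩
  have ht : ∃ t, ∀ y ∈ l, y = some t := by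
    rcases l with _ | ⟨y, l⟩
    · exact ⟨0, by simp⟩
    · simp only [List.length_cons] at hlen
      obtain rfl : l = [] := List.length_eq_zero_iff.1 (by omega)
      obtain ⟨t, rfl⟩ := hl' y (by simp)
      exact ⟨t, by simp⟩
  obtain ⟨t, ht⟩ := ht
  have s₁ := h₁.state _ (valid_mkC_head hlen hl' fun t ht => (main t ht).1) _ hy₁ f₁
  have s₂ := h₂.state _ (valid_mkC_head hlen hl' fun t ht => (main t ht).2) _ hy₂ f₂
  change (state (k + 1) y₁.1.err, state (k + 1) y₂.1.err) = L
  rw [s₁, s₂]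
  exact Prod.ext (main t ht).1.2.logical_eq (main t ht).2.2.logical_eq

/-- Bounds for the failure probability of an error correction with controlled, respectively with
tagged, input. -/
structure CorrFail (D : Cfg (k + 1) → PMF (Cfg (k + 1) × Bool)) (p : ℕ → ℝ≥0∞)
    (q₀ q₁ : (Fin 7 → Cfg k) → ℝ≥0∞) (B₀ B₁ : ℝ≥0∞) : Prop where
  none : ∀ g, E (D (mkC none g)) (fun x => ind (x.2 = true)) ≤ q₀ g
  some : ∀ t g, E (D (mkC t g)) (fun x => ind (x.2 = true)) ≤ q₁ g
  bd_none : Bd (Inv (TW p k)) q₀ B₀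
  bd_some : Bd (Inv (TW p k)) q₁ B₁

/-- The bound separates two tags or failed gates, a correction that fails on a tagged input (`B₁`),
and one that fails on an untagged input (`B₀`). The gates emit `TW` pairs given their record, so the
correction bounds multiply those for tags and failed gates. -/
theorem cnotK_fail {q₀ q₁ q₀' q₁' : (Fin 7 → Cfg k) → ℝ≥0∞} {B₀ B₁ : ℝ≥0∞}
    (hG : ∀ i, CnotSpec (f i) (G i) p C)
    (h₁ : CorrFail D₁ p q₀ q₁ B₀ B₁) (h₂ : CorrFail D₂ p q₀' q₁' B₀ B₁) :
    Bd (PairTW p (k + 1)) (fun c => E (cnotK G D₁ D₂ c) (fun x => ind (x.2 = true)))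
      ((p (k + 1) ^ 2 + 7 * C * (p (k + 1) + p (k + 1)) + 21 * C ^ 2) +
        ((p (k + 1) + p (k + 1)) * (B₁ + B₁) + 7 * C * (B₁ + B₁)) + (B₀ + B₀)) := by
  intro m hm
  let T := fun h : Fin 7 → Cfg k × Cfg k => trans some G h
  have pT : Pres (Inv (PairTW p k)) T (Inv (PairTW p k)) :=
    trans_pres (PairOf.isCone (TW.isCone k)) some fun i x f => (hG i).tw x f
  have rT := trans_rates some fun i => (hG i).fail
  let τ : Cfg (k + 1) × Cfg (k + 1) → ℝ≥0∞ := fun c => ind (tagC c.1 ≠ none) + ind (tagC c.2 ≠ none)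
  let Z : Cfg (k + 1) × Cfg (k + 1) → Fin 7 → Cfg k × Cfg k := fun c => zipC (subC c.1) (subC c.2)
  have hq₀ : Bd (Inv (PairTW p k)) (fun h => q₀ (rowL h) + q₀' (rowR h)) (B₀ + B₀) :=
    h₁.bd_none.rowL.add h₂.bd_none.rowR
  have hq₁ : Bd (Inv (PairTW p k)) (fun h => q₁ (rowL h) + q₁' (rowR h)) (B₁ + B₁) :=
    h₁.bd_some.rowL.add h₂.bd_some.rowR
  let Q₀ := fun h => E (T h) (fun x => q₀ (rowL x.1) + q₀' (rowR x.1))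
  let Q₁ := fun h => E (T h) (fun x => q₁ (rowL x.1) + q₁' (rowR x.1))
  let Q₂ := fun h => E (T h) (fun x => ind (1 ≤ x.2.1.length) * (q₁ (rowL x.1) + q₁' (rowR x.1)))
  let N₁ := fun h => E (T h) (fun x => ind (1 ≤ x.2.1.length))
  let N₂ := fun h => E (T h) (fun x => ind (2 ≤ x.2.1.length))
  have point : ∀ c, E (cnotK G D₁ D₂ c) (fun x => ind (x.2 = true)) ≤
      (ind (tagC c.1 ≠ none) * ind (tagC c.2 ≠ none) + τ c * N₁ (Z c) + N₂ (Z c)) +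
        (τ c * Q₁ (Z c) + Q₂ (Z c)) + Q₀ (Z c) := by
    intro c
    rw [E_cnotK]
    have e1 : ind (tagC c.1 ≠ none) * ind (tagC c.2 ≠ none) = E (T (Z c)) (fun _ =>
        ind (tagC c.1 ≠ none) * ind (tagC c.2 ≠ none)) := by rw [E_const, mass_pmf, mul_one]
    rw [e1]
    simp only [N₁, N₂, Q₁, Q₂, Q₀, ← E_mul_left, ← E_add]
    refine E_mono fun x => ?_
    have hflag : ∀ y₁ y₂ : Cfg (k + 1) × Bool, ind ((cnotOut (tagList c ++ x.2.1) y₁ y₂).2 = true) ≤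
        ind (2 ≤ (tagList c ++ x.2.1).length) + (ind (y₁.2 = true) + ind (y₂.2 = true)) := by
      intro y₁ y₂
      rw [ind_congr (cnotOut_flag _ _ _)]
      refine (ind_or_le _ _).trans ?_
      gcongr
      exact ind_or_le _ _
    have len : (tagList c ++ x.2.1).length =
        (tagC c.1).toList.length + (tagC c.2).toList.length + x.2.1.length := by
      simp [tagList, add_assoc]
    have i1 : ind (2 ≤ (tagList c ++ x.2.1).length) ≤
        ind (tagC c.1 ≠ none) * ind (tagC c.2 ≠ none) + τ c * ind (1 ≤ x.2.1.length) +
          ind (2 ≤ x.2.1.length) := by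
      rw [len]
      simp only [τ]
      rcases tagC c.1 with _ | t₁ <;> rcases tagC c.2 with _ | t₂ <;>
        simp only [Option.toList_none, Option.toList_some, List.length_nil, List.length_singleton,
          ne_eq, not_true, reduceCtorEq, not_false_eq_true, ind_true, ind_false, zero_add,
          add_zero, mul_zero, zero_mul, one_mul, mul_one]
      · exact le_rfl
      · exact le_add_right (ind_mono (by omega))
      · exact le_add_right (ind_mono (by omega))
      · exact (ind_le_one _).trans (le_add_right (le_add_right le_rfl))
    have i2 : E (D₁ (mkC (tagList c ++ x.2.1).head?.join (rowL x.1))) (fun y => ind (y.2 = true)) +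
        E (D₂ (mkC (tagList c ++ x.2.1).head?.join (rowR x.1))) (fun y => ind (y.2 = true)) ≤
        (τ c * (q₁ (rowL x.1) + q₁' (rowR x.1)) +
          ind (1 ≤ x.2.1.length) * (q₁ (rowL x.1) + q₁' (rowR x.1))) +
          (q₀ (rowL x.1) + q₀' (rowR x.1)) := by
      by_cases h0 : (tagList c ++ x.2.1).length = 0
      · rw [List.length_eq_zero_iff.1 h0]
        exact le_add_left (add_le_add (h₁.none _) (h₂.none _))
      -- A nonempty list contains a tag or a failed gate, so the weight in front of `q₁` and `q₁'`
      -- is at least one.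
      · refine le_add_right ((add_le_add (h₁.some _ _) (h₂.some _ _)).trans ?_)
        rw [← add_mul]
        refine le_mul_of_one_le_left zero_le ?_
        rw [len] at h0
        simp only [τ]
        revert h0
        rcases tagC c.1 with _ | t₁ <;> rcases tagC c.2 with _ | t₂ <;> intro h0 <;>
          simp only [Option.toList_none, Option.toList_some, List.length_nil,
            List.length_singleton, ne_eq, not_true, reduceCtorEq, not_false_eq_true, ind_true,
            ind_false, zero_add, add_zero] at h0 ⊢
        · rw [ind_true (by omega)]
        · exact le_add_right le_rfl
        · exact le_add_right le_rfl
        · exact le_add_right (le_add_right le_rfl)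
    calc _ ≤ ind (2 ≤ (tagList c ++ x.2.1).length) +
          (E (D₁ (mkC (tagList c ++ x.2.1).head?.join (rowL x.1))) (fun y => ind (y.2 = true)) +
          E (D₂ (mkC (tagList c ++ x.2.1).head?.join (rowR x.1)))
            (fun y => ind (y.2 = true))) := by
          refine (E_mono fun y₁ => E_mono fun y₂ => hflag y₁ y₂).trans ?_
          simp only [E_add, E_const, mass_pmf, mul_one]
          exact le_rfl
      _ ≤ _ := add_le_add i1 i2
      _ = _ := by ring
  refine (E_mono point).trans ?_
  simp only [E_add]
  have hτ : E m τ ≤ (p (k + 1) + p (k + 1)) * mass m := by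
    rw [E_add, add_mul]; exact add_le_add hm.tag_left hm.tag_right
  have wτ : ∀ {ψ : (Fin 7 → Cfg k × Cfg k) → ℝ≥0∞} {e : ℝ≥0∞}, Bd (Inv (PairTW p k)) ψ e →
      E m (fun c => τ c * ψ (Z c)) ≤ e * ((p (k + 1) + p (k + 1)) * mass m) := fun h =>
    (h.pair_sub hm fun t t' => ind (t ≠ none) + ind (t' ≠ none)).trans (mul_le_mul_right hτ _)
  have w1 : ∀ {ψ : (Fin 7 → Cfg k × Cfg k) → ℝ≥0∞} {e : ℝ≥0∞}, Bd (Inv (PairTW p k)) ψ e →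
      E m (fun c => ψ (Z c)) ≤ e * mass m := fun h => by
    have := h.pair_sub hm fun _ _ => 1
    simpa only [one_mul, E_one] using this
  have bQ₁ : Bd (Inv (PairTW p k)) Q₁ (B₁ + B₁) := fun m' hm' => by
    have := pT.bd_mul hq₁ (fun _ => 1) hm'
    simpa only [one_mul, E_one, mass_pmf] using this
  have bQ₀ : Bd (Inv (PairTW p k)) Q₀ (B₀ + B₀) := fun m' hm' => by
    have := pT.bd_mul hq₀ (fun _ => 1) hm'
    simpa only [one_mul, E_one, mass_pmf] using this
  have bQ₂ : Bd (Inv (PairTW p k)) Q₂ (7 * C * (B₁ + B₁)) := fun m' hm' => by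
    refine (pT.bd_mul hq₁ (fun r => ind (1 ≤ r.1.length)) hm').trans ?_
    calc _ ≤ (B₁ + B₁) * (7 * C * mass m') := mul_le_mul_right (rT.one m' hm') _
      _ = _ := by ring
  calc _ ≤ (p (k + 1) ^ 2 * mass m + 7 * C * ((p (k + 1) + p (k + 1)) * mass m) +
        21 * C ^ 2 * mass m) + ((B₁ + B₁) * ((p (k + 1) + p (k + 1)) * mass m) +
        7 * C * (B₁ + B₁) * mass m) + (B₀ + B₀) * mass m :=
      add_le_add (add_le_add (add_le_add (add_le_add hm.tag_both (wτ rT.one)) (w1 rT.two))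
        (add_le_add (wτ bQ₁) (w1 bQ₂))) (w1 bQ₀)
    _ = _ := by ring

end CNOT

/-! ## Postselection -/

section Postselect

variable {α β : Type}

theorem E_ind_ne_zero {μ : PMF α} {S : Set α} :
    E μ (fun a => ind (a ∈ S)) ≠ 0 ↔ ∃ a ∈ S, a ∈ μ.support := by
  rw [E, ne_eq, ENNReal.tsum_eq_zero, not_forall]
  refine exists_congr fun a => ?_
  by_cases ha : a ∈ S <;> simp [ind, ha, PMF.mem_support_iff]

theorem postselect_apply {μ : PMF α} {S : Set α} (h : E μ (fun a => ind (a ∈ S)) ≠ 0) (a : α) :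
    postselect μ S a = (E μ fun a => ind (a ∈ S))⁻¹ * (μ a * ind (a ∈ S)) := by
  classical
  have e : ∀ a, S.indicator μ a = μ a * ind (a ∈ S) := by
    intro a
    by_cases ha : a ∈ S <;> simp [ind, ha]
  rw [postselect, dif_pos (E_ind_ne_zero.1 h), PMF.filter_apply]
  simp only [e]
  rw [mul_comm]; rfl

theorem E_postselect {μ : PMF α} {S : Set α} (h : E μ (fun a => ind (a ∈ S)) ≠ 0)
    (φ : α → ℝ≥0∞) : E (postselect μ S) φ =
      (E μ fun a => ind (a ∈ S))⁻¹ * E μ (fun a => ind (a ∈ S) * φ a) := by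
  rw [← E_mul_left]
  refine tsum_congr fun a => ?_
  rw [postselect_apply h]; ring

theorem mem_support_postselect {μ : PMF α} {S : Set α} (h : E μ (fun a => ind (a ∈ S)) ≠ 0)
    {a : α} (ha : a ∈ (postselect μ S).support) : a ∈ μ.support ∧ a ∈ S := by
  rw [PMF.mem_support_iff, postselect_apply h] at ha
  refine ⟨fun h0 => ha (by simp [h0]), ?_⟩
  by_contra hS
  exact ha (by simp [ind, hS])

/-- Acceptance is already decided before `f` is run. If it is impossible, both sides fall back to
the unconditioned law. -/
theorem postselect_bind {μ : PMF α} {S : Set α} {f : α → PMF β} {T : Set β}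
    (h : ∀ a ∈ μ.support, ∀ b ∈ (f a).support, b ∈ T ↔ a ∈ S) :
    postselect (μ.bind f) T = (postselect μ S).bind f := by
  have e : ∀ a b, μ a * (f a b * ind (b ∈ T)) = μ a * ind (a ∈ S) * f a b := by
    intro a b
    by_cases ha : μ a = 0
    · simp [ha]
    · by_cases hb : f a b = 0
      · simp [hb]
      · rw [ind_congr (h a ((PMF.mem_support_iff _ _).2 ha) b ((PMF.mem_support_iff _ _).2 hb))]
        ring
  have q : E (μ.bind f) (fun b => ind (b ∈ T)) = E μ (fun a => ind (a ∈ S)) := by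
    rw [E_bind]
    refine tsum_congr fun a => ?_
    simp only [E, ← ENNReal.tsum_mul_left, e]
    rw [ENNReal.tsum_mul_left, (f a).tsum_coe, mul_one]
  by_cases h0 : E μ (fun a => ind (a ∈ S)) = 0
  · have h1 := h0
    rw [← q] at h1
    have h2 := (not_congr E_ind_ne_zero).1 (not_not.2 h0)
    have h3 := (not_congr E_ind_ne_zero).1 (not_not.2 h1)
    rw [postselect, postselect, dif_neg h2, dif_neg h3]
  · refine PMF.ext fun b => ?_
    rw [postselect_apply (by rwa [q]), q, bind_apply_E, bind_apply_E, E_postselect h0,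
      ← E_mul_right]
    congr 1
    refine tsum_congr fun a => ?_
    beta_reduce
    rw [e a b, mul_assoc]

end Postselect

/-! ## Preparation of ancillas -/

section Ancilla

variable {k : ℕ} {p : ℕ → ℝ≥0∞} {A B C : ℝ≥0∞}

/-- Transverse Hadamard gates on a flagged configuration. -/
def plusK (Z : PMF (Cfg k × Bool)) : PMF (Cfg k × Bool) := Z.map fun x => (hadamardC k x.1, x.2)

theorem AncSpec.plus {z : PMF (Err k)} {Z : PMF (Cfg k × Bool)} (h : AncSpec z Z p A) :
    AncSpec (z.map (hadamard k)) (plusK Z) p A where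
  err := by
    rw [← h.err, plusK, PMF.map_comp, PMF.map_comp]
    congr 1; funext x
    exact hadamardC_err k x.1
  tw f := by
    have : ∀ x, plusK Z (x, f) = Z (hadamardC k x, f) := by
      intro x
      rw [plusK, map_apply_E, apply_eq_E Z]
      congr 1; funext y
      refine ind_congr ?_
      rw [Prod.ext_iff, Prod.ext_iff]
      refine and_congr ⟨fun e => ?_, fun e => ?_⟩ Iff.rfl
      · change hadamardC k y.1 = x at e
        change y.1 = hadamardC k x
        rw [← e, hadamardC_hadamardC]
      · change y.1 = hadamardC k x at e
        change hadamardC k y.1 = x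
        rw [e, hadamardC_hadamardC]
    simp only [this]
    exact (h.tw f).hadamardC
  fail := by rw [plusK, E_map]; exact h.fail
  valid x hx hf := by
    obtain ⟨y, hy, rfl⟩ := (PMF.mem_support_map_iff _ _ _).1 hx
    exact valid_hadamardC k (h.valid y hy hf)
  state x hx hf := by
    obtain ⟨y, hy, rfl⟩ := (PMF.mem_support_map_iff _ _ _).1 hx
    have := h.state y hy hf
    change SteaneFT.state k (hadamardC k y.1).err = 0
    rw [state_hadamardC, this]; rfl

/-- An unverified ancilla: preparations `P`, gates `N` of the encoder, corrections `Q`. -/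
def unverK (P : Fin 7 → PMF (Cfg k × Bool)) (N : ℕ → Cfg k × Cfg k → PMF ((Cfg k × Cfg k) × Bool))
    (Q : Fin 7 → Cfg k → PMF (Cfg k × Bool)) (u : Fin 7 → Unit) : PMF ((Fin 7 → Cfg k) × Rec) :=
  wbind (wbind (trans (fun _ => none) (fun i _ => P i) u) (netK N encoder)) (trans some Q)

/-- Another row of registers is put next to a row. -/
def joinK (μ : PMF ((Fin 7 → Cfg k) × Rec)) (g : Fin 7 → Cfg k) :
    PMF ((Fin 7 → Cfg k × Cfg k) × Rec) := μ.map fun x => (zipC g x.1, x.2)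

theorem encoder_ne : ∀ e ∈ encoder, e.1 ≠ e.2 := by decide

variable {P P' : Fin 7 → PMF (Cfg k × Bool)} {N N' : ℕ → Cfg k × Cfg k → PMF ((Cfg k × Cfg k) × Bool)}
  {Q Q' : Fin 7 → Cfg k → PMF (Cfg k × Bool)} {z z' : Fin 7 → PMF (Err k)}
  {n n' : ℕ → Err k × Err k → PMF (Err k × Err k)} {q q' : Fin 7 → Err k → PMF (Err k)}
  {G : Fin 7 → Cfg k × Cfg k → PMF ((Cfg k × Cfg k) × Bool)}
  {γ : Fin 7 → Err k × Err k → PMF (Err k × Err k)}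

theorem unverK_pres (hQ : ∀ i, CorrSpec (q i) (Q i) p B) {I : ((Fin 7 → Unit) → ℝ≥0∞) → Prop} :
    Pres I (unverK P N Q) (Inv (TW p k)) :=
  Pres.comp (J := fun _ => True) (Inv.isCone (TW.isCone k)) (fun _ _ _ => trivial)
    (trans_pres (TW.isCone k) some fun i x f => (hQ i).tw x f)

/-- Seven preparations, nine gates with 36 pairs, seven corrections. The input registers are dummies
of type `Unit`, on which any mass is allowed. -/
theorem unverK_rates (hP : ∀ i, AncSpec (z i) (P i) p A) (hN : ∀ l, CnotSpec (n l) (N l) p C)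
    (hQ : ∀ i, CorrSpec (q i) (Q i) p B) :
    Rates3 (Inv fun _ => True) (unverK P N Q) (7 * A + 9 * C + 7 * B)
      (21 * A ^ 2 + 36 * C ^ 2 + 7 * A * (9 * C) + 21 * B ^ 2 + (7 * A + 9 * C) * (7 * B)) 0 := by
  have c := TW.isCone (p := p) k
  have h₁ := fun l x v f => (hN l).tw x f |>.1 v
  have h₂ := fun l x v f => (hN l).tw x f |>.2 v
  have pP : Pres (Inv fun _ => True) (trans (fun _ => none) fun i (_ : Unit) => P i)
      (Inv (TW p k)) := trans_pres c _ fun i _ f => (hP i).tw f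
  have rP : Rates3 (Inv fun _ => True) (trans (fun _ => none) fun i (_ : Unit) => P i) (7 * A)
      (21 * A ^ 2) 0 := trans_rates _ fun i m _ => by
    rw [E_const]
    exact mul_le_mul_left (hP i).fail _
  have rN := netK_rates c h₁ h₂ (fun l => (hN l).fail) encoder encoder_ne
  have e9 : (encoder.length : ℝ≥0∞) = 9 := by simp [encoder]
  have e36 : (encoder.length.choose 2 : ℝ≥0∞) = 36 := by
    have : encoder.length.choose 2 = 36 := by decide
    rw [this]; norm_num
  rw [e9, e36] at rN
  have := (rP.comp pP rN).comp (pP.comp (Inv.isCone c) (netK_pres c h₁ h₂ encoder encoder_ne))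
    (trans_rates some fun i => (hQ i).fail)
  simp only [add_zero] at this
  exact this

theorem joinK_pres {μ : PMF ((Fin 7 → Cfg k) × Rec)} (hμ : ∀ r, Inv (TW p k) fun g => μ (g, r)) :
    Pres (Inv (TW p k)) (joinK μ) (Inv (PairTW p k)) := by
  intro m hm r
  have e : ∀ h, ∑' a, m a * joinK μ a (h, r) = m (rowL h) * μ (rowR h, r) := by
    intro h
    have e1 : ∀ a, joinK μ a (h, r) = ind (a = rowL h) * μ (rowR h, r) := by
      intro a
      rw [joinK, map_apply_E, apply_eq_E μ, ← E_mul_left]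
      congr 1; funext x
      rw [← ind_and]
      refine ind_congr ?_
      constructor
      · intro e
        obtain ⟨rfl, rfl⟩ := Prod.mk.inj e
        exact ⟨rfl, rfl⟩
      · rintro ⟨rfl, rfl⟩
        rfl
    simp only [e1]
    rw [tsum_eq_single (rowL h)]
    · rw [ind_true rfl, one_mul]
    · intro a ha; simp [ind, ha]
  simp only [e]
  intro i h
  have u1 : ∀ y : Cfg k × Cfg k, rowL (Function.update h i y) =
      Function.update (rowL h) i y.1 := by
    intro y; funext j
    by_cases hj : j = i
    · subst hj; simp [rowL]
    · simp [rowL, hj]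
  have u2 : ∀ y : Cfg k × Cfg k, rowR (Function.update h i y) =
      Function.update (rowR h) i y.2 := by
    intro y; funext j
    by_cases hj : j = i
    · subst hj; simp [rowR]
    · simp [rowR, hj]
  simp only [u1, u2]
  refine ⟨fun y => ?_, fun y => ?_⟩
  · simp only [mul_comm (m _)]
    exact (hm i _).smul _
  · exact (hμ r i (rowR h)).smul (m (Function.update (rowL h) i y))

/-- A bound on averages, evaluated at the point mass of `a`, is a pointwise bound; the added row
does not depend on the row already present. -/
theorem joinK_rates {I : ((Fin 7 → Cfg k) → ℝ≥0∞) → Prop} {α : Type} {K : α → PMF ((Fin 7 → Cfg k) × Rec)}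
    {J : (α → ℝ≥0∞) → Prop} {e₁ e₂ eA : ℝ≥0∞} (h : Rates3 J K e₁ e₂ eA) {a : α}
    (ha : J fun x => ind (x = a)) : Rates3 I (joinK (K a)) e₁ e₂ eA := by
  have key : ∀ {ψ : α → ℝ≥0∞} {e : ℝ≥0∞}, Bd J ψ e → ψ a ≤ e := by
    intro ψ e hψ
    have h1 := hψ _ ha
    have h2 : ∀ φ : α → ℝ≥0∞, E (fun x => ind (x = a)) φ = φ a := by
      intro φ
      rw [E, tsum_eq_single a]
      · simp [ind]
      · intro x hx; simp [ind, hx]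
    rw [← E_one, h2, h2, mul_one] at h1
    exact h1
  refine ⟨fun m _ => ?_, fun m _ => ?_, fun m _ => ?_⟩ <;> rw [← E_const] <;>
    refine E_mono fun g => ?_ <;> rw [joinK, E_map]
  · exact key h.one
  · exact key h.two
  · exact key h.anc

/-- Two unverified ancillas after the transverse gates `G`. -/
def doubleK (P P' : Fin 7 → PMF (Cfg k × Bool))
    (N N' : ℕ → Cfg k × Cfg k → PMF ((Cfg k × Cfg k) × Bool))
    (Q Q' : Fin 7 → Cfg k → PMF (Cfg k × Bool))
    (G : Fin 7 → Cfg k × Cfg k → PMF ((Cfg k × Cfg k) × Bool)) (u : Fin 7 → Unit) :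
    PMF ((Fin 7 → Cfg k × Cfg k) × Rec) :=
  wbind (wbind (unverK P N Q u) (joinK (unverK P' N' Q' u))) (trans some G)

theorem doubleK_pres (hG : ∀ i, CnotSpec (γ i) (G i) p C) (u : Fin 7 → Unit) (r : Rec) :
    Inv (PairTW p k) (fun y => doubleK P P' N N' Q Q' G u (y, r)) := by
  have := Pres.comp (I := fun _ => True) (J := fun _ => True)
    (K := fun u => wbind (unverK P N Q u) (joinK (unverK P' N' Q' u)))
    (Inv.isCone (PairOf.isCone (TW.isCone k))) (fun _ _ _ => trivial)
    (trans_pres (PairOf.isCone (TW.isCone k)) some fun i x f => (hG i).tw x f)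
  have h := this (fun x => ind (x = u)) trivial r
  have e : ∀ b, ∑' x, ind (x = u) * doubleK P P' N N' Q Q' G x (b, r) =
      doubleK P P' N N' Q Q' G u (b, r) := by
    intro b
    rw [tsum_eq_single u]
    · simp [ind]
    · intro x hx; simp [ind, hx]
  exact (funext e) ▸ h

/-- There are 14 preparations, 14 corrections and 25 = 9 + 9 + 7 gates. The coefficients count
pairs: 91 and 300 within one kind, 350 and 196 across kinds. -/
theorem doubleK_rates (hP : ∀ i, AncSpec (z i) (P i) p A) (hP' : ∀ i, AncSpec (z' i) (P' i) p A)
    (hN : ∀ l, CnotSpec (n l) (N l) p C) (hN' : ∀ l, CnotSpec (n' l) (N' l) p C)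
    (hQ : ∀ i, CorrSpec (q i) (Q i) p B) (hQ' : ∀ i, CorrSpec (q' i) (Q' i) p B)
    (hG : ∀ i, CnotSpec (γ i) (G i) p C) (u : Fin 7 → Unit) :
    E (doubleK P P' N N' Q Q' G u) (fun x => ind (1 ≤ x.2.1.length)) ≤ 14 * (A + B) + 25 * C ∧
    E (doubleK P P' N N' Q Q' G u) (fun x => ind (2 ≤ x.2.1.length)) ≤
      91 * (A ^ 2 + B ^ 2) + 300 * C ^ 2 + 350 * (A + B) * C + 196 * A * B := by
  have hu : Inv (fun _ => True) (fun x => ind (x = u)) := fun _ _ => trivial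
  have c := PairOf.isCone (TW.isCone (p := p) k)
  have key : ∀ r, Inv (TW p k) fun g => unverK P' N' Q' u (g, r) := by
    intro r
    have h := unverK_pres (P := P') (N := N') hQ' (I := fun _ => True) (fun x => ind (x = u)) trivial r
    have e : ∀ b, ∑' x, ind (x = u) * unverK P' N' Q' x (b, r) = unverK P' N' Q' u (b, r) := by
      intro b
      rw [tsum_eq_single u]
      · simp [ind]
      · intro x hx; simp [ind, hx]
    exact (funext e) ▸ h
  have pJ := joinK_pres key
  have h := (((unverK_rates hP hN hQ).comp (unverK_pres hQ)
    (joinK_rates (unverK_rates hP' hN' hQ') hu)).comp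
    ((unverK_pres hQ).comp (Inv.isCone c) pJ) (trans_rates some fun i => (hG i).fail))
  have e : ∀ φ : (Fin 7 → Unit) → ℝ≥0∞, E (fun x => ind (x = u)) φ = φ u := by
    intro φ
    rw [E, tsum_eq_single u]
    · simp [ind]
    · intro x hx; simp [ind, hx]
  have h1 := h.one _ hu
  have h2 := h.two _ hu
  rw [← E_one, e, e, mul_one] at h1 h2
  exact ⟨h1.trans_eq (by ring), h2.trans_eq (by ring)⟩

theorem network_map {o : Ops k} {loc : List ℕ}
    (hN : ∀ l x, (N l x).map (fun x => (x.1.1.err, x.1.2.err)) =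
      o.cnot (l :: loc) (x.1.err, x.2.err)) :
    ∀ (es : List (Fin 7 × Fin 7)) (g : Fin 7 → Cfg k),
      (netK N es g).map (fun x => errs x.1) = network o loc es (errs g)
  | [], g => by
    rw [netK, PMF.pure_map]; rfl
  | e :: es, g => by
    rw [netK, wbind_map]
    simp only [network_map hN es]
    have e1 : network o loc (e :: es) (errs g) = (PMF.map (fun x => (x.1.1.err, x.1.2.err))
        (N es.length (g e.1, g e.2))).bind fun r => network o loc es
          (Function.update (Function.update (fun i => (g i).err) e.1 r.1) e.2 r.2) :=
      congrArg (fun μ => PMF.bind μ _) (hN es.length (g e.1, g e.2)).symm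
    rw [e1, stepK, PMF.bind_map, PMF.bind_map]
    congr 1; funext x
    change network o loc es _ = network o loc es _
    congr 1
    funext i
    change (Function.update (Function.update g e.1 x.1.1) e.2 x.1.2 i).err =
      Function.update (Function.update (fun i => (g i).err) e.1 x.1.1.err) e.2 x.1.2.err i
    by_cases h2 : i = e.2
    · subst h2; simp
    · by_cases h1 : i = e.1
      · subst h1; simp [h2]
      · simp [h1, h2]

theorem unverK_map {o : Ops k} {loc : List ℕ}
    (hP : ∀ i, (P i).map (fun x => x.1.err) = if i = 0 ∨ i = 1 ∨ i = 3 then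
      o.plus (i.val :: 0 :: loc) else o.zero (i.val :: 0 :: loc))
    (hN : ∀ l x, (N l x).map (fun x => (x.1.1.err, x.1.2.err)) =
      o.cnot (l :: 1 :: loc) (x.1.err, x.2.err))
    (hQ : ∀ i c, (Q i c).map (fun x => x.1.err) = o.correct (i.val :: 2 :: loc) c.err)
    (u : Fin 7 → Unit) : (unverK P N Q u).map (fun x => errs x.1) = unverified o loc := by
  have h3 : ∀ g, (trans some Q g).map (fun x => errs x.1) = transverseCorrect o (2 :: loc) (errs g) :=
    fun g => trans_map_errs some Q _ g fun i => hQ i (g i)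
  rw [unverK, wbind_map]
  simp only [h3]
  rw [bind_of_map _ (fun x : (Fin 7 → Cfg k) × Rec => errs x.1), wbind_map]
  simp only [network_map hN]
  rw [bind_of_map _ (fun x : (Fin 7 → Cfg k) × Rec => errs x.1) (fun e => network o (1 :: loc) encoder e),
    trans_map_errs (fun _ => none) (fun i _ => P i) _ u hP]
  exact PMF.bind_bind _ _ _

/-- Later gates may spread a failure, so it is recorded as `none`. Without failures, trivial states
propagate to trivial states. -/
theorem netK_valid (hN : ∀ l, CnotSpec (n l) (N l) p C) : ∀ (es : List (Fin 7 × Fin 7))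
    (g g' : Fin 7 → Cfg k) (r : Rec), (g', r) ∈ (netK N es g).support →
    r.2 = false ∧ (∀ y ∈ r.1, y = none) ∧ ((∀ i, Valid k (g i) ∧ state k (g i).err = 0) → r.1 = [] →
      ∀ i, Valid k (g' i) ∧ state k (g' i).err = 0)
  | [], g, g', r, h => by
    rw [netK, PMF.mem_support_pure_iff] at h
    obtain ⟨rfl, rfl⟩ := Prod.mk.inj h
    exact ⟨rfl, by simp, fun h _ => h⟩
  | e :: es, g, g', r, h => by
    obtain ⟨g₁, s, t, h1, h2, rfl⟩ := mem_support_wbind.1 h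
    obtain ⟨i1, i2, i3⟩ := netK_valid hN es g₁ g' t h2
    rw [stepK, PMF.mem_support_map_iff] at h1
    obtain ⟨x, hx, ex⟩ := h1
    obtain ⟨rfl, rfl⟩ := Prod.ext_iff.1 ex
    refine ⟨by simp [Rec.append, i1], ?_, fun hg hr => ?_⟩
    · intro y hy
      simp only [Rec.append, List.mem_append] at hy
      rcases hy with hy | hy
      · split_ifs at hy <;> simp_all
      · exact i2 y hy
    · obtain ⟨hr1, hr2⟩ := List.append_eq_nil_iff.1 hr
      have hf : x.2 = false := by
        by_contra hne
        simp [Bool.not_eq_false] at hne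
        simp [hne] at hr1
      refine i3 (fun i => ?_) hr2
      have v := (hN _).valid _ x hx hf
      have st := (hN _).state (g e.1, g e.2) (hg _).1 (hg _).1 x hx hf
      rw [(hg e.1).2, (hg e.2).2] at st
      change (state k x.1.1.err, state k x.1.2.err) = (0, 0) at st
      obtain ⟨s1, s2⟩ := Prod.ext_iff.1 st
      change Valid k (Function.update (Function.update g e.1 x.1.1) e.2 x.1.2 i) ∧
        state k (Function.update (Function.update g e.1 x.1.1) e.2 x.1.2 i).err = 0
      by_cases h2 : i = e.2
      · subst h2; simpa using ⟨v.2, s2⟩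
      · by_cases h1 : i = e.1
        · subst h1; simpa [h2] using ⟨v.1, s1⟩
        · simpa [h1, h2] using hg i

/-- The final correction validates a subblock whatever the encoder did; a trivial state also needs
the absence of spreading faults. -/
theorem unverK_valid (hP : ∀ i, AncSpec (z i) (P i) p A) (hN : ∀ l, CnotSpec (n l) (N l) p C)
    (hQ : ∀ i, CorrSpec (q i) (Q i) p B) {u : Fin 7 → Unit} {g : Fin 7 → Cfg k} {r : Rec}
    (h : (g, r) ∈ (unverK P N Q u).support) {j : Fin 7} (hj : some j ∉ r.1) :
    Valid k (g j) ∧ (none ∉ r.1 → state k (g j).err = 0) := by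
  obtain ⟨g₂, s, t, h1, h2, rfl⟩ := mem_support_wbind.1 h
  obtain ⟨g₁, s', t', h3, h4, rfl⟩ := mem_support_wbind.1 h1
  obtain ⟨-, φ, h5, h6⟩ := mem_support_trans h2
  obtain ⟨-, φ', h7, h8⟩ := mem_support_trans h3
  obtain ⟨-, m1, m2⟩ := netK_valid hN _ _ _ _ h4
  simp only [Rec.append, List.mem_append, not_or] at hj ⊢
  have hφ : φ j = false := by
    by_contra hne
    apply hj.2
    rw [h5]
    exact List.mem_map_of_mem (mem_flagList.2 (by simpa using hne))
  refine ⟨(hQ j).valid _ _ (h6 j) hφ, fun hn => ?_⟩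
  have hφ' : ∀ i, φ' i = false := by
    intro i
    by_contra hne
    apply hn.1.1
    rw [h7, List.mem_map]
    exact ⟨i, mem_flagList.2 (by simpa using hne), rfl⟩
  have ht' : t'.1 = [] := by
    refine List.eq_nil_iff_forall_not_mem.2 fun y hy => hn.1.2 ?_
    rw [← m1 y hy]; exact hy
  have hv := m2 (fun i => ⟨(hP i).valid _ (h8 i) (hφ' i), (hP i).state _ (h8 i) (hφ' i)⟩) ht' j
  rw [← hv.2]
  exact (hQ j).state _ hv.1 _ (h6 j) hφ

end Ancilla

/-! ## Verified ancillas -/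

section Verified

variable {k : ℕ} {p : ℕ → ℝ≥0∞} {A B C : ℝ≥0∞}

/-- The columns of the check matrix are distinct, so a coset leader has at most one nonzero entry.
-/
theorem minPattern_unique : ∀ e : Fin 7 → ZMod 2, ∀ i j, minPattern e i ≠ 0 → minPattern e j ≠ 0 →
    i = j := by
  intro e i j hi hj
  have hc : ∀ i j : Fin 7, (∀ r, checks r i = checks r j) → i = j := by decide +kernel
  simp only [minPattern, ne_eq, ite_eq_right_iff, one_ne_zero, imp_false, not_not] at hi hj
  exact hc i j fun r => (hi r).trans (hj r).symm

/-- The verification of two copies accepts. -/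
def Accept (y : Fin 7 → Cfg k × Cfg k) : Prop :=
  minPattern (xs (states (rowR y))) = 0 ∧ decodeBit (xs (states (rowR y))) = 0

/-- The ideal string has logical value `0` and trivial syndrome, so the verdict depends only on the
X-parts of the second copy. -/
theorem accepted_iff {b : Bits (k + 1)} (hb : b ∈ (codeword (k + 1) 0).support)
    (y : Fin 7 → Cfg k × Cfg k) : accepted (b.xor (xPart (errs (rowR y)))) ↔ Accept y := by
  have h1 : (fun i => value k (xPart (errs (rowR y)) i)) = xs (states (rowR y)) :=
    funext fun i => value_xPart k _
  have h2 : value (k + 1) (b.xor (xPart (errs (rowR y)))) = decodeBit (xs (states (rowR y))) := by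
    rw [value_codeword _ hb, add_zero, value_succ, h1]
  rw [accepted, values_codeword hb, h1, h2]
  exact and_congr ⟨fun h => funext h, fun h i => congrFun h i⟩ Iff.rfl

open Classical in
/-- The uncontrolled subblock of an ancilla with faults `l` and states `s` of the subblocks. -/
def ancTag (l : List (Option (Fin 7))) (s : Fin 7 → Pauli) : Option (Fin 7) :=
  match l with
  | [] => none
  | some i :: _ => some i
  -- A spreading fault has no place of its own. In an accepted run its remaining relative error sits
  -- on one subblock, which is tagged instead.
  | none :: _ => if h : ∃ i, relState s i ≠ 0 then some h.choose else none

open Classical in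
/-- The kept ancilla, with the bookkeeping of a logical Z. -/
def ancOut (x : (Fin 7 → Cfg k × Cfg k) × Rec) : Cfg (k + 1) × Bool :=
  let P : Pauli := (0, (logical (states (rowL x.1))).2)
  if 2 ≤ x.2.1.length then (untag (k + 1) (errs fun i => shiftC k P (rowL x.1 i)), true)
  else (mkC (ancTag x.2.1 (states (rowL x.1))) fun i => shiftC k P (rowL x.1 i), false)

/-- Preparation of a verified ancilla from two copies `D`. -/
def zeroK (D : PMF ((Fin 7 → Cfg k × Cfg k) × Rec)) : PMF (Cfg (k + 1) × Bool) :=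
  (postselect D {x | Accept x.1}).map ancOut

theorem ancOut_err (x : (Fin 7 → Cfg k × Cfg k) × Rec) :
    (ancOut x).1.err = bookkeep (errs (rowL x.1)) := by
  have : (ancOut x).1.err =
      errs fun i => shiftC k (0, (logical (states (rowL x.1))).2) (rowL x.1 i) := by
    unfold ancOut
    split_ifs
    · exact untag_err _ _
    · rfl
  rw [this]
  funext i
  exact shiftC_err k _ _

/-- The random codeword does not influence acceptance, so it may be drawn after postselection and
then forgotten. -/
theorem zeroK_err {D : PMF ((Fin 7 → Cfg k × Cfg k) × Rec)} {o : Ops k} {loc : List ℕ}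
    (hD : D.map (fun x => (errs (rowL x.1), errs (rowR x.1))) =
      (unverified o (0 :: loc)).bind fun e₁ => (unverified o (1 :: loc)).bind fun e₂ =>
        transverseCNOT o (2 :: loc) e₁ e₂) :
    (zeroK D).map (fun x => x.1.err) = prepareZero o loc := by
  have h : ((unverified o (0 :: loc)).bind fun e₁ =>
      (unverified o (1 :: loc)).bind fun e₂ =>
      (transverseCNOT o (2 :: loc) e₁ e₂).bind fun r =>
      (codeword (k + 1) 0).map fun c => (r.1, c.xor (xPart r.2))) =
      D.bind fun x => (codeword (k + 1) 0).map fun c =>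
        (errs (rowL x.1), c.xor (xPart (errs (rowR x.1)))) := by
    rw [bind_of_map D (fun x => (errs (rowL x.1), errs (rowR x.1))) (fun r =>
      (codeword (k + 1) 0).map fun c => (r.1, c.xor (xPart r.2))), hD]
    simp only [PMF.bind_bind]
  rw [prepareZero, h, postselect_bind (S := {x | Accept x.1}), zeroK, PMF.map_comp, PMF.map_bind]
  · rw [PMF.map]
    congr 1; funext x
    rw [PMF.map_comp]
    change PMF.pure (ancOut x).1.err =
      (codeword (k + 1) 0).map (Function.const _ (bookkeep (errs (rowL x.1))))
    rw [PMF.map_const, ancOut_err]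
  · intro x _ r hr
    obtain ⟨b, hb, rfl⟩ := (PMF.mem_support_map_iff _ _ _).1 hr
    exact accepted_iff hb x.1

theorem mem_support_zeroK {D : PMF ((Fin 7 → Cfg k × Cfg k) × Rec)}
    (hD : E D (fun x => ind (x ∈ {x : (Fin 7 → Cfg k × Cfg k) × Rec | Accept x.1})) ≠ 0)
    {x : Cfg (k + 1) × Bool} (hx : x ∈ (zeroK D).support) :
    ∃ y ∈ D.support, Accept y.1 ∧ ancOut y = x := by
  obtain ⟨y, hy, rfl⟩ := (PMF.mem_support_map_iff _ _ _).1 hx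
  obtain ⟨h1, h2⟩ := mem_support_postselect hD hy
  exact ⟨y, h1, h2, rfl⟩

theorem ancOut_flag (x : (Fin 7 → Cfg k × Cfg k) × Rec) :
    (ancOut x).2 = true ↔ 2 ≤ x.2.1.length := by
  unfold ancOut
  split_ifs with h <;> simp [h]

theorem ancOut_of_not {x : (Fin 7 → Cfg k × Cfg k) × Rec} (h : (ancOut x).2 = false) :
    x.2.1.length ≤ 1 ∧ ancOut x = (mkC (ancTag x.2.1 (states (rowL x.1))) fun i =>
      shiftC k (0, (logical (states (rowL x.1))).2) (rowL x.1 i), false) := by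
  have : ¬2 ≤ x.2.1.length := by rw [← ancOut_flag, h]; simp
  exact ⟨by omega, by simp [ancOut, this]⟩

theorem ancOut_tag {x : (Fin 7 → Cfg k × Cfg k) × Rec} (h : tagC (ancOut x).1 ≠ none) :
    1 ≤ x.2.1.length := by
  by_contra hl
  have hl' : x.2.1 = [] := List.length_eq_zero_iff.1 (by omega)
  apply h
  unfold ancOut
  rw [if_neg (by omega)]
  simp [hl', ancTag]

/-- Outcomes of two copies with at most one fault. -/
structure DoubleSpec (D : PMF ((Fin 7 → Cfg k × Cfg k) × Rec)) (p : ℕ → ℝ≥0∞) (e₁ e₂ : ℝ≥0∞) :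
    Prop where
  pres : ∀ r, Inv (PairTW p k) fun y => D (y, r)
  one : E D (fun x => ind (1 ≤ x.2.1.length)) ≤ e₁
  two : E D (fun x => ind (2 ≤ x.2.1.length)) ≤ e₂
  /-- Subblocks without a fault of their own. -/
  valid : ∀ x ∈ D.support, ∀ j, some j ∉ x.2.1 → Valid k (rowL x.1 j)
  clean : ∀ x ∈ D.support, none ∉ x.2.1 → ∀ j, some j ∉ x.2.1 →
    states (rowL x.1) j = 0 ∧ states (rowR x.1) j = 0
  /-- A single fault that spreads. -/
  spread : ∀ x ∈ D.support, x.2.1 = [none] → Accept x.1 →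
    minPattern (xs (states (rowL x.1))) = 0 ∧ decodeBit (xs (states (rowL x.1))) = 0

variable {D : PMF ((Fin 7 → Cfg k × Cfg k) × Rec)} {e₁ e₂ : ℝ≥0∞}

/-- A fault-free run leaves no X-part in the states of the second copy and is accepted. -/
theorem DoubleSpec.accept (h : DoubleSpec D p e₁ e₂) :
    1 - e₁ ≤ E D (fun x => ind (x ∈ {x : (Fin 7 → Cfg k × Cfg k) × Rec | Accept x.1})) := by
  rw [tsub_le_iff_right]
  refine le_trans ?_ (add_le_add_right h.one _)
  rw [← mass_pmf D, ← E_one, ← E_add]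
  refine E_mono_support fun x hx => ?_
  by_cases hl : 1 ≤ x.2.1.length
  · rw [ind_true hl]; exact le_add_self
  · have hl' : x.2.1 = [] := List.length_eq_zero_iff.1 (by omega)
    have h0 : xs (states (rowR x.1)) = 0 := funext fun j => congrArg Prod.fst
      (h.clean x ((PMF.mem_support_iff _ _).2 hx) (by simp [hl']) j (by simp [hl'])).2
    rw [ind_true]
    · exact le_self_add
    · refine ⟨by rw [h0, minPattern_zero], ?_⟩
      rw [h0, decodeBit_of_syndrome (Matrix.mulVec_zero _)]
      simp

/-- A local fault is confined to its tagged place. After a spreading fault, acceptance rules out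
relative X errors and logical X; the Z-part has a coset leader of weight at most one, which is
tagged, and its logical value is removed by the bookkeeping. -/
theorem DoubleSpec.ancOut_valid (h : DoubleSpec D p e₁ e₂) {x : (Fin 7 → Cfg k × Cfg k) × Rec}
    (hx : x ∈ D.support) (ha : Accept x.1) (hf : (ancOut x).2 = false) :
    Valid (k + 1) (ancOut x).1 ∧ state (k + 1) (ancOut x).1.err = 0 := by
  obtain ⟨hl, e⟩ := ancOut_of_not hf
  rw [e]
  set P : Pauli := (0, (logical (states (rowL x.1))).2) with hP
  have hs : states (fun i => shiftC k P (rowL x.1 i)) = fun i => states (rowL x.1) i + P :=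
    funext fun i => state_shiftC P _
  have hst : (logical (states (rowL x.1))).1 = 0 →
      state (k + 1) (mkC (ancTag x.2.1 (states (rowL x.1))) fun i => shiftC k P (rowL x.1 i)).err =
        0 := by
    intro h1
    rw [state_succ, subC_mkC, hs, logical_add_const]
    refine Prod.ext ?_ ?_
    · change (logical (states (rowL x.1))).1 + 0 = 0
      rw [h1, add_zero]
    · exact CharTwo.add_self_eq_zero _
  have hval : (∀ i, ancTag x.2.1 (states (rowL x.1)) ≠ some i →
      relState (states (rowL x.1)) i = 0 ∧ Valid k (rowL x.1 i)) →
      Valid (k + 1) (mkC (ancTag x.2.1 (states (rowL x.1))) fun i => shiftC k P (rowL x.1 i)) := by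
    intro hv i hi
    obtain ⟨h1, h2⟩ := hv i hi
    rw [subRel_eq, subC_mkC, hs, relState_add_const]
    exact ⟨h1, valid_shiftC k _ h2⟩
  have near : none ∉ x.2.1 → ∀ t, (∀ y ∈ x.2.1, y = some t) → NearS t (states (rowL x.1)) 0 := by
    intro hn t ht
    have : ∀ j, j ≠ t → states (rowL x.1) j = 0 := fun j hj =>
      (h.clean x hx hn j fun hm => hj (Option.some.inj (ht _ hm))).1
    exact ⟨⟨0, Matrix.mulVec_zero _, by simp, fun j hj => congrArg Prod.fst (this j hj)⟩,
      ⟨0, Matrix.mulVec_zero _, by simp, fun j hj => congrArg Prod.snd (this j hj)⟩⟩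
  rcases hx2 : x.2.1 with _ | ⟨y, l⟩
  · rw [hx2] at near hst hval
    refine ⟨hval fun i _ => ?_, hst ?_⟩
    · obtain ⟨t, ht⟩ := exists_ne i
      exact ⟨(near (by simp) t (by simp)).relState_eq ht.symm, h.valid x hx i (by simp [hx2])⟩
    · rw [(near (by simp) 0 (by simp)).logical_eq]; rfl
  · rw [hx2] at hl
    simp only [List.length_cons] at hl
    obtain rfl : l = [] := List.length_eq_zero_iff.1 (by omega)
    rcases y with _ | t
    · obtain ⟨c1, c2⟩ := h.spread x hx hx2 ha
      rw [hx2] at hst hval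
      refine ⟨hval fun i hi => ⟨?_, h.valid x hx i (by simp [hx2])⟩, hst ?_⟩
      · by_contra hne
        have hex : ∃ i, relState (states (rowL x.1)) i ≠ 0 := ⟨i, hne⟩
        simp only [ancTag, hex, dite_true] at hi
        apply hi
        have hz : ∀ j, relState (states (rowL x.1)) j ≠ 0 →
            minPattern (zs (states (rowL x.1))) j ≠ 0 := by
          intro j hj h0
          exact hj (Prod.ext (congrFun c1 j) h0)
        exact congrArg some (minPattern_unique _ _ _ (hz _ hex.choose_spec) (hz i hne))
      · rw [logical_eq]; exact c2
    · rw [hx2] at near hst hval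
      have nt := near (by simp) t (by simp)
      refine ⟨hval fun i hi => ?_, hst ?_⟩
      · have hi' : i ≠ t := by rintro rfl; exact hi rfl
        exact ⟨nt.relState_eq hi', h.valid x hx i (by simp [hx2, hi'])⟩
      · rw [nt.logical_eq]; rfl

/-- For a fixed record and a fixed second copy, acceptance is settled, and both the tag and the
bookkeeping depend on the first copy through its states. The law of one kept subblock is thus a
restriction by state of a `TW` mass, followed by a shift. -/
theorem zeroK_tw_sub (h : DoubleSpec D p e₁ e₂)
    (hD : E D (fun x => ind (x ∈ {x : (Fin 7 → Cfg k × Cfg k) × Rec | Accept x.1})) ≠ 0)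
    (t : Option (Fin 7)) (i : Fin 7) (g : Fin 7 → Cfg k) :
    TW p k (fun x => zeroK D (mkC t (Function.update g i x), false)) := by
  let S : Set ((Fin 7 → Cfg k × Cfg k) × Rec) := {x | Accept x.1}
  let q := (E D fun x => ind (x ∈ S))⁻¹
  -- The bookkeeping Pauli `P` becomes a summation variable, so that each summand is relabelled by
  -- one fixed involution.
  let cond : Pauli → Rec → (Fin 7 → Pauli) → Prop := fun P r s =>
    r.1.length ≤ 1 ∧ ancTag r.1 s = t ∧ (0, (logical s).2) = P
  have e : ∀ g' : Fin 7 → Cfg k, zeroK D (mkC t g', false) =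
      ∑' a : (Rec × (Fin 7 → Cfg k)) × Pauli, (q * ind (Accept (zipC a.1.2 a.1.2))) *
        (D (zipC (fun j => shiftC k a.2 (g' j)) a.1.2, a.1.1) *
          ind (cond a.2 a.1.1 (states fun j => shiftC k a.2 (g' j)))) := by
    intro g'
    have hA : ∀ (u u' : Fin 7 → Cfg k) (h : Fin 7 → Cfg k), Accept (zipC u h) ↔ Accept (zipC u' h) :=
      fun _ _ _ => Iff.rfl
    rw [zeroK, map_apply_E, E_postselect hD, ← E_mul_left]
    refine ENNReal.tsum_prod'.trans (ENNReal.tsum_comm.trans ?_)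
    refine Eq.trans ?_ (ENNReal.tsum_prod' (α := Rec × (Fin 7 → Cfg k)) (β := Pauli)).symm
    refine Eq.trans ?_ (ENNReal.tsum_prod' (α := Rec) (β := Fin 7 → Cfg k)).symm
    refine tsum_congr fun r => ?_
    rw [← (Equiv.arrowProdEquivProdArrow (Fin 7) (fun _ => Cfg k)
      (fun _ => Cfg k)).symm.tsum_eq]
    refine ENNReal.tsum_prod'.trans (ENNReal.tsum_comm.trans ?_)
    refine tsum_congr fun u => ?_
    change ∑' v, D (zipC v u, r) * (q * (ind (Accept (zipC v u)) *
      ind (ancOut (zipC v u, r) = (mkC t g', false)))) = _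
    have e1 : ∀ v : Fin 7 → Cfg k, ind (ancOut (zipC v u, r) = (mkC t g', false)) =
        ∑' P : Pauli, ind (v = fun j => shiftC k P (g' j)) * ind (cond P r (states v)) := by
      intro v
      rw [tsum_eq_single (0, (logical (states v)).2)]
      · rw [← ind_and]
        refine ind_congr ?_
        constructor
        · intro ha
          obtain ⟨h1, h2⟩ := ancOut_of_not (congrArg Prod.snd ha)
          rw [h2] at ha
          have ha' := congrArg Prod.fst ha
          have ht : ancTag r.1 (states v) = t := congrArg tagC ha'
          have hg : (fun j => shiftC k (0, (logical (states v)).2) (v j)) = g' :=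
            congrArg subC ha'
          refine ⟨?_, h1, ht, rfl⟩
          rw [← hg]
          funext j
          exact (shiftC_shiftC k _ _).symm
        · rintro ⟨hv, h1, ht, -⟩
          have hl : ¬2 ≤ r.1.length := by omega
          have : ancOut (zipC v u, r) = (mkC (ancTag r.1 (states v)) fun j =>
              shiftC k (0, (logical (states v)).2) (v j), false) := if_neg hl
          rw [this, ht]
          congr 2
          funext j
          have := congrFun hv j
          beta_reduce at this
          conv_lhs => rw [this]
          exact shiftC_shiftC k _ _
      · intro P hP
        rw [ind_false (P := cond P r (states v)), mul_zero]
        rintro ⟨-, -, h3⟩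
        exact hP h3.symm
    simp only [e1, ← ENNReal.tsum_mul_left]
    rw [ENNReal.tsum_comm]
    refine tsum_congr fun P => ?_
    rw [tsum_eq_single fun j => shiftC k P (g' j)]
    · rw [ind_true rfl, ind_congr (hA (fun j => shiftC k P (g' j)) u u)]
      ring
    · intro v hv
      simp [ind, hv]
  simp only [e]
  refine TW.isCone k ((Rec × (Fin 7 → Cfg k)) × Pauli)
    (fun a => q * ind (Accept (zipC a.1.2 a.1.2)))
    (fun a x => D (zipC (fun j => shiftC k a.2 (Function.update g i x j)) a.1.2, a.1.1) *
      ind (cond a.2 a.1.1 (states fun j => shiftC k a.2 (Function.update g i x j)))) fun a => ?_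
  have u : ∀ x, (fun j => shiftC k a.2 (Function.update g i x j)) =
      Function.update (fun j => shiftC k a.2 (g j)) i (shiftC k a.2 x) := by
    intro x; funext j
    by_cases hj : j = i
    · subst hj; simp
    · simp [hj]
  simp only [u, states_update]
  exact (((h.pres a.1.1).zip_left a.1.2 i fun j => shiftC k a.2 (g j)).restrict fun s =>
    cond a.2 a.1.1 (Function.update (states fun j => shiftC k a.2 (g j)) i s)).shiftC a.2

/-- Conditioning on acceptance costs a factor `1 / (1 - e₁)`. Unflagged ancillas all have state `0`,
so the bound on tags given the state only compares with the probability of no failure, at least `1 -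
e₂ / (1 - e₁)`. -/
theorem zeroK_spec (h : DoubleSpec D p e₁ e₂) (h₁ : e₁ < 1)
    (hp : e₁ / (1 - e₁) ≤ p (k + 1) * (1 - e₂ / (1 - e₁))) {z : PMF (Err (k + 1))}
    (hz : (zeroK D).map (fun x => x.1.err) = z) :
    AncSpec z (zeroK D) p (e₂ / (1 - e₁)) ∧
      E (zeroK D) (fun x => ind (tagC x.1 ≠ none)) ≤ e₁ / (1 - e₁) := by
  let S : Set ((Fin 7 → Cfg k × Cfg k) × Rec) := {x | Accept x.1}
  have hN : 1 - e₁ ≤ E D (fun x => ind (x ∈ S)) := h.accept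
  have hD : E D (fun x => ind (x ∈ S)) ≠ 0 :=
    fun h0 => (tsub_pos_iff_lt.2 h₁).ne' (le_antisymm (hN.trans_eq h0) zero_le)
  have bound : ∀ (φ : Cfg (k + 1) × Bool → ℝ≥0∞) (ψ : (Fin 7 → Cfg k × Cfg k) × Rec → ℝ≥0∞)
      (e : ℝ≥0∞), (∀ x, φ (ancOut x) ≤ ψ x) → E D ψ ≤ e → E (zeroK D) φ ≤ e / (1 - e₁) := by
    intro φ ψ e hφ hψ
    rw [zeroK, E_map, E_postselect hD, div_eq_mul_inv, mul_comm]
    refine mul_le_mul' ((E_mono fun x => ?_).trans hψ) (ENNReal.inv_le_inv.2 hN)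
    exact (mul_le_of_le_one_left' (ind_le_one _)).trans (hφ x)
  have hfail : E (zeroK D) (fun x => ind (x.2 = true)) ≤ e₂ / (1 - e₁) :=
    bound _ _ _ (fun x => (ind_congr (ancOut_flag x)).le) h.two
  have htag : E (zeroK D) (fun x => ind (tagC x.1 ≠ none)) ≤ e₁ / (1 - e₁) :=
    bound _ _ _ (fun x => ind_mono ancOut_tag) h.one
  have hst : ∀ x ∈ (zeroK D).support, x.2 = false →
      Valid (k + 1) x.1 ∧ state (k + 1) x.1.err = 0 := by
    intro x hx hf
    obtain ⟨y, hy, ha, rfl⟩ := mem_support_zeroK hD hx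
    exact h.ancOut_valid hy ha hf
  refine ⟨⟨hz, ?_, hfail, fun x hx hf => (hst x hx hf).1, fun x hx hf => (hst x hx hf).2⟩, htag⟩
  rintro (_ | _)
  · refine ⟨fun s => ?_, fun t i g => zeroK_tw_sub h hD t i g⟩
    by_cases hs : s = 0
    · have e1 : ∀ Q : Cfg (k + 1) → Prop, E (fun x => zeroK D (x, false))
          (fun c => ind (state (k + 1) c.err = s ∧ Q c)) =
          E (zeroK D) (fun x => ind (x.2 = false) * ind (Q x.1)) := by
        intro Q
        rw [E_section]
        refine tsum_congr fun x => ?_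
        by_cases hx : zeroK D x = 0
        · simp [hx]
        · by_cases hf : x.2 = false
          · have := (hst x ((PMF.mem_support_iff _ _).2 hx) hf).2
            rw [hs]
            beta_reduce
            have hiff : (state (k + 1) x.1.err = 0 ∧ Q x.1) ↔ Q x.1 :=
              ⟨fun h => h.2, fun h => ⟨this, h⟩⟩
            rw [ind_congr hiff]
          · simp [ind, hf]
      have e2 := e1 fun c => tagC c ≠ none
      have e3 := e1 fun _ => True
      simp only [and_true, ind_true trivial, mul_one] at e3
      rw [e2, e3]
      refine (E_mono fun x => mul_le_of_le_one_left' (ind_le_one _)).trans (htag.trans (hp.trans ?_))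
      refine mul_le_mul_right ?_ _
      rw [tsub_le_iff_right]
      refine le_trans ?_ (add_le_add_right hfail _)
      rw [← E_add, ← mass_pmf (zeroK D), ← E_one]
      refine E_mono fun x => ?_
      rcases x.2 <;> simp [ind]
    · have e0 : E (fun x => zeroK D (x, false))
          (fun c : Cfg (k + 1) => ind (state (k + 1) c.err = s ∧ tagC c ≠ none)) = 0 := by
        refine ENNReal.tsum_eq_zero.2 fun c => ?_
        by_cases hc : zeroK D (c, false) = 0
        · simp [hc]
        · have := (hst _ ((PMF.mem_support_iff _ _).2 hc) rfl).2
          beta_reduce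
          rw [ind_false, mul_zero]
          rintro ⟨h', -⟩
          exact hs (h'.symm.trans this)
      rw [e0]; exact zero_le
  · refine TW.of_untagged fun x hx => ?_
    obtain ⟨y, -, -, e⟩ := mem_support_zeroK hD ((PMF.mem_support_iff _ _).2 hx)
    unfold ancOut at e
    split_ifs at e
    · have e' : x = untag (k + 1) _ := (congrArg Prod.fst e).symm
      rw [e', untag_err]
    · exact absurd (congrArg Prod.snd e) (by simp)

/-! ### Two unverified copies, as produced by the instrumented operations -/

section Double

variable {P P' : Fin 7 → PMF (Cfg k × Bool)} {N N' : ℕ → Cfg k × Cfg k → PMF ((Cfg k × Cfg k) × Bool)}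
  {Q Q' : Fin 7 → Cfg k → PMF (Cfg k × Bool)} {z z' : Fin 7 → PMF (Err k)}
  {n n' : ℕ → Err k × Err k → PMF (Err k × Err k)} {q q' : Fin 7 → Err k → PMF (Err k)}
  {G : Fin 7 → Cfg k × Cfg k → PMF ((Cfg k × Cfg k) × Bool)}
  {γ : Fin 7 → Err k × Err k → PMF (Err k × Err k)} {u : Fin 7 → Unit}

theorem mem_support_doubleK {x : (Fin 7 → Cfg k × Cfg k) × Rec}
    (hx : x ∈ (doubleK P P' N N' Q Q' G u).support) : ∃ g r g' r', ∃ φ : Fin 7 → Bool,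
      (g, r) ∈ (unverK P N Q u).support ∧ (g', r') ∈ (unverK P' N' Q' u).support ∧
      x.2.1 = r.1 ++ r'.1 ++ (flagList φ).map some ∧
      ∀ i, (x.1 i, φ i) ∈ (G i (g i, g' i)).support := by
  obtain ⟨y, s⟩ := x
  obtain ⟨h, r₀, t, h1, h2, rfl⟩ := mem_support_wbind.1 hx
  obtain ⟨g, r, r', h3, h4, rfl⟩ := mem_support_wbind.1 h1
  obtain ⟨⟨g', r''⟩, h5, e⟩ := (PMF.mem_support_map_iff _ _ _).1 h4
  obtain ⟨rfl, rfl⟩ := Prod.mk.inj e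
  obtain ⟨-, φ, h6, h7⟩ := mem_support_trans h2
  exact ⟨g, r, g', r'', φ, h3, h5, by simp [Rec.append, h6], h7⟩

/-- X errors travel from the first copy to the second. If the one spreading fault is in the first
copy, the second one measures exactly its X pattern; if it is in the second, the first copy has no
X-part, since only Z errors travel back. -/
theorem doubleK_spec (hP : ∀ i, AncSpec (z i) (P i) p A) (hP' : ∀ i, AncSpec (z' i) (P' i) p A)
    (hN : ∀ l, CnotSpec (n l) (N l) p C) (hN' : ∀ l, CnotSpec (n' l) (N' l) p C)
    (hQ : ∀ i, CorrSpec (q i) (Q i) p B) (hQ' : ∀ i, CorrSpec (q' i) (Q' i) p B)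
    (hG : ∀ i, CnotSpec (γ i) (G i) p C) (u : Fin 7 → Unit) :
    DoubleSpec (doubleK P P' N N' Q Q' G u) p (14 * (A + B) + 25 * C)
      (91 * (A ^ 2 + B ^ 2) + 300 * C ^ 2 + 350 * (A + B) * C + 196 * A * B) := by
  obtain ⟨r1, r2⟩ := doubleK_rates hP hP' hN hN' hQ hQ' hG u
  refine ⟨doubleK_pres hG u, r1, r2, ?_, ?_, ?_⟩
  · intro x hx j hj
    obtain ⟨g, r, g', r', φ, h1, h2, hl, h3⟩ := mem_support_doubleK hx
    simp only [hl, List.mem_append, not_or] at hj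
    have hφ : φ j = false := by
      by_contra hne
      exact hj.2 (List.mem_map_of_mem (mem_flagList.2 (by simpa using hne)))
    exact ((hG j).valid _ _ (h3 j) hφ).1
  · intro x hx hn j hj
    obtain ⟨g, r, g', r', φ, h1, h2, hl, h3⟩ := mem_support_doubleK hx
    simp only [hl, List.mem_append, not_or] at hj hn
    have hφ : φ j = false := by
      by_contra hne
      exact hj.2 (List.mem_map_of_mem (mem_flagList.2 (by simpa using hne)))
    obtain ⟨v1, s1⟩ := unverK_valid hP hN hQ h1 hj.1.1
    obtain ⟨v2, s2⟩ := unverK_valid hP' hN' hQ' h2 hj.1.2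
    have := (hG j).state _ v1 v2 _ (h3 j) hφ
    rw [s1 hn.1.1, s2 hn.1.2] at this
    exact ⟨congrArg Prod.fst this, congrArg Prod.snd this⟩
  · intro x hx hl ha
    obtain ⟨g, r, g', r', φ, h1, h2, hl', h3⟩ := mem_support_doubleK hx
    rw [hl] at hl'
    have hφ : flagList φ = [] := by
      by_contra hne
      obtain ⟨j, hj⟩ := List.exists_mem_of_ne_nil _ hne
      have : some j ∈ [(none : Option (Fin 7))] := by
        rw [hl']; exact List.mem_append_right _ (List.mem_map_of_mem hj)
      simp at this
    have hφ' : ∀ j, φ j = false := by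
      intro j
      by_contra hne
      have : j ∈ flagList φ := mem_flagList.2 (by simpa using hne)
      simp [hφ] at this
    rw [hφ, List.map_nil, List.append_nil] at hl'
    have hm : ∀ j, some j ∉ r.1 ∧ some j ∉ r'.1 := by
      intro j
      have : some j ∉ [(none : Option (Fin 7))] := by simp
      rw [hl', List.mem_append, not_or] at this
      exact this
    have v1 := fun j => unverK_valid hP hN hQ h1 (hm j).1
    have v2 := fun j => unverK_valid hP' hN' hQ' h2 (hm j).2
    have st := fun j => (hG j).state _ (v1 j).1 (v2 j).1 _ (h3 j) (hφ' j)
    have xl : xs (states (rowL x.1)) = xs (states g) :=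
      funext fun j => congrArg (fun a => a.1.1) (st j)
    by_cases hr : none ∈ r.1
    · have hr' : none ∉ r'.1 := by
        intro hr'
        have h1 := List.length_pos_of_mem hr
        have h2 := List.length_pos_of_mem hr'
        have := congrArg List.length hl'
        simp only [List.length_append, List.length_singleton] at this
        omega
      have xr : xs (states (rowR x.1)) = xs (states g) := by
        funext j
        have := congrArg (fun a => a.2.1) (st j)
        change (state k (x.1 j).2.err).1 = (state k (g j).err).1 + (state k (g' j).err).1 at this
        rw [(v2 j).2 hr'] at this
        exact this.trans (add_zero _)
      rw [xl, ← xr]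
      exact ha
    · have : xs (states g) = 0 := funext fun j => congrArg Prod.fst ((v1 j).2 hr)
      rw [xl, this, minPattern_zero, decodeBit_of_syndrome (Matrix.mulVec_zero _)]
      simp

theorem doubleK_map {o : Ops k} {loc : List ℕ}
    (h₁ : (unverK P N Q u).map (fun x => errs x.1) = unverified o (0 :: loc))
    (h₂ : (unverK P' N' Q' u).map (fun x => errs x.1) = unverified o (1 :: loc))
    (hG : ∀ i x, (G i x).map (fun x => (x.1.1.err, x.1.2.err)) =
      o.cnot (i.val :: 2 :: loc) (x.1.err, x.2.err)) :
    (doubleK P P' N N' Q Q' G u).map (fun x => (errs (rowL x.1), errs (rowR x.1))) =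
      (unverified o (0 :: loc)).bind fun e₁ => (unverified o (1 :: loc)).bind fun e₂ =>
        transverseCNOT o (2 :: loc) e₁ e₂ := by
  have h3 : ∀ h : Fin 7 → Cfg k × Cfg k, (trans some G h).map
      (fun x => (errs (rowL x.1), errs (rowR x.1))) =
      transverseCNOT o (2 :: loc) (errs (rowL h)) (errs (rowR h)) := by
    intro h
    have e := trans_map_errs₂ some G (fun i => o.cnot (i.val :: 2 :: loc) ((h i).1.err, (h i).2.err))
      h fun i => hG i (h i)
    change _ = (indep 7 fun i => o.cnot (i.val :: 2 :: loc) ((h i).1.err, (h i).2.err)).map _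
    rw [← e, PMF.map_comp]
    rfl
  rw [doubleK, wbind_map (h := fun y => (errs (rowL y), errs (rowR y)))]
  simp only [h3]
  rw [wbind, PMF.bind_bind, ← h₁, PMF.bind_map]
  congr 1; funext x
  rw [joinK, PMF.map_comp, PMF.bind_map, ← h₂, Function.comp, PMF.bind_map]
  rfl

end Double

end Verified

/-! ## Instrumented operations of the next level -/

section Level

variable {k : ℕ} {p : ℕ → ℝ≥0∞} {A B C : ℝ≥0∞}

/-- A gate with control and target exchanged. -/
def swapK (G : Cfg k × Cfg k → PMF ((Cfg k × Cfg k) × Bool)) (c : Cfg k × Cfg k) :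
    PMF ((Cfg k × Cfg k) × Bool) := (G c.swap).map fun x => (x.1.swap, x.2)

/-- The seven ancillas at the start of an encoder. -/
def IOps.prep (K : IOps k) (loc : List ℕ) (i : Fin 7) : PMF (Cfg k × Bool) :=
  if i = 0 ∨ i = 1 ∨ i = 3 then plusK (K.zero (i.val :: 0 :: loc)) else K.zero (i.val :: 0 :: loc)

/-- Ancillas of the next level. -/
def IOps.zero' (K : IOps k) (loc : List ℕ) : PMF (Cfg (k + 1) × Bool) :=
  zeroK (doubleK (K.prep (0 :: loc)) (K.prep (1 :: loc))
    (fun l => K.cnot (l :: 1 :: 0 :: loc)) (fun l => K.cnot (l :: 1 :: 1 :: loc))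
    (fun i => K.correct (i.val :: 2 :: 0 :: loc)) (fun i => K.correct (i.val :: 2 :: 1 :: loc))
    (fun i => K.cnot (i.val :: 2 :: loc)) fun _ => ())

/-- Rounds of error correction of the next level. -/
def IOps.round (K : IOps k) (loc : List ℕ) :
    (Fin 7 → Cfg k) → PMF ((Fin 7 → Cfg k) × Rec) :=
  roundK (fun i => K.correct (i.val :: 0 :: loc)) (plusK (K.zero' (1 :: loc))) (K.zero' (3 :: loc))
    (fun i => K.cnot (i.val :: 2 :: loc)) (fun i => swapK (K.cnot (i.val :: 4 :: loc)))

/-- Error corrections of the next level. -/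
def IOps.correct' (K : IOps k) (loc : List ℕ) : Cfg (k + 1) → PMF (Cfg (k + 1) × Bool) :=
  corrK (K.round (0 :: loc)) (K.round (1 :: loc))

/-- Instrumented operations of the next level. -/
def IOps.succ (K : IOps k) : IOps (k + 1) where
  zero := K.zero'
  correct := K.correct'
  cnot loc := cnotK (fun i => K.cnot (i.val :: 0 :: loc)) (K.correct' (1 :: loc))
    (K.correct' (2 :: loc))

theorem CnotSpec.gateSpec {F : Fin 7 → Err k × Err k → PMF (Err k × Err k)}
    {G : Fin 7 → Cfg k × Cfg k → PMF ((Cfg k × Cfg k) × Bool)} (h : ∀ i, CnotSpec (F i) (G i) p C) :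
    GateSpec G Prod.fst Prod.snd where
  valid i c x hx hf := (h i).valid c x hx hf
  state i c h₁ h₂ x hx hf := by
    have := (h i).state c h₁ h₂ x hx hf
    exact ⟨congrArg (fun a => a.1.1) this, congrArg (fun a => a.1.2) this,
      congrArg (fun a => a.2.1) this⟩

/-- Z errors travel from target to control. With the data as target and the ancilla as control, the
two parts exchange their roles. -/
theorem CnotSpec.gateSpec_swap {F : Fin 7 → Err k × Err k → PMF (Err k × Err k)}
    {G : Fin 7 → Cfg k × Cfg k → PMF ((Cfg k × Cfg k) × Bool)} (h : ∀ i, CnotSpec (F i) (G i) p C) :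
    GateSpec (fun i => swapK (G i)) Prod.snd Prod.fst where
  valid i c x hx hf := by
    obtain ⟨y, hy, rfl⟩ := (PMF.mem_support_map_iff _ _ _).1 hx
    exact ((h i).valid _ y hy hf).symm
  state i c h₁ h₂ x hx hf := by
    obtain ⟨y, hy, rfl⟩ := (PMF.mem_support_map_iff _ _ _).1 hx
    have := (h i).state c.swap h₂ h₁ y hy hf
    refine ⟨congrArg (fun a => a.2.2) this, (congrArg (fun a => a.2.1) this).trans (add_comm _ _),
      (congrArg (fun a => a.1.2) this).trans (add_comm _ _)⟩

theorem swapK_apply (G : Cfg k × Cfg k → PMF ((Cfg k × Cfg k) × Bool)) (c y : Cfg k × Cfg k)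
    (f : Bool) : swapK G c (y, f) = G c.swap (y.swap, f) := by
  rw [swapK, map_apply_E, apply_eq_E (G c.swap)]
  congr 1; funext x
  refine ind_congr ⟨fun e => ?_, fun e => ?_⟩
  · obtain ⟨rfl, rfl⟩ := Prod.mk.inj e
    rfl
  · rw [e]; rfl

theorem swapK_tw {F : Err k × Err k → PMF (Err k × Err k)}
    {G : Cfg k × Cfg k → PMF ((Cfg k × Cfg k) × Bool)} (h : CnotSpec F G p C) (c : Cfg k × Cfg k)
    (f : Bool) : PairTW p k (fun y => swapK G c (y, f)) := by
  simp only [swapK_apply]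
  exact ⟨fun y => (h.tw c.swap f).2 y, fun x => (h.tw c.swap f).1 x⟩

theorem swapK_fail {F : Err k × Err k → PMF (Err k × Err k)}
    {G : Cfg k × Cfg k → PMF ((Cfg k × Cfg k) × Bool)} (h : CnotSpec F G p C) :
    Bd (PairTW p k) (fun c => E (swapK G c) (fun y => ind (y.2 = true))) C := by
  intro m hm
  have e : ∀ φ : Cfg k × Cfg k → ℝ≥0∞, E (fun c => m c.swap) φ = E m fun c => φ c.swap :=
    E_comp_involutive Prod.swap_swap m
  have := h.fail (fun c => m c.swap) ⟨fun y => hm.2 y, fun x => hm.1 x⟩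
  rw [← E_one, e, e, E_one] at this
  simp only [swapK, E_map]
  exact this

variable {K : IOps k} {o : Ops k}

theorem IOps.Spec.prep_spec (h : K.Spec o p A B C) (loc : List ℕ) (i : Fin 7) :
    AncSpec (if i = 0 ∨ i = 1 ∨ i = 3 then o.plus (i.val :: 0 :: loc)
      else o.zero (i.val :: 0 :: loc)) (K.prep loc i) p A := by
  unfold IOps.prep
  split_ifs
  · exact (h.zero _).plus
  · exact h.zero _

theorem IOps.Spec.zero'_spec (h : K.Spec o p A B C) {e₁ e₂ : ℝ≥0∞} (he₁ : e₁ = 14 * (A + B) + 25 * C)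
    (he₂ : e₂ = 91 * (A ^ 2 + B ^ 2) + 300 * C ^ 2 + 350 * (A + B) * C + 196 * A * B)
    (h₁ : e₁ < 1) (hp : e₁ / (1 - e₁) ≤ p (k + 1) * (1 - e₂ / (1 - e₁))) (loc : List ℕ) :
    AncSpec (prepareZero o loc) (K.zero' loc) p (e₂ / (1 - e₁)) ∧
      E (K.zero' loc) (fun x => ind (tagC x.1 ≠ none)) ≤ e₁ / (1 - e₁) := by
  refine zeroK_spec ?_ h₁ hp ?_
  · rw [he₁, he₂]
    exact doubleK_spec (h.prep_spec _) (h.prep_spec _) (fun l => h.cnot _) (fun l => h.cnot _)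
      (fun i => h.correct _) (fun i => h.correct _) (fun i => h.cnot _) _
  · exact zeroK_err (doubleK_map
      (unverK_map (fun i => (h.prep_spec _ i).err) (fun l => (h.cnot _).err)
        (fun i => (h.correct _).err) _)
      (unverK_map (fun i => (h.prep_spec _ i).err) (fun l => (h.cnot _).err)
        (fun i => (h.correct _).err) _) fun i => (h.cnot _).err)

/-- The first half of a round of error correction. -/
def roundX (o : Ops k) (loc : List ℕ) (e : Err (k + 1)) : PMF (Err (k + 1)) :=
  (prepareZero o (1 :: loc)).bind fun a =>
  (transverseCNOT o (2 :: loc) e (hadamard (k + 1) a)).bind fun r =>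
  (randomCodeword (k + 1)).map fun c =>
    (show Err (k + 1) from fun i => shift k (relFlips (c.xor (xPart r.2)) i, 0) (r.1 i))

/-- The second half of a round of error correction. -/
def roundZ (o : Ops k) (loc : List ℕ) (e : Err (k + 1)) : PMF (Err (k + 1)) :=
  (prepareZero o (3 :: loc)).bind fun b =>
  (transverseCNOT o (4 :: loc) b e).bind fun r =>
  (randomCodeword (k + 1)).map fun c =>
    (show Err (k + 1) from fun i => shift k (0, relFlips (c.xor (zPart r.1)) i) (r.2 i))

theorem correctionRound_eq (o : Ops k) (loc : List ℕ) (e : Err (k + 1)) : correctionRound o loc e =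
    (transverseCorrect o (0 :: loc) e).bind fun e => (roundX o loc e).bind (roundZ o loc) := by
  simp only [correctionRound, roundX, PMF.bind_bind]
  congr 1; funext e'
  congr 1; funext a
  congr 1; funext r
  exact (PMF.bind_map (randomCodeword (k + 1)) (fun c => (show Err (k + 1) from fun i =>
    shift k (relFlips (c.xor (xPart r.2)) i, 0) (r.1 i))) (roundZ o loc)).symm

theorem IOps.Spec.round_err (h : K.Spec o p A B C) {A' : ℝ≥0∞}
    (hz : ∀ loc, AncSpec (prepareZero o loc) (K.zero' loc) p A') (loc : List ℕ)
    (g : Fin 7 → Cfg k) :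
    (K.round loc g).map (fun x => errs x.1) = correctionRound o loc (errs g) := by
  have h₁ : ∀ g, (halfK (plusK (K.zero' (1 :: loc))) (fun i => K.cnot (i.val :: 2 :: loc)) xPart
      (fun a => (a, 0)) g).map (fun x => errs x.1) = roundX o loc (errs g) := by
    intro g
    refine (halfK_map (hz (1 :: loc)).plus.err
      (F := fun i x y => o.cnot (i.val :: 2 :: loc) (x, y))
      (fun i x => (h.cnot (i.val :: 2 :: loc)).err x) g).trans ?_
    rw [roundX, PMF.bind_map]
    congr 1; funext a
    rw [transverseCNOT, PMF.bind_map]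
    rfl
  have h₂ : ∀ g, (halfK (K.zero' (3 :: loc)) (fun i => swapK (K.cnot (i.val :: 4 :: loc))) zPart
      (fun a => (0, a)) g).map (fun x => errs x.1) = roundZ o loc (errs g) := by
    intro g
    refine (halfK_map (hz (3 :: loc)).err
      (F := fun i x y => (o.cnot (i.val :: 4 :: loc) (y, x)).map Prod.swap)
      (fun i x => by
        have e := (h.cnot (i.val :: 4 :: loc)).err x.swap
        change _ = PMF.map Prod.swap (o.cnot _ (x.swap.1.err, x.swap.2.err))
        rw [← e, swapK, PMF.map_comp, PMF.map_comp]
        rfl) g).trans ?_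
    rw [roundZ]
    congr 1; funext a
    rw [transverseCNOT, PMF.bind_map, ← indep_map 7 _ (Prod.swap : Err k × Err k → Err k × Err k),
      PMF.bind_map]
    rfl
  rw [correctionRound_eq]
  exact roundK_map (fun i c => (h.correct (i.val :: 0 :: loc)).err c) h₁ h₂ g

theorem IOps.Spec.round_spec (h : K.Spec o p A B C) {A' a : ℝ≥0∞}
    (hz : ∀ loc, AncSpec (prepareZero o loc) (K.zero' loc) p A')
    (ha : ∀ loc, E (K.zero' loc) (fun x => ind (tagC x.1 ≠ none)) ≤ a) (loc : List ℕ) :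
    RoundSpec (correctionRound o loc) (K.round loc) p (7 * B + (a + 7 * C) + (a + 7 * C))
      (21 * B ^ 2 + (21 * C ^ 2 + a * (7 * C)) + 7 * B * (a + 7 * C) +
        (21 * C ^ 2 + a * (7 * C)) + (7 * B + (a + 7 * C)) * (a + 7 * C)) (A' + A') :=
  roundK_spec (h.round_err hz loc) (fun i => h.correct _) (hz _).plus (hz _)
    (by rw [plusK, E_map]; exact ha _) (ha _) (CnotSpec.gateSpec fun i => h.cnot _)
    (CnotSpec.gateSpec_swap fun i => h.cnot (i.val :: 4 :: loc)) (fun i x f => (h.cnot _).tw x f)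
    (fun i x f => swapK_tw (h.cnot _) x f) (fun i => (h.cnot _).fail)
    fun i => swapK_fail (h.cnot _)

/-- For a tagged input one fault suffices. The tag is given here rather than random, so no factor `p
(k + 1)` appears. -/
theorem corrK_corrFail {R₁ R₂ : (Fin 7 → Cfg k) → PMF ((Fin 7 → Cfg k) × Rec)}
    {F₁ F₂ : Err (k + 1) → PMF (Err (k + 1))} {e₁ e₂ eA : ℝ≥0∞}
    (h₁ : RoundSpec F₁ R₁ p e₁ e₂ eA) (h₂ : RoundSpec F₂ R₂ p e₁ e₂ eA) :
    CorrFail (corrK R₁ R₂) p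
      (fun g => E (wbind (R₁ g) R₂) (fun x => ind (2 ≤ x.2.1.length)) +
        E (wbind (R₁ g) R₂) (fun x => ind (x.2.2 = true)))
      (fun g => E (wbind (R₁ g) R₂) (fun x => ind (1 ≤ x.2.1.length)) +
        E (wbind (R₁ g) R₂) (fun x => ind (x.2.2 = true)))
      ((e₂ + e₂ + e₁ * e₁) + (eA + eA)) ((e₁ + e₁) + (eA + eA)) := by
  have hr := h₁.rates.comp (L := R₂) (J := Inv (TW p k)) (fun m hm r =>
    Inv.isCone (TW.isCone k) _ _ _ fun g => h₁.pres g r) h₂.rates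
  exact ⟨fun g => corrK_fail_none rfl, fun t g => corrK_fail_some _, hr.two.add hr.anc,
    hr.one.add hr.anc⟩

/-- `s` and `t` are the one-fault and two-fault rates of a round. `hsp` is the self-consistency
condition for tags on corrected blocks, and `hp` the one for ancillas. -/
theorem IOps.Spec.succ_spec (h : K.Spec o p A B C) {N : Noise} (ho : ops N k = o)
    {e₁ e₂ A' a s t : ℝ≥0∞} (he₁ : e₁ = 14 * (A + B) + 25 * C)
    (he₂ : e₂ = 91 * (A ^ 2 + B ^ 2) + 300 * C ^ 2 + 350 * (A + B) * C + 196 * A * B)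
    (h₁ : e₁ < 1) (hA' : A' = e₂ / (1 - e₁)) (ha : e₁ / (1 - e₁) ≤ a)
    (hp : e₁ / (1 - e₁) ≤ p (k + 1) * (1 - A'))
    (hs : s = 7 * B + 2 * a + 14 * C)
    (ht : t = 21 * B ^ 2 + a ^ 2 + 91 * C ^ 2 + 28 * a * C + 14 * B * a + 98 * B * C)
    (hsp : s + p (k + 1) * (s + 2 * A') ≤ p (k + 1)) (hfin : p (k + 1) * (s + 2 * A') ≠ ⊤) :
    K.succ.Spec (ops N (k + 1)) p A' (2 * t + s ^ 2 + 4 * A' + 2 * s * p (k + 1))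
      ((p (k + 1) ^ 2 + 14 * C * p (k + 1) + 21 * C ^ 2) + (2 * p (k + 1) + 7 * C) *
        (2 * (2 * s + 4 * A')) + 2 * (2 * t + s ^ 2 + 4 * A')) := by
  subst ho
  have hz : ∀ loc, AncSpec (prepareZero (ops N k) loc) (K.zero' loc) p A' := fun loc => by
    rw [hA'] at hp ⊢
    exact (h.zero'_spec he₁ he₂ h₁ hp loc).1
  have hr := h.round_spec hz (a := a) fun loc => by
    rw [hA'] at hp
    exact (h.zero'_spec he₁ he₂ h₁ hp loc).2.trans ha
  have q1 : 7 * B + (a + 7 * C) + (a + 7 * C) = s := by rw [hs]; ring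
  have q2 : 21 * B ^ 2 + (21 * C ^ 2 + a * (7 * C)) + 7 * B * (a + 7 * C) +
        (21 * C ^ 2 + a * (7 * C)) + (7 * B + (a + 7 * C)) * (a + 7 * C) = t := by rw [ht]; ring
  rw [q1, q2] at hr
  have hc : ∀ loc, CorrSpec (correction (ops N k) loc) (K.correct' loc) p
      (2 * t + s ^ 2 + 4 * A' + 2 * s * p (k + 1)) := fun loc => by
    have := corrK_spec (hr (0 :: loc)) (hr (1 :: loc)) (by rwa [← two_mul A']) (by rwa [← two_mul A'])
    have e : (t + t + s * s) + (A' + A' + (A' + A')) + (s + s) * p (k + 1) =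
      2 * t + s ^ 2 + 4 * A' + 2 * s * p (k + 1) := by ring
    rw [e] at this
    exact this
  have hf : ∀ loc, CorrFail (K.correct' loc) p _ _ _ _ := fun loc =>
    corrK_corrFail (hr (0 :: loc)) (hr (1 :: loc))
  refine ⟨hz, hc, fun loc => ?_⟩
  have hG := fun i : Fin 7 => h.cnot (i.val :: 0 :: loc)
  refine ⟨fun c => ?_, fun c f => cnotK_tw (hc _) (hc _) c f, ?_,
    fun c x hx hf => cnotK_valid (hc _) (hc _) c x hx hf,
    fun c h₁ h₂ x hx hf => cnotK_state hG (hc _) (hc _) c h₁ h₂ x hx hf⟩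
  · refine (cnotK_err hG (hc _) (hc _) c).trans ?_
    change _ = encodedCNOT (ops N k) loc (c.1.err, c.2.err)
    rw [encodedCNOT, transverseCNOT, PMF.bind_map]
    rfl
  · refine (cnotK_fail hG (hf (1 :: loc)) (hf (2 :: loc))).mono (fun _ => le_rfl) (le_of_eq ?_)
    ring

/-- Instrumented operations of level `0`. -/
def IOps.base (N : Noise) : IOps 0 where
  zero _ := PMF.pure (noError 0, false)
  correct _ c := PMF.pure (c, false)
  cnot loc c := (coin N.p N.p_le_one).bind fun fails =>
    if fails then (N.q loc).map fun d => (propagate (c.1.err, c.2.err) + d, true)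
    else PMF.pure (propagate (c.1.err, c.2.err), false)

/-- Qubits carry no tags, and the flag is the coin itself; a failure that applies the identity is
flagged as well. -/
theorem IOps.base_spec (N : Noise) (p : ℕ → ℝ≥0∞) : (IOps.base N).Spec (ops N 0) p 0 0 N.p where
  zero loc := ⟨PMF.pure_map _ _, fun _ => trivial, by simp [IOps.base, E_pure, ind],
    fun _ _ _ => trivial, fun x hx _ => by
      rw [(PMF.mem_support_pure_iff _ _).1 hx]; rfl⟩
  correct loc := ⟨fun c => PMF.pure_map _ _, fun _ _ => trivial, fun m _ => by
      simp [IOps.base, E_pure, ind, E_zero], fun _ _ _ _ => trivial, fun c _ x hx _ => by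
      rw [(PMF.mem_support_pure_iff _ _).1 hx]⟩
  cnot loc := by
    refine ⟨fun c => ?_, fun _ _ => ⟨fun _ => trivial, fun _ => trivial⟩, fun m _ => ?_,
      fun _ _ _ _ => ⟨trivial, trivial⟩, fun c _ _ x hx hf => ?_⟩
    · change _ = physicalCNOT N loc (c.1.err, c.2.err)
      rw [physicalCNOT, IOps.base, PMF.map_bind]
      congr 1; funext b
      rcases b
      · exact PMF.pure_map _ _
      · exact PMF.map_comp _ _ _
    · rw [← E_const]
      refine E_mono fun c => le_of_eq ?_
      rw [IOps.base, E_bind, E, tsum_bool]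
      simp [E_pure, E_map, ind, E_const, mass_pmf, coin]
    · obtain ⟨b, -, hb⟩ := (PMF.mem_support_bind_iff _ _ _).1 hx
      rcases b
      · rw [(PMF.mem_support_pure_iff _ _).1 hb]; rfl
      · obtain ⟨d, -, rfl⟩ := (PMF.mem_support_map_iff _ _ _).1 hb
        simp at hf

end Level

/-! ## The recursion for the parameters -/

section Parameters

variable {p : ℝ} {k : ℕ}

/-- The recursion in polynomial form. -/
structure LevelRel (A₀ B₀ C₀ n A a b B C : ℝ) : Prop where
  n_pos : 0 < n
  n_eq : 14 * (A₀ + B₀) + 25 * C₀ + n = 1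
  A_nonneg : 0 ≤ A
  A_lt_one : A < 1
  A_eq : A * n = 91 * (A₀ ^ 2 + B₀ ^ 2) + 300 * C₀ ^ 2 + 350 * (A₀ + B₀) * C₀ + 196 * A₀ * B₀
  a_nonneg : 0 ≤ a
  a_eq : a * ((1 - A) * n) = 14 * (A₀ + B₀) + 25 * C₀
  b_nonneg : 0 ≤ b
  a_le_b : a ≤ b
  b_eq : b = (4 * a + 14 * B₀ + 28 * C₀) + b * (4 * A + (4 * a + 14 * B₀ + 28 * C₀))
  B_eq : B = 2 * (21 * B₀ ^ 2 + a ^ 2 + 91 * C₀ ^ 2 + 28 * a * C₀ + 14 * B₀ * a + 98 * B₀ * C₀) +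
    (7 * B₀ + 2 * a + 14 * C₀) ^ 2 + 4 * A + 2 * (7 * B₀ + 2 * a + 14 * C₀) * b
  C_eq : C = (b ^ 2 + 14 * C₀ * b + 21 * C₀ ^ 2) + (2 * b + 7 * C₀) *
    (2 * (2 * (7 * B₀ + 2 * a + 14 * C₀) + 4 * A)) + 2 * B

/-- Once the denominators are cleared, the relations involve no subtraction except in `1 - A` and
can be transferred to `ℝ≥0∞`. -/
theorem rates_levelRel (hr : (rates p (k + 1)).InRange) (hA : 0 ≤ (rates p k).A)
    (hB : 0 ≤ (rates p k).B) (hC : 0 ≤ (rates p k).C) :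
    LevelRel (rates p k).A (rates p k).B (rates p k).C (rates p (k + 1)).accept
      (rates p (k + 1)).A (rates p (k + 1)).a (rates p (k + 1)).b (rates p (k + 1)).B
      (rates p (k + 1)).C := by
  obtain ⟨h1, h2, -, h3, -⟩ := hr
  set r := rates p (k + 1) with hr
  generalize hA₀ : (rates p k).A = A₀ at *
  generalize hB₀ : (rates p k).B = B₀ at *
  generalize hC₀ : (rates p k).C = C₀ at *
  have c1 : Nat.choose 14 2 = 91 := by decide
  have c2 : Nat.choose 25 2 = 300 := by decide
  have c3 : Nat.choose 28 2 = 378 := by decide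
  have c4 : Nat.choose 4 2 = 6 := by decide
  have c5 : Nat.choose 7 2 = 21 := by decide
  have en : r.accept = 1 - 2 * 7 * A₀ - 2 * 7 * B₀ - (2 * 9 + 7) * C₀ := by
    rw [hr, rates, hA₀, hB₀, hC₀]
  have eA : r.A = (91 * (A₀ ^ 2 + B₀ ^ 2) + 300 * C₀ ^ 2 + 350 * (A₀ + B₀) * C₀ +
      196 * A₀ * B₀) / r.accept := by
    rw [hr, rates, hA₀, hB₀, hC₀, c1, c2]
    push_cast
    congr 1; ring
  have ea : r.a = (14 * (A₀ + B₀) + 25 * C₀) / ((1 - r.A) * r.accept) := by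
    rw [hr, rates, hA₀, hB₀, hC₀]
    ring
  have eB' : r.B' = 4 * r.A + (4 * r.a + 14 * B₀ + 28 * C₀) := by
    rw [hr, rates, hA₀, hB₀, hC₀]
    ring
  have eb : r.b = (4 * r.a + 14 * B₀ + 28 * C₀) / (1 - r.B') := by
    rw [hr, rates, hA₀, hB₀, hC₀]
    ring
  have eB : r.B = 4 * r.A + 378 * C₀ ^ 2 + 6 * r.a ^ 2 + 91 * B₀ ^ 2 +
      r.b * (28 * C₀ + 4 * r.a + 14 * B₀) + 28 * C₀ * (4 * r.a + 14 * B₀) + 56 * r.a * B₀ := by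
    rw [hr, rates, hA₀, hB₀, hC₀, c1, c3, c4]
    push_cast
    ring
  have eC : r.C = (2 * r.B + 14 * C₀ * r.B' + 21 * C₀ ^ 2) + 2 * r.b * (2 * r.B' + 7 * C₀) +
      r.b ^ 2 := by
    rw [hr, rates, hA₀, hB₀, hC₀, c5]
    push_cast
    ring
  have nA : 0 ≤ r.A := by rw [eA]; positivity
  have pA : 0 < 1 - r.A := by linarith
  have na : 0 ≤ r.a := by rw [ea]; positivity
  have pB : 0 < 1 - r.B' := by linarith
  have nb : 0 ≤ r.b := by rw [eb]; positivity
  have hb : r.b * (1 - r.B') = 4 * r.a + 14 * B₀ + 28 * C₀ := by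
    rw [eb]; exact div_mul_cancel₀ _ pB.ne'
  have hB' : 0 ≤ r.B' := by rw [eB']; positivity
  refine ⟨h1, by rw [en]; ring, nA, h2, ?_, na, ?_, nb, ?_, ?_, ?_, ?_⟩
  · rw [eA]; exact div_mul_cancel₀ _ h1.ne'
  · rw [ea]; exact div_mul_cancel₀ _ (mul_pos pA h1).ne'
  -- `a ≤ 4 * a + 14 * B₀ + 28 * C₀ = b * (1 - B') ≤ b`.
  · nlinarith [mul_nonneg nb hB']
  · rw [← eB']; linarith
  · rw [eB]; ring
  · rw [eC, eB']; ring

theorem LevelRel.nonneg {A₀ B₀ C₀ n A a b B C : ℝ} (h : LevelRel A₀ B₀ C₀ n A a b B C)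
    (hB : 0 ≤ B₀) (hC : 0 ≤ C₀) : 0 ≤ A ∧ 0 ≤ B ∧ 0 ≤ C := by
  have h1 := h.A_nonneg
  have h2 := h.a_nonneg
  have h3 := h.b_nonneg
  have h4 : 0 ≤ B := by rw [h.B_eq]; positivity
  exact ⟨h1, h4, by rw [h.C_eq]; positivity⟩

theorem rates_nonneg (hp : 0 ≤ p) : ∀ k, (∀ j, 1 ≤ j → j ≤ k → (rates p j).InRange) →
    0 ≤ (rates p k).A ∧ 0 ≤ (rates p k).B ∧ 0 ≤ (rates p k).C
  | 0, _ => ⟨le_rfl, le_rfl, hp⟩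
  | k + 1, h => by
    obtain ⟨h1, h2, h3⟩ := rates_nonneg hp k fun j hj hj' => h j hj (by omega)
    exact (rates_levelRel (h (k + 1) (by omega) le_rfl) h1 h2 h3).nonneg h2 h3

theorem rates_b_nonneg (hp : 0 ≤ p) (h : ∀ j, 1 ≤ j → j ≤ k → (rates p j).InRange) {j : ℕ}
    (hj : j ≤ k) : 0 ≤ (rates p j).b := by
  rcases j with _ | j
  · exact le_rfl
  · obtain ⟨h1, h2, h3⟩ := rates_nonneg hp j fun i hi hi' => h i hi (by omega)
    exact (rates_levelRel (h (j + 1) (by omega) hj) h1 h2 h3).b_nonneg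

end Parameters

theorem IOps.Spec.succ {k : ℕ} {K : IOps k} {N : Noise} {q : ℕ → ℝ≥0∞} {A₀ B₀ C₀ n A a b B C : ℝ≥0}
    (h : K.Spec (ops N k) q A₀ B₀ C₀) (hq : q (k + 1) = b)
    (hr : LevelRel A₀ B₀ C₀ n A a b B C) : K.succ.Spec (ops N (k + 1)) q A B C := by
  have hn : ((14 * (A₀ + B₀) + 25 * C₀ : ℝ≥0) : ℝ≥0∞) + n = 1 := by
    exact_mod_cast hr.n_eq
  have hA : (A : ℝ≥0∞) * n = ((91 * (A₀ ^ 2 + B₀ ^ 2) + 300 * C₀ ^ 2 + 350 * (A₀ + B₀) * C₀ +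
      196 * A₀ * B₀ : ℝ≥0) : ℝ≥0∞) := by
    exact_mod_cast hr.A_eq
  have hn0 : (n : ℝ≥0∞) ≠ 0 := by exact_mod_cast hr.n_pos.ne'
  obtain ⟨m, hm⟩ : ∃ m : ℝ≥0, (m : ℝ) = 1 - A := ⟨⟨1 - A, by linarith [hr.A_lt_one]⟩, rfl⟩
  have hmA : (m : ℝ≥0∞) + A = 1 := by
    have : (m : ℝ) + A = 1 := by linarith
    exact_mod_cast this
  have s1 : 1 - ((14 * (A₀ + B₀) + 25 * C₀ : ℝ≥0) : ℝ≥0∞) = n :=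
    ENNReal.sub_eq_of_eq_add_rev ENNReal.coe_ne_top hn.symm
  have s2 : 1 - (A : ℝ≥0∞) = m := ENNReal.sub_eq_of_eq_add ENNReal.coe_ne_top hmA.symm
  have ha : (a : ℝ≥0∞) * (m * n) = ((14 * (A₀ + B₀) + 25 * C₀ : ℝ≥0) : ℝ≥0∞) := by
    have := hr.a_eq
    rw [← hm] at this
    exact_mod_cast this
  have hb : (7 * B₀ + 2 * a + 14 * C₀ : ℝ≥0∞) + b * ((7 * B₀ + 2 * a + 14 * C₀) + 2 * A) ≤ b := by
    have h1 := hr.b_eq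
    have h2 := hr.b_nonneg
    -- Half of `b_eq`: the left side equals `b / 2`, because `b` is defined with the one-fault rate
    -- of two rounds while the tag needs that of one.
    have : (7 * B₀ + 2 * a + 14 * C₀ : ℝ) + b * ((7 * B₀ + 2 * a + 14 * C₀) + 2 * A) ≤ b := by
      nlinarith
    exact_mod_cast this
  have hab : (a : ℝ≥0∞) ≤ b := by exact_mod_cast hr.a_le_b
  have hm1 : (m : ℝ≥0∞) ≤ 1 := by rw [← s2]; exact tsub_le_self
  have := IOps.Spec.succ_spec h rfl (a := a) (A' := A)
    (e₁ := ((14 * (A₀ + B₀) + 25 * C₀ : ℝ≥0) : ℝ≥0∞))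
    (e₂ := ((91 * (A₀ ^ 2 + B₀ ^ 2) + 300 * C₀ ^ 2 + 350 * (A₀ + B₀) * C₀ +
      196 * A₀ * B₀ : ℝ≥0) : ℝ≥0∞)) (by push_cast; rfl) (by push_cast; rfl)
    (by
      rw [← hn]
      exact ENNReal.lt_add_right ENNReal.coe_ne_top hn0)
    (by rw [s1, ← hA, ENNReal.mul_div_cancel_right hn0 ENNReal.coe_ne_top])
    (by
      rw [s1, ← ha]
      refine ENNReal.div_le_of_le_mul ?_
      exact mul_le_mul_right (mul_le_of_le_one_left' hm1) _)
    (by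
      rw [s1, s2, hq, ← ha]
      refine ENNReal.div_le_of_le_mul ?_
      rw [mul_assoc]
      exact mul_le_mul_left hab _)
    rfl rfl (by rw [hq]; exact hb) (by rw [hq]; exact ENNReal.coe_ne_top)
  rw [hq] at this
  refine ⟨this.zero, fun loc => ?_, fun loc => ?_⟩
  · have e : (B : ℝ≥0∞) = 2 * (21 * B₀ ^ 2 + a ^ 2 + 91 * C₀ ^ 2 + 28 * a * C₀ + 14 * B₀ * a +
        98 * B₀ * C₀) + (7 * B₀ + 2 * a + 14 * C₀) ^ 2 + 4 * A +
        2 * (7 * B₀ + 2 * a + 14 * C₀) * b := by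
      exact_mod_cast hr.B_eq
    rw [e]
    exact this.correct loc
  · have hc := this.cnot loc
    refine ⟨hc.err, hc.tw, hc.fail.mono (fun _ => le_rfl) ?_, hc.valid, hc.state⟩
    have e : (C : ℝ≥0∞) = (b ^ 2 + 14 * C₀ * b + 21 * C₀ ^ 2) + (2 * b + 7 * C₀) *
        (2 * (2 * (7 * B₀ + 2 * a + 14 * C₀) + 4 * A)) + 2 * B := by
      exact_mod_cast hr.C_eq
    have e' : (B : ℝ≥0∞) = 2 * (21 * B₀ ^ 2 + a ^ 2 + 91 * C₀ ^ 2 + 28 * a * C₀ + 14 * B₀ * a +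
        98 * B₀ * C₀) + (7 * B₀ + 2 * a + 14 * C₀) ^ 2 + 4 * A +
        2 * (7 * B₀ + 2 * a + 14 * C₀) * b := by
      exact_mod_cast hr.B_eq
    rw [e, e']
    -- An untagged correction has the smaller failure bound, without the last term of `B`.
    exact add_le_add_right (mul_le_mul_right le_self_add _) _

theorem exists_iops (N : Noise) : ∀ k, (∀ j, 1 ≤ j → j ≤ k → (rates N.p j).InRange) →
    ∃ K : IOps k, K.Spec (ops N k) (fun j => ENNReal.ofReal (rates N.p j).b)
      (ENNReal.ofReal (rates N.p k).A) (ENNReal.ofReal (rates N.p k).B)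
      (ENNReal.ofReal (rates N.p k).C)
  | 0, _ => ⟨IOps.base N, by
      have := IOps.base_spec N fun j => ENNReal.ofReal (rates N.p j).b
      simpa [rates] using this⟩
  | k + 1, h => by
    have h' : ∀ j, 1 ≤ j → j ≤ k → (rates N.p j).InRange := fun j hj hj' => h j hj (by omega)
    obtain ⟨K, hK⟩ := exists_iops N k h'
    obtain ⟨h1, h2, h3⟩ := rates_nonneg N.p.coe_nonneg k h'
    have hr := rates_levelRel (h (k + 1) (by omega) le_rfl) h1 h2 h3
    obtain ⟨h4, h5, h6⟩ := hr.nonneg h2 h3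
    rw [ENNReal.ofReal_eq_coe_nnreal h1, ENNReal.ofReal_eq_coe_nnreal h2,
      ENNReal.ofReal_eq_coe_nnreal h3] at hK
    rw [ENNReal.ofReal_eq_coe_nnreal h4, ENNReal.ofReal_eq_coe_nnreal h5,
      ENNReal.ofReal_eq_coe_nnreal h6]
    exact ⟨K.succ, IOps.Spec.succ (A₀ := ⟨_, h1⟩) (B₀ := ⟨_, h2⟩) (C₀ := ⟨_, h3⟩)
      (n := ⟨_, hr.n_pos.le⟩) (A := ⟨_, h4⟩) (a := ⟨_, hr.a_nonneg⟩) (b := ⟨_, hr.b_nonneg⟩)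
      (B := ⟨_, h5⟩) (C := ⟨_, h6⟩) hK
      (ENNReal.ofReal_eq_coe_nnreal hr.b_nonneg) hr⟩

/-! ## Wellness and tag-wellness -/

section Wellness

variable {Ω : Type u} {W : Type v} {μ : PMF Ω} {p : ℕ → ℝ} {k : ℕ}

theorem E_pmf_ne_top (S : Ω → Prop) : E μ (fun ω => ind (S ω)) ≠ ⊤ :=
  ((E_ind_le μ S).trans_eq (mass_pmf μ)).trans_lt ENNReal.one_lt_top |>.ne

theorem prob_eq (S : Set Ω) : prob μ S = (E μ fun ω => ind (ω ∈ S)).toReal := by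
  classical
  rw [prob, PMF.toOuterMeasure_apply]
  congr 1
  refine tsum_congr fun ω => ?_
  by_cases h : ω ∈ S <;> simp [ind, h]

theorem prob_le_iff {S T : Set Ω} {a : ℝ} (ha : 0 ≤ a) : prob μ S ≤ a * prob μ T ↔
    E μ (fun ω => ind (ω ∈ S)) ≤ ENNReal.ofReal a * E μ (fun ω => ind (ω ∈ T)) := by
  rw [prob_eq, prob_eq, ← ENNReal.toReal_ofReal ha, ← ENNReal.toReal_mul, ENNReal.toReal_le_toReal
    (E_pmf_ne_top _) (ENNReal.mul_ne_top ENNReal.ofReal_ne_top (E_pmf_ne_top _)),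
    ENNReal.ofReal_toReal ENNReal.ofReal_ne_top]

/-- The law of `X` on the event `D` when `env` takes the value `x`. -/
def law {β : Type} (μ : PMF Ω) (D : Set Ω) (X : Ω → β) (env : Ω → W) (x : W) (c : β) : ℝ≥0∞ :=
  E μ fun ω => ind (ω ∈ D ∧ X ω = c ∧ env ω = x)

theorem E_law {β : Type} (D : Set Ω) (X : Ω → β) (env : Ω → W) (x : W) (φ : β → ℝ≥0∞) :
    E (law μ D X env x) φ = E μ fun ω => ind (ω ∈ D ∧ env ω = x) * φ (X ω) := by
  simp only [E, law, ← ENNReal.tsum_mul_right]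
  rw [ENNReal.tsum_comm]
  refine tsum_congr fun ω => ?_
  rw [tsum_eq_single (X ω)]
  · have : (ω ∈ D ∧ X ω = X ω ∧ env ω = x) ↔ (ω ∈ D ∧ env ω = x) := by tauto
    rw [ind_congr this, mul_assoc]
  · intro c hc
    rw [ind_false fun h => hc h.2.1.symm]
    simp

theorem E_fiber {R : Type w} (F : Ω → R) (Q : R → Prop) (S : Ω → Prop) :
    E μ (fun ω => ind (S ω ∧ Q (F ω))) = ∑' r, ind (Q r) * E μ (fun ω => ind (S ω ∧ F ω = r)) := by
  simp only [E, ← ENNReal.tsum_mul_left]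
  rw [ENNReal.tsum_comm]
  refine tsum_congr fun ω => ?_
  rw [tsum_eq_single (F ω)]
  · simp only [and_true, ind_and]; ring
  · intro r hr
    rw [ind_false (P := S ω ∧ F ω = r) fun h => hr h.2.symm]
    simp

/-- The law of a subblock given `env`, the tag and the siblings is a section of the law of the
block, which the second clause of `TW` covers. If the tag is the subblock itself, the law is zero on
the event considered. -/
theorem well_of_tw : ∀ (k : ℕ) {W : Type v} (D : Set Ω) (X : Ω → Cfg k) (env : Ω → W),
    (∀ j, 1 ≤ j → j ≤ k → 0 ≤ p j) →
    (∀ x, TW (fun j => ENNReal.ofReal (p j)) k (law μ D X env x)) →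
    (∀ ω ∈ μ.support, ω ∈ D → Valid k (X ω)) → Well μ p k D X env
  | 0, _, _, _, _, _, _, _ => trivial
  | k + 1, W, D, X, env, hp, h, hv => by
    refine ⟨fun ω hω hD i hi => (hv ω hω hD i hi).1, fun s x => ?_, fun i => ?_⟩
    · rw [prob_le_iff (hp (k + 1) (by omega) le_rfl)]
      have h1 := (h x).1 s
      rw [E_law, E_law] at h1
      refine (le_of_eq ?_).trans (h1.trans_eq ?_)
      · congr 1; funext ω
        rw [← ind_and]
        exact ind_congr ⟨fun ⟨a, b, c, d⟩ => ⟨⟨a, c⟩, b, d⟩, fun ⟨⟨a, c⟩, b, d⟩ => ⟨a, b, c, d⟩⟩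
      · congr 2; funext ω
        rw [← ind_and]
        exact ind_congr ⟨fun ⟨⟨a, c⟩, b⟩ => ⟨a, b, c⟩, fun ⟨a, b, c⟩ => ⟨⟨a, c⟩, b⟩⟩
    · refine well_of_tw k _ _ _ (fun j h1 h2 => hp j h1 (by omega)) ?_
        fun ω hω hD => (hv ω hω hD.1 i hD.2).2
      rintro ⟨x, t, r⟩
      by_cases ht : t = some i
      · have : law μ {ω | ω ∈ D ∧ (X ω).1 ≠ some i} (fun ω => (X ω).2 i)
            (fun ω => (env ω, (X ω).1, fun j : {j : Fin 7 // j ≠ i} => (X ω).2 j)) (x, t, r) =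
            fun _ => 0 := by
          funext c
          rw [law, ← E_zero μ]
          congr 1; funext ω
          rw [ind_false]
          rintro ⟨⟨-, h1⟩, -, h2⟩
          exact h1 ((congrArg (fun a => a.2.1) h2).trans ht)
        rw [this]
        exact TW.zero k
      · let g : Fin 7 → Cfg k := fun j => if hj : j ≠ i then r ⟨j, hj⟩ else untag k (noError k)
        have : law μ {ω | ω ∈ D ∧ (X ω).1 ≠ some i} (fun ω => (X ω).2 i)
            (fun ω => (env ω, (X ω).1, fun j : {j : Fin 7 // j ≠ i} => (X ω).2 j)) (x, t, r) =
            fun c => law μ D X env x (mkC t (Function.update g i c)) := by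
          funext c
          rw [law, law]
          congr 1; funext ω
          refine ind_congr ⟨?_, ?_⟩
          · rintro ⟨⟨h1, -⟩, h3, h4⟩
            refine ⟨h1, ?_, congrArg Prod.fst h4⟩
            refine Prod.ext (congrArg (fun a => a.2.1) h4) ?_
            funext j
            change (X ω).2 j = Function.update g i c j
            by_cases hj : j = i
            · subst hj; simpa using h3
            · rw [Function.update_of_ne hj]
              have := congrFun (congrArg (fun a => a.2.2) h4) ⟨j, hj⟩
              simpa [g, hj] using this
          · rintro ⟨h1, h2, h3⟩
            have h4 : (X ω).1 = t := congrArg tagC h2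
            have h5 : (X ω).2 = Function.update g i c := congrArg subC h2
            refine ⟨⟨h1, by rw [h4]; exact ht⟩, by simp [h5], ?_⟩
            refine Prod.ext h3 (Prod.ext h4 ?_)
            funext j
            change (X ω).2 j.1 = r j
            rw [h5, Function.update_of_ne j.2]
            simp [g, j.2]
        rw [this]
        exact (h x).2 t i g

/-- Tags inside of uncontrolled subblocks are removed. -/
def stripTags : (k : ℕ) → Cfg k → Cfg k
  | 0, c => c
  | k + 1, c => mkC (tagC c) fun j =>
      if tagC c = some j then untag k (subC c j).err else stripTags k (subC c j)

theorem stripTags_err : ∀ (k : ℕ) (c : Cfg k), (stripTags k c).err = c.err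
  | 0, _ => rfl
  | k + 1, c => by
    funext j
    change (if tagC c = some j then untag k (subC c j).err else stripTags k (subC c j)).err =
      (subC c j).err
    split_ifs
    · exact untag_err _ _
    · exact stripTags_err k _

theorem valid_stripTags : ∀ (k : ℕ) {c : Cfg k}, Valid k c → Valid k (stripTags k c)
  | 0, _, _ => trivial
  | k + 1, c, h => fun i hi => by
    obtain ⟨h1, h2⟩ := h i hi
    refine ⟨by rw [stripTags_err]; exact h1, ?_⟩
    change Valid k (if tagC c = some i then untag k (subC c i).err else stripTags k (subC c i))
    have hi' : tagC c ≠ some i := hi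
    rw [if_neg hi']
    exact valid_stripTags k h2

theorem Well.valid : ∀ {k : ℕ} {W : Type v} {D : Set Ω} {X : Ω → Cfg k} {env : Ω → W},
    Well μ p k D X env → ∀ ω ∈ μ.support, ω ∈ D → Valid k (X ω)
  | 0, _, _, _, _, _ => fun _ _ _ => trivial
  | _ + 1, _, _, _, _, h => fun ω hω hD i hi => ⟨h.1 ω hω hD i hi, (h.2.2 i).valid ω hω ⟨hD, hi⟩⟩

/-- `Well` says nothing about the inside of an uncontrolled subblock, while `TW` constrains every
section; hence the inner tags are erased there. Elsewhere, fixing the stripped siblings amounts to a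
sum over the original ones, and `TW` passes to sums. -/
theorem Well.tw : ∀ {k : ℕ} {W : Type v} {D : Set Ω} {X : Ω → Cfg k} {env : Ω → W},
    (∀ j, 1 ≤ j → j ≤ k → 0 ≤ p j) → Well μ p k D X env → ∀ x,
    TW (fun j => ENNReal.ofReal (p j)) k (law μ D (fun ω => stripTags k (X ω)) env x)
  | 0, _, _, _, _, _, _ => fun _ => trivial
  | k + 1, W, D, X, env, hp, h => fun x => by
    refine ⟨fun s => ?_, fun t i g => ?_⟩
    · have h1 := h.2.1 s x
      rw [prob_le_iff (hp (k + 1) (by omega) le_rfl)] at h1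
      rw [E_law, E_law]
      simp only [stripTags_err]
      refine (le_of_eq ?_).trans (h1.trans_eq ?_)
      · congr 1; funext ω
        rw [← ind_and]
        exact ind_congr ⟨fun ⟨⟨a, c⟩, b, d⟩ => ⟨a, b, c, d⟩, fun ⟨a, b, c, d⟩ => ⟨⟨a, c⟩, b, d⟩⟩
      · congr 2; funext ω
        rw [← ind_and]
        exact ind_congr ⟨fun ⟨a, b, c⟩ => ⟨⟨a, c⟩, b⟩, fun ⟨⟨a, c⟩, b⟩ => ⟨a, b, c⟩⟩
    · by_cases ht : t = some i
      · refine TW.of_untagged fun c hc => ?_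
        rw [law, E, ne_eq, ENNReal.tsum_eq_zero, not_forall] at hc
        obtain ⟨ω, hω⟩ := hc
        have hω' : stripTags (k + 1) (X ω) = mkC t (Function.update g i c) := by
          by_contra hne
          exact hω (by rw [ind_false fun h => hne h.2.1, mul_zero])
        have h1 : tagC (X ω) = t := congrArg tagC hω'
        have h2 := congrFun (congrArg subC hω') i
        change (if tagC (X ω) = some i then untag k (subC (X ω) i).err else stripTags k (subC (X ω) i)) =
          Function.update g i c i at h2
        rw [if_pos (h1.trans ht), Function.update_self] at h2
        rw [← h2, untag_err]
      · let f : Fin 7 → Cfg k → Cfg k := fun j c => if t = some j then untag k c.err else stripTags k c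
        let Q : Option (Fin 7) × ({j : Fin 7 // j ≠ i} → Cfg k) → Prop := fun y =>
          y.1 = t ∧ ∀ j, f j.1 (y.2 j) = g j.1
        have e : (fun c => law μ D (fun ω => stripTags (k + 1) (X ω)) env x
            (mkC t (Function.update g i c))) = fun c => ∑' y, ind (Q y) *
            law μ {ω | ω ∈ D ∧ (X ω).1 ≠ some i} (fun ω => stripTags k ((X ω).2 i))
            (fun ω => (env ω, (X ω).1, fun j : {j : Fin 7 // j ≠ i} => (X ω).2 j)) (x, y) c := by
          funext c
          let S : Ω → Prop := fun ω => (ω ∈ D ∧ (X ω).1 ≠ some i) ∧ stripTags k ((X ω).2 i) = c ∧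
            env ω = x
          let F : Ω → Option (Fin 7) × ({j : Fin 7 // j ≠ i} → Cfg k) := fun ω =>
            ((X ω).1, fun j => (X ω).2 j)
          have h1 : ∀ y, law μ {ω | ω ∈ D ∧ (X ω).1 ≠ some i} (fun ω => stripTags k ((X ω).2 i))
              (fun ω => (env ω, (X ω).1, fun j : {j : Fin 7 // j ≠ i} => (X ω).2 j)) (x, y) c =
              E μ fun ω => ind (S ω ∧ F ω = y) := by
            intro y
            rw [law]
            congr 1; funext ω
            refine ind_congr ⟨fun ⟨a, b, c⟩ => ?_, fun ⟨⟨a, b, c⟩, d⟩ => ⟨a, b, Prod.ext c d⟩⟩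
            exact ⟨⟨a, b, congrArg Prod.fst c⟩, congrArg Prod.snd c⟩
          simp only [h1]
          rw [← E_fiber F Q S, law]
          congr 1; funext ω
          refine ind_congr ⟨?_, ?_⟩
          · rintro ⟨a, b, c'⟩
            have h2 : (X ω).1 = t := congrArg tagC b
            have h3 : ∀ j, f j ((X ω).2 j) = Function.update g i c j := by
              intro j
              have := congrFun (congrArg subC b) j
              change (if (X ω).1 = some j then untag k ((X ω).2 j).err else stripTags k ((X ω).2 j)) =
                Function.update g i c j at this
              rw [h2] at this
              exact this
            refine ⟨⟨⟨a, by rw [h2]; exact ht⟩, ?_, c'⟩, h2, fun j => ?_⟩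
            · have := h3 i
              simpa [f, ht] using this
            · have := h3 j.1
              rwa [Function.update_of_ne j.2] at this
          · rintro ⟨⟨⟨a, -⟩, b, c'⟩, h2, h3⟩
            refine ⟨a, ?_, c'⟩
            have h2' : (X ω).1 = t := h2
            refine Prod.ext h2' ?_
            funext j
            change (if (X ω).1 = some j then untag k ((X ω).2 j).err else stripTags k ((X ω).2 j)) =
              Function.update g i c j
            rw [h2']
            by_cases hj : j = i
            · subst hj
              simpa [ht] using b
            · rw [Function.update_of_ne hj]
              exact h3 ⟨j, hj⟩
        rw [e]
        exact TW.tsum _ _ fun y =>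
          (h.2.2 i).tw (fun j h1 h2 => hp j h1 (by omega)) (x, y)

end Wellness

/-! ## Logical effect -/

theorem sign_add (a b : ZMod 2) : sign (a + b) = sign a * sign b := by
  have h : ∀ a : ZMod 2, a = 0 ∨ a = 1 := by decide
  rcases h a with rfl | rfl <;> rcases h b with rfl | rfl <;>
    simp [sign, show (1 : ZMod 2) + 1 = 0 from by decide]

/-- Conjugation by CNOT moves Pauli products as `propagate` does. With Z-parts acting after X-parts
the signs agree exactly, so the phase `1` works. -/
theorem correctCNOT_of_state {k : ℕ} {e f : Err k × Err k}
    (h : (state k f.1, state k f.2) = propagate (state k e.1, state k e.2)) : CorrectCNOT e f := by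
  intro S ψ
  refine ⟨1, by simp, ?_⟩
  obtain ⟨h1, h2⟩ := Prod.mk.inj h
  rw [one_smul]
  funext x
  obtain ⟨⟨a, b⟩, s⟩ := x
  simp only [decode, h1, h2, pauliAct, cnotAct]
  generalize state k e.1 = P
  generalize state k e.2 = Q
  have e1 : b - (P.1 + Q.1) - (a - P.1) = b - a - Q.1 := by ring
  rw [e1, ← sign_add, ← sign_add]
  congr 2
  have : ∀ a b c d : ZMod 2, (a + b) * c + b * d = a * c + b * (d - c) := by decide
  exact this _ _ _ _

/-! ## Runs -/

section Runs

variable {W : Type v} {k : ℕ} {N : Noise} {μ : PMF ((Err k × Err k) × W)}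

/-- The run of an instrumented CNOT on configurations. -/
def runLaw (G : Cfg k × Cfg k → PMF ((Cfg k × Cfg k) × Bool)) (ν : PMF ((Cfg k × Cfg k) × W)) :
    PMF (Run k W) :=
  ν.bind fun x => (G x.1).map fun y => ⟨(x.1.1.err, x.1.2.err), x.2, y.1.1, y.1.2, y.2⟩

/-- Well inputs come with tags, from which those inside uncontrolled subblocks are erased. Other
inputs are left untagged: this is tag-well at no cost, and validity is not claimed for them. -/
theorem exists_input (p : ℕ → ℝ) (hp : ∀ j, 1 ≤ j → j ≤ k → 0 ≤ p j) :
    ∃ ν : PMF ((Cfg k × Cfg k) × W), ν.map (fun x => ((x.1.1.err, x.1.2.err), x.2)) = μ ∧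
      (∀ x, PairTW (fun j => ENNReal.ofReal (p j)) k fun c => ν (c, x)) ∧
      (InputsWell p k μ → ∀ x ∈ ν.support, Valid k x.1.1 ∧ Valid k x.1.2) := by
  by_cases h : InputsWell p k μ
  · obtain ⟨ν, h1, h2, h3⟩ := h
    have e : ∀ c y x, (ν.map fun x => ((stripTags k x.1.1, stripTags k x.1.2), x.2)) ((c, y), x) =
        E ν fun z => ind ((stripTags k z.1.1 = c ∧ z.2 = x) ∧ stripTags k z.1.2 = y) := by
      intro c y x
      rw [map_apply_E]
      congr 1; funext z
      refine ind_congr ⟨fun e => ?_, fun ⟨⟨a, b⟩, d⟩ => by rw [a, b, d]⟩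
      obtain ⟨e1, e2⟩ := Prod.mk.inj e
      obtain ⟨e3, e4⟩ := Prod.mk.inj e1
      exact ⟨⟨e3, e2⟩, e4⟩
    refine ⟨ν.map fun x => ((stripTags k x.1.1, stripTags k x.1.2), x.2), ?_, fun x => ⟨fun y => ?_,
      fun c => ?_⟩, fun _ x hx => ?_⟩
    · rw [PMF.map_comp, ← h1]
      congr 1; funext x
      simp only [Function.comp, stripTags_err]
    · have : (fun c => (ν.map fun x => ((stripTags k x.1.1, stripTags k x.1.2), x.2)) ((c, y), x)) =
          fun c => ∑' y', ind (stripTags k y' = y) *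
            law ν Set.univ (fun z => stripTags k z.1.1) (fun z => (z.1.2, z.2)) (y', x) c := by
        funext c
        rw [e, E_fiber (fun z : (Cfg k × Cfg k) × W => z.1.2) (fun y' => stripTags k y' = y)]
        refine tsum_congr fun y' => ?_
        congr 2; funext z
        refine ind_congr ⟨fun ⟨⟨a, b⟩, d⟩ => ⟨trivial, a, Prod.ext d b⟩, fun ⟨_, a, b⟩ => ?_⟩
        exact ⟨⟨a, (Prod.mk.inj b).2⟩, (Prod.mk.inj b).1⟩
      rw [this]
      exact TW.tsum _ _ fun y' => h2.tw hp _
    · have : (fun y => (ν.map fun x => ((stripTags k x.1.1, stripTags k x.1.2), x.2)) ((c, y), x)) =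
          fun y => ∑' c', ind (stripTags k c' = c) *
            law ν Set.univ (fun z => stripTags k z.1.2) (fun z => (z.1.1, z.2)) (c', x) y := by
        funext y
        have e' : (E ν fun z => ind ((stripTags k z.1.1 = c ∧ z.2 = x) ∧ stripTags k z.1.2 = y)) =
            E ν fun z => ind ((stripTags k z.1.2 = y ∧ z.2 = x) ∧ stripTags k z.1.1 = c) := by
          congr 1; funext z
          exact ind_congr (by tauto)
        rw [e, e', E_fiber (fun z : (Cfg k × Cfg k) × W => z.1.1) (fun c' => stripTags k c' = c)]
        refine tsum_congr fun y' => ?_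
        congr 2; funext z
        refine ind_congr ⟨fun ⟨⟨a, b⟩, d⟩ => ⟨trivial, a, Prod.ext d b⟩, fun ⟨_, a, b⟩ => ?_⟩
        exact ⟨⟨a, (Prod.mk.inj b).2⟩, (Prod.mk.inj b).1⟩
      rw [this]
      exact TW.tsum _ _ fun y' => h3.tw hp _
    · obtain ⟨z, hz, rfl⟩ := (PMF.mem_support_map_iff _ _ _).1 hx
      exact ⟨valid_stripTags k (h2.valid z hz trivial), valid_stripTags k (h3.valid z hz trivial)⟩
  · have hu : ∀ x ∈ (μ.map fun x => ((untag k x.1.1, untag k x.1.2), x.2)).support,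
        x.1.1 = untag k x.1.1.err ∧ x.1.2 = untag k x.1.2.err := by
      intro x hx
      obtain ⟨z, -, rfl⟩ := (PMF.mem_support_map_iff _ _ _).1 hx
      simp only [untag_err, and_self]
    refine ⟨μ.map fun x => ((untag k x.1.1, untag k x.1.2), x.2), ?_, fun x => ⟨fun y => ?_,
      fun c => ?_⟩, fun h' => absurd h' h⟩
    · rw [PMF.map_comp]
      simp only [Function.comp_def, untag_err]
      exact PMF.map_id μ
    · exact TW.of_untagged fun c hc => (hu _ ((PMF.mem_support_iff _ _).2 hc)).1
    · exact TW.of_untagged fun y hy => (hu _ ((PMF.mem_support_iff _ _).2 hy)).2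

end Runs

end
end SteaneFT

/-! ### The theorem, from instrumented operations and instrumented inputs -/

open SteaneFT
theorem mainTheorem2 {W : Type*} (N : Noise) (k : ℕ)
    (hN : ∀ j, 1 ≤ j → j ≤ k → (rates N.p j).InRange)
    (loc : List ℕ) (μ : PMF ((Err k × Err k) × W)) :
    ∃ J : PMF (Run k W),
      J.map (fun r => ((r.input, r.rest), r.output)) = cnotLaw N k loc μ ∧
      prob J {r | r.failed = true} ≤ (rates N.p k).C ∧
      PairWell J (fun j => (rates N.p j).b) k {r | r.failed = false}
        Run.out₁ Run.out₂ Run.rest ∧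
      (InputsWell (fun j => (rates N.p j).b) k μ →
        ∀ r ∈ J.support, r.failed = false → CorrectCNOT r.input r.output) := by
  have hp : ∀ j, 1 ≤ j → j ≤ k → 0 ≤ (rates N.p j).b := fun j _ hj =>
    rates_b_nonneg N.p.coe_nonneg hN hj
  obtain ⟨ν, hν, htw, hval⟩ := exists_input (μ := μ) (fun j => (rates N.p j).b) hp
  obtain ⟨K, hK⟩ := exists_iops N k hN
  have hc := hK.cnot loc
  have hsupp : ∀ r ∈ (runLaw (K.cnot loc) ν).support, ∃ x ∈ ν.support, ∃ y ∈ (K.cnot loc x.1).support,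
      r = ⟨(x.1.1.err, x.1.2.err), x.2, y.1.1, y.1.2, y.2⟩ := by
    intro r hr
    obtain ⟨x, hx, hr⟩ := (PMF.mem_support_bind_iff _ _ _).1 hr
    obtain ⟨y, hy, rfl⟩ := (PMF.mem_support_map_iff _ _ _).1 hr
    exact ⟨x, hx, y, hy, rfl⟩
  have hvalid : ∀ r ∈ (runLaw (K.cnot loc) ν).support, r.failed = false →
      Valid k r.out₁ ∧ Valid k r.out₂ := by
    intro r hr hf
    obtain ⟨x, -, y, hy, rfl⟩ := hsupp r hr
    exact hc.valid _ y hy hf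
  refine ⟨runLaw (K.cnot loc) ν, ?_, ?_, ⟨?_, ?_⟩, ?_⟩
  · rw [runLaw, PMF.map_bind, cnotLaw, ← hν, PMF.bind_map]
    congr 1; funext x
    rw [PMF.map_comp, Function.comp, ← hc.err, PMF.map_comp]
    rfl
  · rw [prob_eq]
    refine ENNReal.toReal_le_of_le_ofReal (rates_nonneg N.p.coe_nonneg k hN).2.2 ?_
    rw [runLaw, E_bind]
    simp only [E_map]
    rw [E, ENNReal.tsum_prod', ENNReal.tsum_comm]
    calc _ ≤ ∑' x, ENNReal.ofReal (rates N.p k).C * mass (fun c => ν (c, x)) :=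
          ENNReal.tsum_le_tsum fun x => hc.fail _ (htw x)
      _ = ENNReal.ofReal (rates N.p k).C * mass ν := by
          rw [ENNReal.tsum_mul_left, mass_prod ν, ENNReal.tsum_comm]
          rfl
      _ = _ := by rw [mass_pmf, mul_one]
  · refine well_of_tw k _ _ _ hp (fun x => ?_) fun r hr hf => (hvalid r hr hf).1
    -- Given the rest and the other output, this output is a mixture over inputs of sections of the
    -- instrumented gate. These are tag-well for every input, so the input law is irrelevant.
    have e : law (runLaw (K.cnot loc) ν) {r | r.failed = false} Run.out₁
        (fun r => (r.out₂, r.rest)) x = fun c => ∑' z, (ν z * ind (z.2 = x.2)) *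
          K.cnot loc z.1 ((c, x.1), false) := by
      funext c
      rw [law, runLaw, E_bind]
      refine tsum_congr fun z => ?_
      beta_reduce
      rw [mul_assoc, E_map, apply_eq_E (K.cnot loc z.1), ← E_mul_left _ _ (ind (z.2 = x.2))]
      congr 2; funext y
      rw [← ind_and]
      refine ind_congr ⟨fun ⟨a, b, d⟩ => ?_, fun ⟨a, b⟩ => ?_⟩
      · exact ⟨congrArg Prod.snd d, Prod.ext (Prod.ext b (congrArg Prod.fst d)) a⟩
      · rw [b]
        exact ⟨rfl, rfl, Prod.ext rfl a⟩
    rw [e]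
    exact TW.tsum _ _ fun z => (hc.tw z.1 false).1 x.1
  · refine well_of_tw k _ _ _ hp (fun x => ?_) fun r hr hf => (hvalid r hr hf).2
    have e : law (runLaw (K.cnot loc) ν) {r | r.failed = false} Run.out₂
        (fun r => (r.out₁, r.rest)) x = fun c => ∑' z, (ν z * ind (z.2 = x.2)) *
          K.cnot loc z.1 ((x.1, c), false) := by
      funext c
      rw [law, runLaw, E_bind]
      refine tsum_congr fun z => ?_
      beta_reduce
      rw [mul_assoc, E_map, apply_eq_E (K.cnot loc z.1), ← E_mul_left _ _ (ind (z.2 = x.2))]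
      congr 2; funext y
      rw [← ind_and]
      refine ind_congr ⟨fun ⟨a, b, d⟩ => ?_, fun ⟨a, b⟩ => ?_⟩
      · exact ⟨congrArg Prod.snd d, Prod.ext (Prod.ext (congrArg Prod.fst d :) b) a⟩
      · rw [b]
        exact ⟨rfl, rfl, Prod.ext rfl a⟩
    rw [e]
    exact TW.tsum _ _ fun z => (hc.tw z.1 false).2 x.1
  · intro hw r hr hf
    obtain ⟨x, hx, y, hy, rfl⟩ := hsupp r hr
    obtain ⟨v1, v2⟩ := hval hw x hx
    exact correctCNOT_of_state (hc.state x.1 v1 v2 y hy hf)
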